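/- **Setting.** Let $\mathsf H_{\mathbb R}$ be a finite-dimensional real Hilbert space, $(U_t)_{t\in\mathbb R}$ a strongly continuous one-parameter group of orthogonal operators on $\mathsf H_{\mathbb R}$, and $\mathsf H_{\mathbb R}=\bigoplus_{i\in N}\mathsf H_{\mathbb R}^{(i)}$ ($N$ finite) an orthogonal decomposition into $U$-invariant subspaces; let $q(i,j)=q(j,i)\in(-1,1)$ for $i,j\in N$. Inner products are linear in the second variable. Let $\mathsf H_{\mathbb C}$ be the complexification of $\mathsf H_{\mathbb R}$, with conjugation $\xi\mapsto\bar\xi$; let $A$ be the positive operator on $\mathsf H_{\mathbb C}$ with $U_t=A^{it}$, and let $\mathsf H_U$ be $\mathsf H_{\mathbb C}$ with $\langle\xi,\zeta\rangle_U=\langle\xi,2(1+A^{-1})^{-1}\zeta\rangle$. Let $T$ be the operator on $\mathsf H_U\otimes\mathsf H_U$ with $T(\xi\otimes\eta)=q(i,j)\,\eta\otimes\xi$ for $\xi\in\mathsf H_{\mathbb C}^{(i)}$, $\eta\in\mathsf H_{\mathbb C}^{(j)}$. Let $T_k$ denote $T$ acting on the tensor factors $k,k+1$, let $\Phi$ be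 the quasi-multiplicative extension of $\tau_k\mapsto T_k$ to the symmetric group $S_n$, and let $P^{(n)}=\sum_{\sigma\in S_n}\Phi(\sigma)$. Let $\mathcal F_{\rm alg}=\bigoplus_n\mathsf H_U^{\otimes n}$ (algebraic direct sum, with $\mathsf H_U^{\otimes 0}=\mathbb C\Omega$), with $\langle x,y\rangle_T=\sum_n\langle x_n,P^{(n)}y_n\rangle$, and let $\mathcal F_T$ be its completion. On $\mathcal F_T$ let $a^*(\xi)$ be the bounded extension of $x\mapsto\xi\otimes x$, $a(\xi)$ its adjoint, and $s(\xi)=a(\xi)+a^*(\xi)$ for $\xi\in\mathsf H_{\mathbb R}$. Let $\mathsf M_T$ be the von Neumann algebra generated by $\{s(\xi):\xi\in\mathsf H_{\mathbb R}\}$, let $\varphi=\langle\Omega,\cdot\,\Omega\rangle_T$, and let $W(\xi)=a^*(\xi)+a(\bar\xi)\in\mathsf M_T$ for $\xi\in\mathsf H_U$. Let $e_1,\dots,e_d$ be an orthonormal basis of $\mathsf H_U$ such that each $e_k$ lies in $\mathsf H_{\mathbb C}^{(j_k)}$ for some $j_k\in N$. Put $A_k=W(e_k)$, and let $\mathbb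 C[A_1,\dots,A_d]$ be the unital $*$-algebra generated by the $A_k$. For a word $w=\beta_1\cdots\beta_n$ put $e_w=e_{\beta_1}\otimes\cdots\otimes e_{\beta_n}$, with $e_{()}=\Omega$; these vectors form a linear basis of $\mathcal F_{\rm alg}$. **Dual variables.** Let $B(n+1)$ be the set of partitions $\pi$ of $\{0,\dots,n\}$ into pairs and singletons in which $0$ is paired with some $\pi(0)\ge1$, every $\ell$ with $0<\ell<\pi(0)$ is paired with an element of $\{\pi(0)+1,\dots,n\}$, and all remaining elements are singletons. Write $\pi(k)$ for the partner of $k$, with $\pi(k)=k$ for singletons, $p(\pi)$ for the set of pairs and $s(\pi)$ for the set of singletons. For $\alpha\in\{1,\dots,d\}$ let $D_\alpha$ be the unbounded operator on $\mathcal F_T$ with domain $\mathcal F_{\rm alg}$ given by $D_\alpha\Omega=0$ and $$D_\alpha e_{\alpha_n\cdots\alpha_1}=\sum_{\pi\in B(n+1)}(-1)^{\pi(0)-1}Q(\pi)E(\pi)\,e_{s(\pi)},$$ where, with $\alpha_0=\alpha$ and $i_k=j_{\alpha_k}$, $$Q(\pi)=\prod_{0\le v<u<\pi(0)}q(i_v,i_u)\prod_{\substack{0<v<u<\pi(0)\\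 \pi(v)>\pi(u)}}q(i_{\pi(v)},i_{\pi(u)})\prod_{\substack{\pi(0)<v<u\le n\\ v\in s(\pi),\,u\notin s(\pi)}}q(i_v,i_u),\qquad E(\pi)=\prod_{\substack{(k,\ell)\in p(\pi)\\ k>\ell}}\langle\bar e_{\alpha_k},e_{\alpha_\ell}\rangle_U,$$ and $e_{s(\pi)}=e_{\alpha_{\ell_s}}\otimes\cdots\otimes e_{\alpha_{\ell_1}}$ if $s(\pi)=\{\ell_s>\dots>\ell_1\}$ (and $e_{s(\pi)}=\Omega$ if $s(\pi)=\emptyset$). **Theorem.** For every $\alpha\in\{1,\dots,d\}$ one has $\Omega\in\operatorname{dom}D_\alpha^*$, and $(D_1^*\Omega,\dots,D_d^*\Omega)$ is a system of conjugate variables for $(A_1,\dots,A_d)$. That is, for every $k$ there is a unique linear map $\partial_k:\mathbb C[A_1,\dots,A_d]\to\mathsf M_T\otimes\mathsf M_T^{\rm op}$ (the quasi-free difference quotient) such that $$\partial_k(ab)=(a\otimes1)\,\partial_k(b)+(1\otimes b^{\rm op})\,\partial_k(a),\qquad \partial_k(A_\ell)=\varphi(A_\ell A_k)\,1\otimes1$$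 for all $a,b\in\mathbb C[A_1,\dots,A_d]$ and all $\ell$, and $$\langle D_k^*\Omega,\,x\Omega\rangle_T=(\varphi\otimes\varphi^{\rm op})(\partial_k x)=\langle 1\otimes1,\partial_k x\rangle_{L^2(\mathsf M_T\otimes\mathsf M_T^{\rm op})}\qquad\text{for all }x\in\mathbb C[A_1,\dots,A_d].$$ -/

import Mathlib

open scoped InnerProductSpace TensorProduct DirectSum ComplexConjugate LinearPMap

noncomputable section

namespace MixedQAW

/-- The complexification `E + iE` of a real vector space `E`. -/
@[ext] structure Cx (E : Type*) where
  re : E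
  im : E

namespace Cx

section Module

variable {E : Type*} [AddCommGroup E]

instance : Zero (Cx E) := ⟨⟨0, 0⟩⟩
instance : Add (Cx E) := ⟨fun x y => ⟨x.re + y.re, x.im + y.im⟩⟩
instance : Neg (Cx E) := ⟨fun x => ⟨-x.re, -x.im⟩⟩
instance : Sub (Cx E) := ⟨fun x y => ⟨x.re - y.re, x.im - y.im⟩⟩

@[simp] theorem zero_re : (0 : Cx E).re = 0 := rfl
@[simp] theorem zero_im : (0 : Cx E).im = 0 := rfl
@[simp] theorem add_re (x y : Cx E) : (x + y).re = x.re + y.re := rfl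
@[simp] theorem add_im (x y : Cx E) : (x + y).im = x.im + y.im := rfl
@[simp] theorem neg_re (x : Cx E) : (-x).re = -x.re := rfl
@[simp] theorem neg_im (x : Cx E) : (-x).im = -x.im := rfl
@[simp] theorem sub_re (x y : Cx E) : (x - y).re = x.re - y.re := rfl
@[simp] theorem sub_im (x y : Cx E) : (x - y).im = x.im - y.im := rfl

instance : AddCommGroup (Cx E) where
  add_assoc x y z := by ext <;> simp [add_assoc]
  zero_add x := by ext <;> simp
  add_zero x := by ext <;> simp
  add_comm x y := by ext <;> simp [add_comm]
  neg_add_cancel x := by ext <;> simp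
  sub_eq_add_neg x y := by ext <;> simp [sub_eq_add_neg]
  nsmul := nsmulRec
  zsmul := zsmulRec

variable [Module ℝ E]

instance : SMul ℂ (Cx E) :=
  ⟨fun z x => ⟨z.re • x.re - z.im • x.im, z.re • x.im + z.im • x.re⟩⟩

@[simp] theorem smul_re (z : ℂ) (x : Cx E) : (z • x).re = z.re • x.re - z.im • x.im := rfl
@[simp] theorem smul_im (z : ℂ) (x : Cx E) : (z • x).im = z.re • x.im + z.im • x.re := rfl

instance : Module ℂ (Cx E) where
  one_smul x := by ext <;> simp
  mul_smul a b x := by ext <;> simp <;> module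
  smul_zero a := by ext <;> simp
  smul_add a x y := by ext <;> simp <;> module
  add_smul a b x := by ext <;> simp <;> module
  zero_smul x := by ext <;> simp

/-- The inclusion `E ⊆ E + iE`. -/
def ofReal (x : E) : Cx E := ⟨x, 0⟩

/-- The complex-linear extension of a real-linear map. -/
def mapₗ (f : E →ₗ[ℝ] E) : Cx E →ₗ[ℂ] Cx E where
  toFun x := ⟨f x.re, f x.im⟩
  map_add' x y := by ext <;> simp
  map_smul' a x := by ext <;> simp

@[simp] theorem mapₗ_re (f : E →ₗ[ℝ] E) (x : Cx E) : (mapₗ f x).re = f x.re := rfl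
@[simp] theorem mapₗ_im (f : E →ₗ[ℝ] E) (x : Cx E) : (mapₗ f x).im = f x.im := rfl

instance [Module.Finite ℝ E] : Module.Finite ℂ (Cx E) := by
  classical
  obtain ⟨s, hs⟩ := Module.Finite.fg_top (R := ℝ) (M := E)
  refine ⟨⟨s.image ofReal, ?_⟩⟩
  have key : ∀ x : E, ofReal x ∈ Submodule.span ℂ (ofReal '' (s : Set E)) := by
    intro x
    have hx : x ∈ Submodule.span ℝ (s : Set E) := by rw [hs]; trivial
    induction hx using Submodule.span_induction with
    | mem x h => exact Submodule.subset_span ⟨x, h, rfl⟩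
    | zero => exact Submodule.zero_mem _
    | add x y _ _ hx hy =>
      have : ofReal (x + y) = ofReal x + ofReal y := by ext <;> simp [ofReal]
      rw [this]; exact Submodule.add_mem _ hx hy
    | smul a x _ hx =>
      have : ofReal (a • x) = (a : ℂ) • ofReal x := by
        ext
        · rw [smul_re]; simp [ofReal]
        · rw [smul_im]; simp [ofReal]
      rw [this]; exact Submodule.smul_mem _ _ hx
  rw [eq_top_iff]
  intro x _
  have : x = ofReal x.re + Complex.I • ofReal x.im := by ext <;> simp [ofReal]
  rw [this, Finset.coe_image]
  exact Submodule.add_mem _ (key _) (Submodule.smul_mem _ _ (key _))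

end Module

section Inner

variable {E : Type*} [NormedAddCommGroup E] [InnerProductSpace ℝ E]

/-- The hermitian extension of the inner product, linear in the second variable. -/
abbrev core : InnerProductSpace.Core ℂ (Cx E) where
  inner x y := ⟨⟪x.re, y.re⟫_ℝ + ⟪x.im, y.im⟫_ℝ, ⟪x.re, y.im⟫_ℝ - ⟪x.im, y.re⟫_ℝ⟩
  conj_inner_symm x y := by
    apply Complex.ext
    · simp [real_inner_comm]
    · simp only [Complex.conj_im]; rw [real_inner_comm x.im, real_inner_comm x.re]; ring
  re_inner_nonneg x := by
    simp only [RCLike.re_to_complex]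
    exact add_nonneg real_inner_self_nonneg real_inner_self_nonneg
  add_left x y z := by
    apply Complex.ext <;> simp [inner_add_left] <;> ring
  smul_left x y a := by
    apply Complex.ext <;> simp [inner_add_left, inner_sub_left, real_inner_smul_left] <;> ring
  definite x h := by
    have h1 := congrArg Complex.re h
    simp only [Complex.zero_re] at h1
    have h2 := real_inner_self_nonneg (x := x.re)
    have h3 := real_inner_self_nonneg (x := x.im)
    ext
    · exact inner_self_eq_zero.mp (by linarith : ⟪x.re, x.re⟫_ℝ = 0)
    · exact inner_self_eq_zero.mp (by linarith : ⟪x.im, x.im⟫_ℝ = 0)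

instance : NormedAddCommGroup (Cx E) :=
  InnerProductSpace.Core.toNormedAddCommGroup (𝕜 := ℂ) (cd := core)

instance : InnerProductSpace ℂ (Cx E) := InnerProductSpace.ofCore core.toCore

theorem inner_def (x y : Cx E) : ⟪x, y⟫_ℂ =
    ⟨⟪x.re, y.re⟫_ℝ + ⟪x.im, y.im⟫_ℝ, ⟪x.re, y.im⟫_ℝ - ⟪x.im, y.re⟫_ℝ⟩ := rfl

end Inner

end Cx

section Tensor

variable {H : Type*} [NormedAddCommGroup H] [InnerProductSpace ℂ H]

/-- The functional `η₁ ⊗ ⋯ ⊗ ηₙ ↦ ∏ ⟪ξₜ, ηₜ⟫`. -/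
def pairing (n : ℕ) (ξ : Fin n → H) : ⨂[ℂ]^n H →ₗ[ℂ] ℂ :=
  PiTensorProduct.lift
    ((MultilinearMap.mkPiAlgebra ℂ (Fin n) ℂ).compLinearMap fun t => (innerₛₗ ℂ (ξ t)))

theorem pairing_tprod (n : ℕ) (ξ η : Fin n → H) :
    pairing n ξ (PiTensorProduct.tprod ℂ η) = ∏ t, ⟪ξ t, η t⟫_ℂ := by
  simp [pairing]

theorem pairing_update_add (n : ℕ) [DecidableEq (Fin n)] (ξ : Fin n → H) (i : Fin n) (x y : H)
    (z : ⨂[ℂ]^n H) : pairing n (Function.update ξ i (x + y)) z =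
      pairing n (Function.update ξ i x) z + pairing n (Function.update ξ i y) z := by
  induction z using PiTensorProduct.induction_on with
  | smul_tprod r η =>
    simp only [map_smul, pairing_tprod, ← smul_add]
    congr 1
    rw [Fintype.prod_eq_mul_prod_compl i, Fintype.prod_eq_mul_prod_compl i,
      Fintype.prod_eq_mul_prod_compl i]
    have h : ∀ w : H, ∏ t ∈ {i}ᶜ, ⟪Function.update ξ i w t, η t⟫_ℂ = ∏ t ∈ {i}ᶜ, ⟪ξ t, η t⟫_ℂ :=
      fun w => Finset.prod_congr rfl fun t ht => by
        rw [Function.update_of_ne (by simpa using ht)]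
    rw [h, h, h]
    simp only [Function.update_self, inner_add_left]
    ring
  | add a b ha hb => rw [map_add, map_add, map_add, ha, hb]; ring

theorem pairing_update_smul (n : ℕ) [DecidableEq (Fin n)] (ξ : Fin n → H) (i : Fin n) (c : ℂ)
    (x : H) (z : ⨂[ℂ]^n H) : pairing n (Function.update ξ i (c • x)) z =
      conj c * pairing n (Function.update ξ i x) z := by
  induction z using PiTensorProduct.induction_on with
  | smul_tprod r η =>
    simp only [map_smul, pairing_tprod, smul_eq_mul]
    rw [Fintype.prod_eq_mul_prod_compl i, Fintype.prod_eq_mul_prod_compl i]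
    have h : ∀ w : H, ∏ t ∈ {i}ᶜ, ⟪Function.update ξ i w t, η t⟫_ℂ = ∏ t ∈ {i}ᶜ, ⟪ξ t, η t⟫_ℂ :=
      fun w => Finset.prod_congr rfl fun t ht => by
        rw [Function.update_of_ne (by simpa using ht)]
    rw [h, h]
    simp only [Function.update_self, inner_smul_left]
    ring
  | add a b ha hb => rw [map_add, map_add, ha, hb]; ring

/-- The inner product of `H ^ ⊗ n`, as a sesquilinear form: `tensorForm n y x = ⟪x, y⟫`, with
`⟪ξ₁ ⊗ ⋯ ⊗ ξₙ, η₁ ⊗ ⋯ ⊗ ηₙ⟫ = ∏ ⟪ξₜ, ηₜ⟫`. -/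
def tensorForm (n : ℕ) : ⨂[ℂ]^n H →ₗ[ℂ] (⨂[ℂ]^n H →ₗ⋆[ℂ] ℂ) :=
  PiTensorProduct.lift
    { toFun := fun η => (starLinearEquiv ℂ (A := ℂ)).toLinearMap.comp (pairing n η)
      map_update_add' := by
        intro _ η i x y
        refine LinearMap.ext fun z => ?_
        simp only [LinearMap.add_apply, LinearMap.comp_apply, pairing_update_add, map_add]
      map_update_smul' := by
        intro _ η i c x
        refine LinearMap.ext fun z => ?_
        simp [pairing_update_smul] }

theorem tensorForm_tprod (n : ℕ) (ξ η : Fin n → H) :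
    tensorForm n (PiTensorProduct.tprod ℂ η) (PiTensorProduct.tprod ℂ ξ) =
      ∏ t, ⟪ξ t, η t⟫_ℂ := by
  simp [tensorForm, pairing_tprod]

theorem form_ext {n : ℕ} {f g : ⨂[ℂ]^n H →ₗ[ℂ] (⨂[ℂ]^n H →ₗ⋆[ℂ] ℂ)}
    (h : ∀ ξ η, f (PiTensorProduct.tprod ℂ η) (PiTensorProduct.tprod ℂ ξ) =
      g (PiTensorProduct.tprod ℂ η) (PiTensorProduct.tprod ℂ ξ)) : f = g := by
  apply PiTensorProduct.ext
  ext1 η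
  refine LinearMap.ext fun z => ?_
  induction z using PiTensorProduct.induction_on with
  | smul_tprod r ξ =>
    simp only [LinearMap.compMultilinearMap_apply, LinearMap.map_smulₛₗ]
    rw [h]
  | add a b ha hb => rw [map_add, map_add, ha, hb]

theorem tensorForm_symm (n : ℕ) (x y : ⨂[ℂ]^n H) :
    conj (tensorForm n x y) = tensorForm n y x := by
  induction x using PiTensorProduct.induction_on with
  | smul_tprod r ξ =>
    induction y using PiTensorProduct.induction_on with
    | smul_tprod s η =>
      simp only [LinearMap.map_smulₛₗ, LinearMap.smul_apply, tensorForm_tprod, smul_eq_mul,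
        map_mul, map_prod, inner_conj_symm, RingHom.id_apply, Complex.conj_conj]
      ring
    | add a b ha hb => simp only [map_add, ha, hb, LinearMap.add_apply]
  | add a b ha hb => simp only [map_add, ha, hb, LinearMap.add_apply]

theorem tensorForm_self [FiniteDimensional ℂ H] (n : ℕ) (x : ⨂[ℂ]^n H) :
    0 ≤ (tensorForm n x x).re ∧ ((tensorForm n x x).re = 0 → x = 0) := by
  classical
  let b := stdOrthonormalBasis ℂ H
  let B := Basis.piTensorProduct (fun _ : Fin n => b.toBasis)
  have hB : ∀ p p', tensorForm n (B p) (B p') = if p' = p then 1 else 0 := by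
    intro p p'
    have hb := orthonormal_iff_ite.mp b.orthonormal
    simp only [B, Basis.piTensorProduct_apply, tensorForm_tprod, OrthonormalBasis.coe_toBasis, hb]
    simp [Fintype.prod_ite_zero, funext_iff]
  have h : (tensorForm n x x).re = ∑ p, ‖B.repr x p‖ ^ 2 := by
    conv_lhs => rw [← B.sum_repr x]
    simp only [map_sum, LinearMap.sum_apply, map_smul, LinearMap.smul_apply,
      LinearMap.map_smulₛₗ, hB, smul_eq_mul]
    simp only [mul_ite, mul_one, mul_zero, Finset.sum_ite_eq, Finset.mem_univ, if_true,
      Complex.re_sum]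
    refine Finset.sum_congr rfl fun p _ => ?_
    rw [← Complex.normSq_eq_norm_sq, mul_comm, Complex.mul_conj, Complex.ofReal_re]
  rw [h]
  refine ⟨Finset.sum_nonneg fun p _ => by positivity, fun h0 => ?_⟩
  rw [Finset.sum_eq_zero_iff_of_nonneg (fun p _ => by positivity)] at h0
  apply B.ext_elem
  intro p
  simpa using h0 p (Finset.mem_univ p)

variable {N : Type*} (q : N → N → ℝ) (p : N → H →ₗ[ℂ] H)

/-- The projection `p (c 1) ⊗ ⋯ ⊗ p (c n)`. -/
def colourProj {n : ℕ} (c : Fin n → N) : ⨂[ℂ]^n H →ₗ[ℂ] ⨂[ℂ]^n H :=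
  PiTensorProduct.map fun t => p (c t)

/-- The action of a permutation on the tensor factors:
`ξ₁ ⊗ ⋯ ⊗ ξₙ ↦ ξ_{σ⁻¹(1)} ⊗ ⋯ ⊗ ξ_{σ⁻¹(n)}`. -/
def permute {n : ℕ} (σ : Equiv.Perm (Fin n)) : ⨂[ℂ]^n H →ₗ[ℂ] ⨂[ℂ]^n H :=
  (PiTensorProduct.reindex ℂ (fun _ => H) σ).toLinearMap

/-- The product of `q (c u) (c v)` over the inversions `u < v`, `σ v < σ u` of `σ`. -/
def inversionWeight {n : ℕ} (σ : Equiv.Perm (Fin n)) (c : Fin n → N) : ℝ :=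
  ∏ u, ∏ v, if u < v ∧ σ v < σ u then q (c u) (c v) else 1

/-- The quasi-multiplicative extension `Φ` of `τ_k ↦ T_k` to the symmetric group: if `ξ_t` has
colour `c t`, then `Φ(σ) (ξ₁ ⊗ ⋯ ⊗ ξₙ)` is the permuted tensor, multiplied by `q (c u) (c v)` for
every inversion `u < v` of `σ`. -/
def Phi [Fintype N] {n : ℕ} (σ : Equiv.Perm (Fin n)) : ⨂[ℂ]^n H →ₗ[ℂ] ⨂[ℂ]^n H :=
  ∑ c : Fin n → N, (inversionWeight q σ c : ℂ) • (permute σ ∘ₗ colourProj p c)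

/-- The operator `P⁽ⁿ⁾ = ∑ Φ(σ)`. -/
def symmetrizer [Fintype N] (n : ℕ) : ⨂[ℂ]^n H →ₗ[ℂ] ⨂[ℂ]^n H := ∑ σ : Equiv.Perm (Fin n), Phi q p σ

/-- `twistedForm n y x = ⟪x, P⁽ⁿ⁾ y⟫`. -/
def twistedForm [Fintype N] (n : ℕ) : ⨂[ℂ]^n H →ₗ[ℂ] (⨂[ℂ]^n H →ₗ⋆[ℂ] ℂ) :=
  tensorForm n ∘ₗ symmetrizer q p n

/-- The product of `q (b r) (b s)` over the pairs which `ρ` and `τ` order differently. -/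
def kernel {n : ℕ} (b : Fin n → N) (ρ τ : Equiv.Perm (Fin n)) : ℝ :=
  ∏ r, ∏ s, if τ r < τ s ∧ ρ s < ρ r then q (b r) (b s) else 1

theorem schur_bound {R ι : Type*} [Fintype R] [DecidableEq ι] (k : R → R → ℝ)
    (hk : ∀ w : R → ℝ, 0 ≤ ∑ ρ, ∑ τ, w ρ * w τ * k ρ τ) (a : ι → ℝ) (ha : ∀ i, |a i| < 1)
    (χ : ι → R → Bool) (I : Finset ι) : ∀ w : R → ℝ,
    0 ≤ ∑ ρ, ∑ τ, (∏ i ∈ I, if χ i ρ = χ i τ then (1 : ℝ) else 0) * (w ρ * w τ * k ρ τ) ∧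
    (∏ i ∈ I, (1 - |a i|)) *
      ∑ ρ, ∑ τ, (∏ i ∈ I, if χ i ρ = χ i τ then (1 : ℝ) else 0) * (w ρ * w τ * k ρ τ) ≤
      ∑ ρ, ∑ τ, (∏ i ∈ I, if χ i ρ = χ i τ then (1 : ℝ) else a i) * (w ρ * w τ * k ρ τ) := by
  induction I using Finset.induction_on with
  | empty => intro w; simpa using hk w
  | insert i I hi ih =>
    intro w
    let w1 : R → ℝ := fun ρ => if χ i ρ then w ρ else 0
    let w2 : R → ℝ := fun ρ => if χ i ρ then 0 else w ρ
    let w3 : R → ℝ := fun ρ => (if 0 ≤ a i then 1 else if χ i ρ then 1 else -1) * w ρ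
    have hG : ∑ ρ, ∑ τ, (∏ j ∈ insert i I, if χ j ρ = χ j τ then (1 : ℝ) else 0) *
          (w ρ * w τ * k ρ τ) =
        (∑ ρ, ∑ τ, (∏ j ∈ I, if χ j ρ = χ j τ then (1 : ℝ) else 0) * (w1 ρ * w1 τ * k ρ τ)) +
        ∑ ρ, ∑ τ, (∏ j ∈ I, if χ j ρ = χ j τ then (1 : ℝ) else 0) * (w2 ρ * w2 τ * k ρ τ) := by
      simp only [← Finset.sum_add_distrib]
      refine Finset.sum_congr rfl fun ρ _ => Finset.sum_congr rfl fun τ _ => ?_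
      rw [Finset.prod_insert hi]
      simp only [w1, w2]
      cases χ i ρ <;> cases χ i τ <;> simp
    have hF : ∑ ρ, ∑ τ, (∏ j ∈ insert i I, if χ j ρ = χ j τ then (1 : ℝ) else a j) *
          (w ρ * w τ * k ρ τ) =
        (1 - |a i|) *
        ((∑ ρ, ∑ τ, (∏ j ∈ I, if χ j ρ = χ j τ then (1 : ℝ) else a j) * (w1 ρ * w1 τ * k ρ τ)) +
        ∑ ρ, ∑ τ, (∏ j ∈ I, if χ j ρ = χ j τ then (1 : ℝ) else a j) * (w2 ρ * w2 τ * k ρ τ)) +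
        |a i| *
        ∑ ρ, ∑ τ, (∏ j ∈ I, if χ j ρ = χ j τ then (1 : ℝ) else a j) * (w3 ρ * w3 τ * k ρ τ) := by
      simp only [← Finset.sum_add_distrib, Finset.mul_sum]
      refine Finset.sum_congr rfl fun ρ _ => Finset.sum_congr rfl fun τ _ => ?_
      rw [Finset.prod_insert hi]
      simp only [w1, w2, w3]
      by_cases h : 0 ≤ a i
      · rw [abs_of_nonneg h]
        cases χ i ρ <;> cases χ i τ <;> simp [h] <;> ring
      · rw [abs_of_neg (not_le.mp h)]
        cases χ i ρ <;> cases χ i τ <;> simp [h] <;> ring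
    have hc : 0 ≤ 1 - |a i| := by linarith [ha i]
    have e1 := ih w1
    have e2 := ih w2
    have e3 := ih w3
    have hp : 0 ≤ ∏ j ∈ I, (1 - |a j|) :=
      Finset.prod_nonneg fun j _ => by linarith [ha j]
    rw [hG, hF, Finset.prod_insert hi]
    refine ⟨add_nonneg e1.1 e2.1, ?_⟩
    have e4 := le_trans (mul_nonneg hp e3.1) e3.2
    have e5 := mul_le_mul_of_nonneg_left (add_le_add e1.2 e2.2) hc
    have e6 := mul_nonneg (abs_nonneg (a i)) e4
    nlinarith [e5, e6]

variable {q p}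

theorem kernel_eq {n : ℕ} (b : Fin n → N) (ρ τ : Equiv.Perm (Fin n)) :
    inversionWeight q (ρ * τ⁻¹) (b ∘ τ.symm) = kernel q b ρ τ := by
  unfold inversionWeight kernel
  rw [← Equiv.prod_comp τ]
  refine Finset.prod_congr rfl fun r _ => ?_
  rw [← Equiv.prod_comp τ]
  refine Finset.prod_congr rfl fun s _ => ?_
  simp

theorem kernel_symm (hq : ∀ i j, q i j = q j i) {n : ℕ} (b : Fin n → N)
    (ρ τ : Equiv.Perm (Fin n)) : kernel q b ρ τ = kernel q b τ ρ := by
  unfold kernel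
  rw [Finset.prod_comm]
  refine Finset.prod_congr rfl fun r _ => Finset.prod_congr rfl fun s _ => ?_
  rw [hq (b s) (b r)]
  simp only [and_comm]

theorem kernel_eq_pairs (hq : ∀ i j, q i j = q j i) {n : ℕ} (b : Fin n → N)
    (ρ τ : Equiv.Perm (Fin n)) : kernel q b ρ τ =
      ∏ i ∈ (Finset.univ : Finset (Fin n × Fin n)).filter (fun i => i.1 < i.2),
        if (decide (ρ i.1 < ρ i.2)) = (decide (τ i.1 < τ i.2)) then 1 else q (b i.1) (b i.2) := by
  have h0 : kernel q b ρ τ = ∏ i : Fin n × Fin n,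
      if τ i.1 < τ i.2 ∧ ρ i.2 < ρ i.1 then q (b i.1) (b i.2) else 1 := by
    rw [Fintype.prod_prod_type]; rfl
  rw [h0, ← Finset.prod_filter_mul_prod_filter_not Finset.univ (fun i : Fin n × Fin n => i.1 < i.2)]
  have h1 : ∏ i ∈ (Finset.univ : Finset (Fin n × Fin n)).filter (fun i => ¬ i.1 < i.2),
      (if τ i.1 < τ i.2 ∧ ρ i.2 < ρ i.1 then q (b i.1) (b i.2) else 1) =
      ∏ i ∈ (Finset.univ : Finset (Fin n × Fin n)).filter (fun i => i.1 < i.2),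
      (if τ i.2 < τ i.1 ∧ ρ i.1 < ρ i.2 then q (b i.2) (b i.1) else 1) := by
    rw [Finset.prod_filter, Finset.prod_filter, ← Equiv.prod_comp (Equiv.prodComm (Fin n) (Fin n))]
    refine Finset.prod_congr rfl fun i _ => ?_
    change (if ¬ i.2 < i.1 then
        (if τ i.2 < τ i.1 ∧ ρ i.1 < ρ i.2 then q (b i.2) (b i.1) else 1) else 1) =
      if i.1 < i.2 then (if τ i.2 < τ i.1 ∧ ρ i.1 < ρ i.2 then q (b i.2) (b i.1) else 1) else 1
    rcases lt_trichotomy i.1 i.2 with h | h | h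
    · rw [if_pos (not_lt_of_gt h), if_pos h]
    · simp [h]
    · rw [if_neg (not_not.mpr h), if_neg (not_lt_of_gt h)]
  rw [h1, ← Finset.prod_mul_distrib]
  refine Finset.prod_congr rfl fun i hi => ?_
  have hne : i.1 ≠ i.2 := ne_of_lt (by simpa using hi)
  have hρ : ρ i.1 ≠ ρ i.2 := fun h => hne (ρ.injective h)
  have hτ : τ i.1 ≠ τ i.2 := fun h => hne (τ.injective h)
  rw [hq (b i.2) (b i.1)]
  rcases lt_or_gt_of_ne hρ with h | h <;> rcases lt_or_gt_of_ne hτ with h' | h' <;>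
    simp [h, h', not_lt_of_gt h, not_lt_of_gt h']

/-- If two permutations order all pairs in the same way then they agree. -/
theorem perm_eq_of_agree {n : ℕ} (ρ τ : Equiv.Perm (Fin n))
    (h : ∀ i : Fin n × Fin n, i.1 < i.2 → (ρ i.1 < ρ i.2 ↔ τ i.1 < τ i.2)) : ρ = τ := by
  have hm : StrictMono (ρ * τ⁻¹) := by
    intro u v huv
    simp only [Equiv.Perm.mul_apply]
    have e1 : τ (τ⁻¹ u) = u := by simp
    have e2 : τ (τ⁻¹ v) = v := by simp
    have hne : τ⁻¹ u ≠ τ⁻¹ v := fun h => huv.ne (τ⁻¹.injective h)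
    rcases lt_or_gt_of_ne hne with h' | h'
    · exact (h (τ⁻¹ u, τ⁻¹ v) h').mpr (by simpa using huv)
    · have := (h (τ⁻¹ v, τ⁻¹ u) h').not.mpr (by simpa using huv.le)
      exact lt_of_le_of_ne (not_lt.mp this) fun e => hne (ρ.injective e)
  have : (ρ * τ⁻¹) = 1 := Equiv.ext fun u => le_antisymm hm.apply_le hm.le_apply
  exact mul_inv_eq_one.mp this

theorem permute_tprod {n : ℕ} (σ : Equiv.Perm (Fin n)) (ξ : Fin n → H) :
    permute σ (PiTensorProduct.tprod ℂ ξ) = PiTensorProduct.tprod ℂ fun t => ξ (σ.symm t) := by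
  simp [permute]

theorem colourProj_tprod {n : ℕ} (c : Fin n → N) (ξ : Fin n → H) :
    colourProj p c (PiTensorProduct.tprod ℂ ξ) = PiTensorProduct.tprod ℂ fun t => p (c t) (ξ t) := by
  simp [colourProj]

/-- `Φ(σ)` on a simple tensor whose `t`-th factor has colour `c t`. -/
theorem Phi_tprod [Fintype N] (hpo : ∀ i i' x, i ≠ i' → p i (p i' x) = 0) {n : ℕ}
    (σ : Equiv.Perm (Fin n)) (c : Fin n → N) (ξ : Fin n → H) (hξ : ∀ t, p (c t) (ξ t) = ξ t) :
    Phi q p σ (PiTensorProduct.tprod ℂ ξ) =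
      (inversionWeight q σ c : ℂ) • PiTensorProduct.tprod ℂ fun t => ξ (σ.symm t) := by
  classical
  simp only [Phi, LinearMap.sum_apply, LinearMap.smul_apply, LinearMap.comp_apply]
  rw [Finset.sum_eq_single_of_mem c (Finset.mem_univ c)]
  · simp only [colourProj_tprod, hξ, permute_tprod]
  · intro c' _ hc
    obtain ⟨t, ht⟩ := Function.ne_iff.mp hc
    have h0 : p (c' t) (ξ t) = 0 := by rw [← hξ t]; exact hpo _ _ _ ht
    rw [colourProj_tprod, MultilinearMap.map_coord_zero _ t h0, map_zero, smul_zero]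

theorem sum_colourProj [Fintype N] (hp1 : ∀ x, ∑ i, p i x = x) {n : ℕ} (x : ⨂[ℂ]^n H) :
    ∑ c : Fin n → N, colourProj p c x = x := by
  induction x using PiTensorProduct.induction_on with
  | smul_tprod r ξ =>
    simp only [map_smul, colourProj_tprod, ← Finset.smul_sum]
    congr 1
    have h := (PiTensorProduct.tprod ℂ (s := fun _ : Fin n => H)).map_sum
      (fun t (i : N) => p i (ξ t))
    simp only [hp1] at h
    exact h.symm
  | add a b ha hb => simp only [map_add, Finset.sum_add_distrib, ha, hb]

theorem form_permute (hps : ∀ i x y, ⟪p i x, y⟫_ℂ = ⟪x, p i y⟫_ℂ)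
    (hpi : ∀ i x, p i (p i x) = p i x) {n : ℕ} (b : Fin n → N) (ρ τ : Equiv.Perm (Fin n)) (x y : ⨂[ℂ]^n H) :
    tensorForm n (permute (ρ * τ⁻¹) (colourProj p (b ∘ τ.symm) y)) x =
      tensorForm n (colourProj p b (permute τ⁻¹ y)) (colourProj p b (permute ρ⁻¹ x)) := by
  induction y using PiTensorProduct.induction_on with
  | smul_tprod r η =>
    induction x using PiTensorProduct.induction_on with
    | smul_tprod s ξ =>
      simp only [LinearMap.map_smulₛₗ, LinearMap.smul_apply, permute_tprod, colourProj_tprod,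
        tensorForm_tprod]
      congr 2
      rw [← Equiv.prod_comp ρ]
      refine Finset.prod_congr rfl fun r _ => ?_
      have e1 : (ρ * τ⁻¹).symm (ρ r) = τ r := by rw [Equiv.symm_apply_eq]; simp
      have e2 : ρ⁻¹.symm r = ρ r := rfl
      have e3 : τ⁻¹.symm r = τ r := rfl
      rw [hps, hpi, e1, e2, e3, Function.comp_apply, Equiv.symm_apply_apply]
    | add a b ha hb => simp only [map_add, ha, hb]
  | add a b ha hb => simp only [map_add, ha, hb, LinearMap.add_apply]

theorem twisted_eq [Fintype N] (hps : ∀ i x y, ⟪p i x, y⟫_ℂ = ⟪x, p i y⟫_ℂ)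
    (hpi : ∀ i x, p i (p i x) = p i x) (n : ℕ) (x y : ⨂[ℂ]^n H) :
    (Fintype.card (Equiv.Perm (Fin n)) : ℂ) * twistedForm q p n y x =
      ∑ b : Fin n → N, ∑ ρ : Equiv.Perm (Fin n), ∑ τ : Equiv.Perm (Fin n), (kernel q b ρ τ : ℂ) *
        tensorForm n (colourProj p b (permute τ⁻¹ y)) (colourProj p b (permute ρ⁻¹ x)) := by
  have h1 : ∀ τ : Equiv.Perm (Fin n), twistedForm q p n y x =
      ∑ b : Fin n → N, ∑ ρ : Equiv.Perm (Fin n), (kernel q b ρ τ : ℂ) *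
        tensorForm n (colourProj p b (permute τ⁻¹ y)) (colourProj p b (permute ρ⁻¹ x)) := by
    intro τ
    simp only [twistedForm, symmetrizer, Phi, LinearMap.comp_apply, LinearMap.sum_apply, map_sum,
      LinearMap.smul_apply, map_smul, smul_eq_mul]
    rw [Finset.sum_comm, ← Equiv.sum_comp (τ.arrowCongr (Equiv.refl N))]
    refine Finset.sum_congr rfl fun b _ => ?_
    rw [← Equiv.sum_comp (Equiv.mulRight τ⁻¹)]
    refine Finset.sum_congr rfl fun ρ _ => ?_
    have e : (τ.arrowCongr (Equiv.refl N)) b = b ∘ τ.symm := rfl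
    rw [e, Equiv.coe_mulRight, kernel_eq, form_permute hps hpi]
  calc _ = ∑ τ : Equiv.Perm (Fin n), twistedForm q p n y x := by simp
    _ = ∑ τ : Equiv.Perm (Fin n), ∑ b : Fin n → N, ∑ ρ : Equiv.Perm (Fin n),
        (kernel q b ρ τ : ℂ) * tensorForm n (colourProj p b (permute τ⁻¹ y))
          (colourProj p b (permute ρ⁻¹ x)) := Finset.sum_congr rfl fun τ _ => h1 τ
    _ = _ := by
      rw [Finset.sum_comm]
      exact Finset.sum_congr rfl fun b _ => Finset.sum_comm

theorem twisted_symm [Fintype N] (hps : ∀ i x y, ⟪p i x, y⟫_ℂ = ⟪x, p i y⟫_ℂ)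
    (hpi : ∀ i x, p i (p i x) = p i x)
    (hq : ∀ i j, q i j = q j i) (n : ℕ) (x y : ⨂[ℂ]^n H) :
    conj (twistedForm q p n x y) = twistedForm q p n y x := by
  have hc : (Fintype.card (Equiv.Perm (Fin n)) : ℂ) ≠ 0 := by simp
  apply mul_left_cancel₀ hc
  rw [twisted_eq hps hpi, ← Complex.conj_natCast, ← map_mul, twisted_eq hps hpi]
  simp only [map_sum, map_mul, Complex.conj_ofReal, tensorForm_symm]
  refine Finset.sum_congr rfl fun b _ => ?_
  rw [Finset.sum_comm]
  simp only [kernel_symm hq]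

theorem twisted_self [Fintype N] (hps : ∀ i x y, ⟪p i x, y⟫_ℂ = ⟪x, p i y⟫_ℂ)
    (hpi : ∀ i x, p i (p i x) = p i x)
    [FiniteDimensional ℂ H] (hp1 : ∀ x, ∑ i, p i x = x)
    (hq : ∀ i j, q i j = q j i) (hq1 : ∀ i j, |q i j| < 1) (n : ℕ) (x : ⨂[ℂ]^n H) :
    0 ≤ (twistedForm q p n x x).re ∧ ((twistedForm q p n x x).re = 0 → x = 0) := by
  have key : ∀ b : Fin n → N, ∃ κ : ℝ, 0 < κ ∧
      κ * (tensorForm n (colourProj p b x) (colourProj p b x)).re ≤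
      ∑ ρ : Equiv.Perm (Fin n), ∑ τ : Equiv.Perm (Fin n), kernel q b ρ τ *
        (tensorForm n (colourProj p b (permute τ⁻¹ x)) (colourProj p b (permute ρ⁻¹ x))).re := by
    intro b
    let z : Equiv.Perm (Fin n) → ⨂[ℂ]^n H := fun ρ => colourProj p b (permute ρ⁻¹ x)
    let k : Equiv.Perm (Fin n) → Equiv.Perm (Fin n) → ℝ := fun ρ τ => (tensorForm n (z τ) (z ρ)).re
    have hk : ∀ w : Equiv.Perm (Fin n) → ℝ, 0 ≤ ∑ ρ, ∑ τ, w ρ * w τ * k ρ τ := by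
      intro w
      have h := (tensorForm_self n (∑ ρ, (w ρ : ℂ) • z ρ)).1
      simp only [map_sum, LinearMap.sum_apply, map_smul, LinearMap.smul_apply,
        LinearMap.map_smulₛₗ, smul_eq_mul, Complex.conj_ofReal, Complex.re_sum, Complex.re_ofReal_mul,
        Finset.mul_sum] at h
      refine h.trans_eq (Finset.sum_congr rfl fun ρ _ => Finset.sum_congr rfl fun τ _ => ?_)
      exact (mul_assoc _ _ _).symm
    have hb := (schur_bound k hk (fun i : Fin n × Fin n => q (b i.1) (b i.2))
      (fun i => hq1 _ _) (fun i ρ => decide (ρ i.1 < ρ i.2))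
      ((Finset.univ : Finset (Fin n × Fin n)).filter (fun i => i.1 < i.2)) (fun _ => 1)).2
    refine ⟨∏ i ∈ (Finset.univ : Finset (Fin n × Fin n)).filter (fun i => i.1 < i.2),
      (1 - |q (b i.1) (b i.2)|), Finset.prod_pos fun i _ => sub_pos.mpr (hq1 (b i.1) (b i.2)), le_trans ?_
      (hb.trans (le_of_eq ?_))⟩
    · refine mul_le_mul_of_nonneg_left ?_ (Finset.prod_nonneg fun i _ => by
        linarith [hq1 (b i.1) (b i.2)])
      have hδ : ∀ ρ τ : Equiv.Perm (Fin n),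
          (∏ i ∈ (Finset.univ : Finset (Fin n × Fin n)).filter (fun i => i.1 < i.2),
            if decide (ρ i.1 < ρ i.2) = decide (τ i.1 < τ i.2) then (1 : ℝ) else 0) =
          if ρ = τ then 1 else 0 := by
        intro ρ τ
        split_ifs with h
        · subst h; simp
        · by_contra h0
          apply h
          apply perm_eq_of_agree
          intro i hi
          have h1 := Finset.prod_ne_zero_iff.mp h0 i (by simpa using hi)
          by_contra h2
          exact h1 (by simp [h2])
      simp only [hδ, ite_mul, one_mul, zero_mul, Finset.sum_ite_eq, Finset.mem_univ, if_true]
      have h1 : permute (1 : Equiv.Perm (Fin n))⁻¹ x = x := by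
        simp only [permute, inv_one]
        erw [PiTensorProduct.reindex_refl]
        rfl
      have h2 : k 1 1 = (tensorForm n (colourProj p b x) (colourProj p b x)).re := by
        simp only [k, z, h1]
      rw [← h2]
      exact Finset.single_le_sum (f := fun ρ => k ρ ρ) (fun ρ _ => (tensorForm_self n (z ρ)).1)
        (Finset.mem_univ 1)
    · refine Finset.sum_congr rfl fun ρ _ => Finset.sum_congr rfl fun τ _ => ?_
      rw [kernel_eq_pairs hq]
      simp [k, z]
  choose κ hκ hle using key
  have hsum : (Fintype.card (Equiv.Perm (Fin n)) : ℝ) * (twistedForm q p n x x).re =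
      ∑ b : Fin n → N, ∑ ρ : Equiv.Perm (Fin n), ∑ τ : Equiv.Perm (Fin n), kernel q b ρ τ *
        (tensorForm n (colourProj p b (permute τ⁻¹ x)) (colourProj p b (permute ρ⁻¹ x))).re := by
    have h := congrArg Complex.re (twisted_eq (q := q) hps hpi n x x)
    simp only [Complex.re_sum, Complex.re_ofReal_mul] at h
    rw [← h, ← Complex.ofReal_natCast, Complex.re_ofReal_mul]
  have hpos : (0 : ℝ) < Fintype.card (Equiv.Perm (Fin n)) := by
    exact_mod_cast Fintype.card_pos
  have hterm : ∀ b, 0 ≤ κ b * (tensorForm n (colourProj p b x) (colourProj p b x)).re :=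
    fun b => mul_nonneg (hκ b).le (tensorForm_self n _).1
  have hle' := Finset.sum_le_sum (s := Finset.univ) fun b _ => hle b
  rw [← hsum] at hle'
  have h0 := Finset.sum_nonneg (s := Finset.univ) fun b _ => hterm b
  refine ⟨nonneg_of_mul_nonneg_right (h0.trans hle') hpos, fun hz => ?_⟩
  rw [hz, mul_zero] at hle'
  have h1 := (Finset.sum_eq_zero_iff_of_nonneg fun b _ => hterm b).mp (le_antisymm hle' h0)
  rw [← sum_colourProj hp1 x]
  refine Finset.sum_eq_zero fun b hb => (tensorForm_self n _).2 ?_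
  exact (mul_eq_zero.mp (h1 b hb)).resolve_left (hκ b).ne'

end Tensor
/-- The data of the construction: a strongly continuous orthogonal representation `U` of `ℝ` on a
finite-dimensional real Hilbert space `E`, a decomposition of `E` into an orthogonal direct sum of
`U`-invariant subspaces `V i`, and a symmetric matrix `q` with entries in `(-1, 1)`. -/
structure Data (E : Type*) [NormedAddCommGroup E] [InnerProductSpace ℝ E] (N : Type*) where
  U : ℝ → E ≃ₗᵢ[ℝ] E
  U_add : ∀ s t x, U (s + t) x = U s (U t x)
  U_continuous : ∀ x, Continuous fun t => U t x
  V : N → Submodule ℝ E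
  V_orthogonal : OrthogonalFamily ℝ (fun i => V i) fun i => (V i).subtypeₗᵢ
  V_iSup : ⨆ i, V i = ⊤
  V_invariant : ∀ i t, ∀ x ∈ V i, U t x ∈ V i
  q : N → N → ℝ
  q_symm : ∀ i j, q i j = q j i
  q_abs_lt_one : ∀ i j, |q i j| < 1

namespace Data

variable {E : Type*} [NormedAddCommGroup E] [InnerProductSpace ℝ E] {N : Type*}

section Deformed

variable (S : Data E N)

theorem U_zero (x : E) : S.U 0 x = x := by
  have h := S.U_add 0 0 x
  rw [add_zero] at h
  exact ((S.U 0).injective h).symm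

/-- The infinitesimal generator `X` of `U`, so that `U t = exp (t X)`. -/
def generator : E →L[ℝ] E :=
  deriv (fun t => ((S.U t).toContinuousLinearEquiv : E →L[ℝ] E)) 0

theorem hasDerivAt_U
    (h : DifferentiableAt ℝ (fun t => ((S.U t).toContinuousLinearEquiv : E →L[ℝ] E)) 0) (z : E) :
    HasDerivAt (fun t => S.U t z) (S.generator z) 0 := by
  have := h.hasDerivAt.clm_apply (hasDerivAt_const (0 : ℝ) z)
  simpa [generator] using this

theorem generator_eq_zero
    (h : ¬ DifferentiableAt ℝ (fun t => ((S.U t).toContinuousLinearEquiv : E →L[ℝ] E)) 0) :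
    S.generator = 0 := deriv_zero_of_not_differentiableAt h

theorem generator_skew (x y : E) : ⟪S.generator x, y⟫_ℝ = -⟪x, S.generator y⟫_ℝ := by
  by_cases h : DifferentiableAt ℝ
      (fun t => ((S.U t).toContinuousLinearEquiv : E →L[ℝ] E)) 0
  · have h1 := (S.hasDerivAt_U h x).inner ℝ (S.hasDerivAt_U h y)
    have h2 : (fun t => ⟪S.U t x, S.U t y⟫_ℝ) = fun _ => ⟪x, y⟫_ℝ := by
      funext t; exact (S.U t).inner_map_map x y
    rw [h2] at h1
    have h3 := h1.unique (hasDerivAt_const (0 : ℝ) ⟪x, y⟫_ℝ)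
    simp only [U_zero] at h3
    linarith
  · simp [S.generator_eq_zero h]

variable [FiniteDimensional ℝ E]

theorem U_proj (i : N) (t : ℝ) (x : E) :
    (S.V i).starProjection (S.U t x) = S.U t ((S.V i).starProjection x) := by
  refine Submodule.eq_starProjection_of_mem_orthogonal (S.V_invariant i t _
    (Submodule.starProjection_apply_mem _ _)) ?_
  rw [← map_sub, Submodule.mem_orthogonal]
  intro w hw
  have h1 : S.U t (S.U (-t) w) = w := by rw [← S.U_add, add_neg_cancel, U_zero]
  rw [← h1, LinearIsometryEquiv.inner_map_map]
  exact Submodule.inner_right_of_mem_orthogonal (S.V_invariant i (-t) w hw)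
    (Submodule.sub_starProjection_mem_orthogonal _)

theorem generator_proj (i : N) (x : E) :
    (S.V i).starProjection (S.generator x) = S.generator ((S.V i).starProjection x) := by
  by_cases h : DifferentiableAt ℝ
      (fun t => ((S.U t).toContinuousLinearEquiv : E →L[ℝ] E)) 0
  · have h1 := ((S.V i).starProjection.hasFDerivAt.comp_hasDerivAt (0 : ℝ) (S.hasDerivAt_U h x))
    have h2 := S.hasDerivAt_U h ((S.V i).starProjection x)
    refine h1.unique ?_
    refine h2.congr_of_eventuallyEq (Filter.Eventually.of_forall fun t => ?_)
    simp [U_proj]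
  · simp [S.generator_eq_zero h]

/-- The self-adjoint operator `log A = -i X` on the complexification. -/
def logA : Cx E →L[ℂ] Cx E :=
  (-Complex.I) • LinearMap.toContinuousLinearMap (Cx.mapₗ (S.generator : E →ₗ[ℝ] E))

/-- The analytic generator `A` of `U`: the positive operator on the complexification with
`U t = A ^ (i t)`. -/
def analyticGenerator : Cx E →L[ℂ] Cx E := NormedSpace.exp S.logA

/-- The operator `2 (1 + A⁻¹)⁻¹`. -/
def deformation : Cx E →L[ℂ] Cx E :=
  (2 : ℂ) • Ring.inverse (1 + Ring.inverse S.analyticGenerator)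

/-- The colour projection, complexified. -/
def projC (i : N) : Cx E →L[ℂ] Cx E :=
  LinearMap.toContinuousLinearMap (Cx.mapₗ ((S.V i).starProjection : E →ₗ[ℝ] E))

theorem logA_selfAdjoint : IsSelfAdjoint S.logA := by
  rw [ContinuousLinearMap.isSelfAdjoint_iff_isSymmetric]
  intro x y
  simp [logA, inner_smul_left, inner_smul_right, Cx.inner_def, S.generator_skew]
  apply Complex.ext <;> simp <;> ring

theorem projC_comm (i : N) : Commute (S.projC i) S.logA := by
  ext x <;> simp [projC, logA, generator_proj]

theorem inverse_A : Ring.inverse S.analyticGenerator = NormedSpace.exp (-S.logA) := by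
  let _ : NormedAlgebra ℚ (Cx E →L[ℂ] Cx E) := NormedAlgebra.restrictScalars ℚ ℂ _
  have : Invertible S.analyticGenerator := (NormedSpace.isUnit_exp S.logA).invertible
  rw [Ring.inverse_invertible]
  exact invOf_eq_right_inv (by
    rw [analyticGenerator, ← NormedSpace.exp_add_of_commute (Commute.neg_right rfl)]
    simp)

theorem exp_neg_nonneg (x : Cx E) : 0 ≤ RCLike.re ⟪x, NormedSpace.exp (-S.logA) x⟫_ℂ := by
  let _ : NormedAlgebra ℚ (Cx E →L[ℂ] Cx E) := NormedAlgebra.restrictScalars ℚ ℂ _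
  set h : Cx E →L[ℂ] Cx E := (-(1 / 2 : ℂ)) • S.logA with hh
  have hs : IsSelfAdjoint h :=
    IsSelfAdjoint.smul (by rw [isSelfAdjoint_iff]; simp) S.logA_selfAdjoint
  have h2 : -S.logA = h + h := by rw [hh]; module
  rw [h2, NormedSpace.exp_add_of_commute rfl]
  have h3 := (ContinuousLinearMap.isSelfAdjoint_iff_isSymmetric.mp hs.exp) x
    (NormedSpace.exp h x)
  simp only [ContinuousLinearMap.coe_coe] at h3
  rw [mul_apply_eq_comp, ← h3]
  exact inner_self_nonneg

theorem inner_self_eq_zero_of_re {H : Type*} [NormedAddCommGroup H] [InnerProductSpace ℂ H] {x : H}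
    (h : RCLike.re ⟪x, x⟫_ℂ ≤ 0) : ⟪x, x⟫_ℂ = 0 := by
  rw [inner_self_eq_norm_sq] at h
  have h2 : ‖x‖ = 0 := by nlinarith [norm_nonneg x]
  simp [norm_eq_zero.mp h2]

theorem denom_bounded (x : Cx E) :
    RCLike.re ⟪x, x⟫_ℂ ≤ RCLike.re ⟪x, (1 + Ring.inverse S.analyticGenerator) x⟫_ℂ := by
  rw [inverse_A]
  simpa [inner_add_right] using S.exp_neg_nonneg x

theorem denom_selfAdjoint : IsSelfAdjoint (1 + Ring.inverse S.analyticGenerator) := by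
  rw [inverse_A]
  exact (IsSelfAdjoint.one _).add (S.logA_selfAdjoint.neg.exp)

theorem denom_isUnit : IsUnit (1 + Ring.inverse S.analyticGenerator) := by
  rw [ContinuousLinearMap.isUnit_iff_isUnit_toLinearMap, LinearMap.isUnit_iff_ker_eq_bot,
    LinearMap.ker_eq_bot']
  intro x hx
  have h := S.denom_bounded x
  have hx' : (1 + Ring.inverse S.analyticGenerator) x = 0 := hx
  rw [hx', inner_zero_right, map_zero] at h
  exact (inner_self_eq_zero (𝕜 := ℂ)).mp (inner_self_eq_zero_of_re h)

theorem deformation_comm (i : N) : Commute (S.projC i) S.deformation := by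
  have h1 : Commute (S.projC i) (1 + Ring.inverse S.analyticGenerator) := by
    rw [inverse_A]
    exact (Commute.one_right _).add_right ((S.projC_comm i).neg_right.exp_right)
  refine Commute.smul_right ?_ 2
  obtain ⟨u, hu⟩ := S.denom_isUnit
  rw [← hu] at h1 ⊢
  rw [Ring.inverse_unit]
  exact h1.units_inv_right

theorem deformation_spec (x : Cx E) :
    (1 + Ring.inverse S.analyticGenerator) (S.deformation x) = (2 : ℂ) • x := by
  have h := congrArg (fun T => T x) (Ring.mul_inverse_cancel _ S.denom_isUnit)
  simp only [mul_apply_eq_comp, one_apply_eq_self] at h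
  rw [deformation, smul_apply, map_smul, h]

theorem deformation_symm (x y : Cx E) : ⟪S.deformation x, y⟫_ℂ = ⟪x, S.deformation y⟫_ℂ := by
  have hs := (ContinuousLinearMap.isSelfAdjoint_iff_isSymmetric.mp S.denom_selfAdjoint)
    (S.deformation x) (S.deformation y)
  simp only [ContinuousLinearMap.coe_coe] at hs
  rw [deformation_spec, deformation_spec, inner_smul_left, inner_smul_right] at hs
  rw [Complex.conj_ofNat] at hs
  exact mul_left_cancel₀ two_ne_zero hs.symm

theorem deformation_pos (x : Cx E) :
    RCLike.re ⟪S.deformation x, S.deformation x⟫_ℂ ≤ 2 * RCLike.re ⟪x, S.deformation x⟫_ℂ := by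
  have h := S.denom_bounded (S.deformation x)
  rw [deformation_spec, inner_smul_right] at h
  have h2 : ∀ z : ℂ, RCLike.re ((2 : ℂ) * z) = 2 * RCLike.re z := fun z => by simp
  rw [h2, S.deformation_symm x x] at h
  exact h

/-- The space `H_U`: the complexification with the deformed inner product
`⟪ξ, ζ⟫_U = ⟪ξ, 2 (1 + A⁻¹)⁻¹ ζ⟫`. -/
def HU (_ : Data E N) : Type _ := Cx E

instance : AddCommGroup S.HU := inferInstanceAs (AddCommGroup (Cx E))
instance : Module ℂ S.HU := inferInstanceAs (Module ℂ (Cx E))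
instance : Module.Finite ℂ S.HU := inferInstanceAs (Module.Finite ℂ (Cx E))

/-- The identification of the vector spaces underlying `H_U` and the complexification. -/
def toCx : S.HU ≃ₗ[ℂ] Cx E := LinearEquiv.refl ℂ (Cx E)

abbrev coreHU : InnerProductSpace.Core ℂ S.HU where
  inner x y := ⟪S.toCx x, S.deformation (S.toCx y)⟫_ℂ
  conj_inner_symm x y := by
    rw [inner_conj_symm]; exact S.deformation_symm _ _
  re_inner_nonneg x := by
    have h1 := S.deformation_pos (S.toCx x)
    have h2 := inner_self_nonneg (𝕜 := ℂ) (x := S.deformation (S.toCx x))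
    linarith
  add_left x y z := by rw [map_add, inner_add_left]
  smul_left x y a := by rw [map_smul, inner_smul_left]
  definite x h := by
    have h1 := S.deformation_pos (S.toCx x)
    rw [h, map_zero, mul_zero] at h1
    have h2 := (inner_self_eq_zero (𝕜 := ℂ)).mp (inner_self_eq_zero_of_re h1)
    have h3 := S.deformation_spec (S.toCx x)
    rw [h2, map_zero] at h3
    have h4 := (smul_eq_zero.mp h3.symm).resolve_left two_ne_zero
    exact S.toCx.map_eq_zero_iff.mp h4

instance : NormedAddCommGroup S.HU :=
  InnerProductSpace.Core.toNormedAddCommGroup (𝕜 := ℂ) (cd := S.coreHU)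
instance : InnerProductSpace ℂ S.HU := InnerProductSpace.ofCore S.coreHU.toCore

theorem inner_HU (x y : S.HU) : ⟪x, y⟫_ℂ = ⟪S.toCx x, S.deformation (S.toCx y)⟫_ℂ := rfl

/-- The complex conjugation `ξ₁ + i ξ₂ ↦ ξ₁ - i ξ₂`. -/
def bar (ξ : S.HU) : S.HU := S.toCx.symm ⟨(S.toCx ξ).re, -(S.toCx ξ).im⟩

/-- The inclusion of the real Hilbert space in `H_U`. -/
def incl (ξ : E) : S.HU := S.toCx.symm (Cx.ofReal ξ)

/-- The complexification of `V i`, as a subspace of `H_U`. -/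
def colour (i : N) : Submodule ℂ S.HU where
  carrier := {ξ | (S.toCx ξ).re ∈ S.V i ∧ (S.toCx ξ).im ∈ S.V i}
  add_mem' h h' := ⟨add_mem h.1 h'.1, add_mem h.2 h'.2⟩
  zero_mem' := ⟨zero_mem _, zero_mem _⟩
  smul_mem' z _ h := ⟨sub_mem (Submodule.smul_mem _ z.re h.1) (Submodule.smul_mem _ z.im h.2),
    add_mem (Submodule.smul_mem _ z.re h.2) (Submodule.smul_mem _ z.im h.1)⟩

/-- The projection of `H_U` onto `colour i` along the other summands: the complex-linear
extension of the orthogonal projection of `E` onto `V i`. -/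
def proj (i : N) : S.HU →ₗ[ℂ] S.HU :=
  S.toCx.symm.toLinearMap ∘ₗ Cx.mapₗ ((S.V i).starProjection : E →ₗ[ℝ] E) ∘ₗ S.toCx.toLinearMap

theorem toCx_proj (i : N) (x : S.HU) :
    S.toCx (S.proj i x) = ⟨(S.V i).starProjection (S.toCx x).re,
      (S.V i).starProjection (S.toCx x).im⟩ := rfl

theorem proj_symm (i : N) (x y : S.HU) : ⟪S.proj i x, y⟫_ℂ = ⟪x, S.proj i y⟫_ℂ := by
  rw [inner_HU, inner_HU]
  have h := congrArg (fun T => T (S.toCx y)) (S.deformation_comm i).eq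
  simp only [mul_apply_eq_comp] at h
  have h1 : S.toCx (S.proj i y) = S.projC i (S.toCx y) := rfl
  have h2 : S.toCx (S.proj i x) = S.projC i (S.toCx x) := rfl
  rw [h1, h2, ← h]
  have key : ∀ a b : Cx E, ⟪S.projC i a, b⟫_ℂ = ⟪a, S.projC i b⟫_ℂ := by
    intro a b
    simp [Cx.inner_def, projC, Submodule.inner_starProjection_left_eq_right]
  exact key _ _

theorem proj_proj (i j : N) (x : S.HU) [Decidable (i = j)] :
    S.proj i (S.proj j x) = if i = j then S.proj i x else 0 := by
  have key : ∀ z : E, (S.V i).starProjection ((S.V j).starProjection z) =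
      if i = j then (S.V i).starProjection z else 0 := by
    intro z
    split_ifs with h
    · subst h
      exact Submodule.starProjection_eq_self_iff.mpr (Submodule.starProjection_apply_mem _ _)
    · rw [Submodule.starProjection_apply_eq_zero_iff]
      exact S.V_orthogonal.isOrtho (fun e => h e.symm) (Submodule.starProjection_apply_mem _ _)
  have h1 := key (S.toCx x).re
  have h2 := key (S.toCx x).im
  apply S.toCx.injective
  split_ifs with h
  · rw [if_pos h] at h1 h2
    exact Cx.ext h1 h2
  · rw [if_neg h] at h1 h2
    exact Cx.ext h1 h2

theorem sum_proj [Fintype N] (x : S.HU) : ∑ i, S.proj i x = x := by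
  have key : ∀ z : E, ∑ i, (S.V i).starProjection z = z := fun z =>
    S.V_orthogonal.sum_projection_of_mem_iSup z (by rw [S.V_iSup]; trivial)
  let fr : S.HU →+ E := ⟨⟨fun x => (S.toCx x).re, rfl⟩, fun _ _ => rfl⟩
  let fi : S.HU →+ E := ⟨⟨fun x => (S.toCx x).im, rfl⟩, fun _ _ => rfl⟩
  apply S.toCx.injective
  refine Cx.ext ?_ ?_
  · exact (map_sum fr _ _).trans (key (S.toCx x).re)
  · exact (map_sum fi _ _).trans (key (S.toCx x).im)

/-- The form `fockForm y x = ⟪x, y⟫_T = ∑ₙ ⟪xₙ, P⁽ⁿ⁾ yₙ⟫` on the tensor algebra, where `xₙ` is the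
component of `x` in the `n`-th tensor power. -/
def fockForm [Fintype N] : TensorAlgebra ℂ S.HU →ₗ[ℂ] (TensorAlgebra ℂ S.HU →ₗ⋆[ℂ] ℂ) :=
  (DirectSum.toModule ℂ ℕ (TensorAlgebra ℂ S.HU →ₗ⋆[ℂ] ℂ) fun n =>
    { toFun := fun y => (twistedForm S.q S.proj n y).comp
        (DirectSum.component ℂ ℕ (fun n => ⨂[ℂ]^n S.HU) n ∘ₗ
          TensorAlgebra.toDirectSum.toLinearMap)
      map_add' := fun y z => by ext x; simp
      map_smul' := fun c y => by ext x; simp }) ∘ₗ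
  TensorAlgebra.toDirectSum.toLinearMap

theorem fockForm_apply [Fintype N] (x y : TensorAlgebra ℂ S.HU) (s : Finset ℕ)
    (hs : ∀ n, n ∉ s → TensorAlgebra.toDirectSum y n = 0) :
    S.fockForm y x = ∑ n ∈ s, twistedForm S.q S.proj n (TensorAlgebra.toDirectSum y n)
      (TensorAlgebra.toDirectSum x n) := by
  have hy : TensorAlgebra.toDirectSum y =
      ∑ n ∈ s, DirectSum.lof ℂ ℕ (fun n => ⨂[ℂ]^n S.HU) n (TensorAlgebra.toDirectSum y n) := by
    apply DFinsupp.ext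
    intro m
    rw [DFinsupp.finsetSum_apply]
    by_cases hm : m ∈ s
    · rw [Finset.sum_eq_single_of_mem m hm]
      · exact (DirectSum.of_eq_same (β := fun n => ⨂[ℂ]^n S.HU) m _).symm
      · intro b _ hb
        exact DirectSum.of_eq_of_ne (β := fun n => ⨂[ℂ]^n S.HU) _ _ _ hb.symm
    · rw [hs m hm, Finset.sum_eq_zero]
      intro b hb
      exact DirectSum.of_eq_of_ne (β := fun n => ⨂[ℂ]^n S.HU) _ _ _ fun h => hm (h ▸ hb)
  unfold fockForm
  rw [LinearMap.comp_apply, AlgHom.toLinearMap_apply]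
  conv_lhs => rw [hy]
  rw [map_sum, LinearMap.sum_apply]
  refine Finset.sum_congr rfl fun n _ => ?_
  rw [DirectSum.toModule_lof]
  rfl

theorem exists_support (x y : TensorAlgebra ℂ S.HU) : ∃ s : Finset ℕ,
    (∀ n, n ∉ s → TensorAlgebra.toDirectSum x n = 0) ∧
    ∀ n, n ∉ s → TensorAlgebra.toDirectSum y n = 0 := by
  classical
  refine ⟨DFinsupp.support (TensorAlgebra.toDirectSum x) ∪
    DFinsupp.support (TensorAlgebra.toDirectSum y), fun n hn => ?_, fun n hn => ?_⟩
  · exact DFinsupp.notMem_support_iff.mp fun h => hn (Finset.mem_union_left _ h)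
  · exact DFinsupp.notMem_support_iff.mp fun h => hn (Finset.mem_union_right _ h)

theorem proj_idem (i : N) (x : S.HU) : S.proj i (S.proj i x) = S.proj i x := by
  classical
  rw [proj_proj, if_pos rfl]

theorem fockForm_symm [Fintype N] (x y : TensorAlgebra ℂ S.HU) :
    conj (S.fockForm x y) = S.fockForm y x := by
  obtain ⟨s, hx, hy⟩ := S.exists_support x y
  rw [S.fockForm_apply y x s hx, S.fockForm_apply x y s hy, map_sum]
  exact Finset.sum_congr rfl fun n _ => twisted_symm S.proj_symm S.proj_idem S.q_symm n _ _

theorem fockForm_self [Fintype N] (x : TensorAlgebra ℂ S.HU) :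
    0 ≤ (S.fockForm x x).re ∧ ((S.fockForm x x).re = 0 → x = 0) := by
  obtain ⟨s, hx, -⟩ := S.exists_support x x
  have ht := fun n => twisted_self S.proj_symm S.proj_idem S.sum_proj S.q_symm S.q_abs_lt_one n
    (TensorAlgebra.toDirectSum x n)
  rw [S.fockForm_apply x x s hx, Complex.re_sum]
  refine ⟨Finset.sum_nonneg fun n _ => (ht n).1, fun h => ?_⟩
  have h1 := (Finset.sum_eq_zero_iff_of_nonneg fun n _ => (ht n).1).mp h
  have h2 : TensorAlgebra.toDirectSum x = 0 := by
    apply DFinsupp.ext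
    intro n
    by_cases hn : n ∈ s
    · exact (ht n).2 (h1 n hn)
    · exact hx n hn
  rw [← TensorAlgebra.ofDirectSum_toDirectSum x, h2, map_zero]

variable [Fintype N]

/-- The algebraic Fock space: the span of the finite simple tensors, i.e. the tensor algebra of
`H_U`, with the `T`-deformed inner product. -/
def FockAlg : Type _ := TensorAlgebra ℂ S.HU

instance : Ring S.FockAlg := inferInstanceAs (Ring (TensorAlgebra ℂ S.HU))
instance : Algebra ℂ S.FockAlg := inferInstanceAs (Algebra ℂ (TensorAlgebra ℂ S.HU))

abbrev coreFock : InnerProductSpace.Core ℂ S.FockAlg where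
  inner x y := S.fockForm y x
  conj_inner_symm x y := S.fockForm_symm _ _
  re_inner_nonneg x := (S.fockForm_self x).1
  add_left x y z := (S.fockForm z).map_add x y
  smul_left x y a := (S.fockForm y).map_smulₛₗ a x
  definite x h := (S.fockForm_self x).2 (by rw [h]; rfl)

instance : NormedAddCommGroup S.FockAlg :=
  InnerProductSpace.Core.toNormedAddCommGroup (𝕜 := ℂ) (cd := S.coreFock)
instance : InnerProductSpace ℂ S.FockAlg := InnerProductSpace.ofCore S.coreFock.toCore

theorem inner_fockAlg (x y : S.FockAlg) : ⟪x, y⟫_ℂ = S.fockForm y x := rfl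

/-- The vector `ξ ∈ H_U` as an element of the algebraic Fock space. -/
def ι : S.HU →ₗ[ℂ] S.FockAlg := TensorAlgebra.ι ℂ

/-- The `T`-deformed Fock space. -/
abbrev Fock : Type _ := UniformSpace.Completion S.FockAlg

/-- The inclusion of the algebraic Fock space. -/
def toFock : S.FockAlg →ₗᵢ[ℂ] S.Fock := UniformSpace.Completion.toComplₗᵢ

/-- The vacuum vector. -/
def vacuum : S.Fock := S.toFock 1

/-- The left creation operator `a*(ξ)`: the bounded extension to the Fock space of the map
`x ↦ ξ ⊗ x` on the algebraic Fock space. -/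
def creation (ξ : S.HU) : S.Fock →L[ℂ] S.Fock :=
  (S.toFock.toLinearMap ∘ₗ LinearMap.mulLeft ℂ (S.ι ξ)).extendOfNorm S.toFock.toLinearMap

/-- The annihilation operator `a(ξ)`, i.e. the adjoint of the creation operator `a*(ξ)`. -/
def annihilation (ξ : S.HU) : S.Fock →L[ℂ] S.Fock := (S.creation ξ).adjoint

/-- `s(ξ) = a(ξ) + a*(ξ)` for `ξ` in the real Hilbert space. -/
def field (ξ : E) : S.Fock →L[ℂ] S.Fock := S.annihilation (S.incl ξ) + S.creation (S.incl ξ)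

/-- The von Neumann algebra `M_T` generated by the `s(ξ)`. -/
def vN : VonNeumannAlgebra S.Fock where
  toStarSubalgebra := StarSubalgebra.centralizer ℂ
    (StarSubalgebra.centralizer ℂ (Set.range S.field) : Set (S.Fock →L[ℂ] S.Fock))
  centralizer_centralizer' := by
    change Set.centralizer (Set.centralizer (StarSubalgebra.centralizer ℂ
      (StarSubalgebra.centralizer ℂ (Set.range S.field) : Set (S.Fock →L[ℂ] S.Fock)) :
        Set (S.Fock →L[ℂ] S.Fock))) = _
    rw [StarSubalgebra.coe_centralizer_centralizer, Set.centralizer_centralizer_centralizer]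
    exact (StarSubalgebra.coe_centralizer_centralizer ℂ _).symm

/-- The algebra underlying `M_T`. -/
abbrev M : Type _ := S.vN.toStarSubalgebra

/-- `s(ξ)` as an element of `M_T`. -/
def fieldM (ξ : E) : S.M := ⟨S.field ξ, by
  rw [vN, ← SetLike.mem_coe, StarSubalgebra.coe_centralizer_centralizer]
  exact Set.subset_centralizer_centralizer (Or.inl ⟨ξ, rfl⟩)⟩

/-- The operator `W(ξ) = s(ξ₁) + i s(ξ₂) = a*(ξ) + a(ξ̄)` of `M_T`, for `ξ = ξ₁ + i ξ₂`;
it satisfies `W(ξ) Ω = ξ`. -/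
def W (ξ : S.HU) : S.M := S.fieldM (S.toCx ξ).re + Complex.I • S.fieldM (S.toCx ξ).im

/-- The vacuum state. -/
def state : S.M →ₗ[ℂ] ℂ where
  toFun x := ⟪S.vacuum, (x : S.Fock →L[ℂ] S.Fock) S.vacuum⟫_ℂ
  map_add' x y := by simp [inner_add_right]
  map_smul' c x := by simp [inner_smul_right]

/-- The state `φ ⊗ φᵒᵖ`, so that `⟪1 ⊗ 1, z⟫ = (φ ⊗ φᵒᵖ) z` in the GNS space. -/
def stateTensor : S.M ⊗[ℂ] S.Mᵐᵒᵖ →ₗ[ℂ] ℂ :=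
  LinearMap.mul' ℂ ℂ ∘ₗ TensorProduct.map S.state
    (S.state ∘ₗ (MulOpposite.opLinearEquiv ℂ).symm.toLinearMap)

section Conjugate

variable {d : ℕ} (A : Fin d → S.M)

/-- The unital *-algebra generated by `A₁, …, A_d`. -/
def polyAlg : StarSubalgebra ℂ S.M := StarAlgebra.adjoin ℂ (Set.range A)

theorem mem_polyAlg (l : Fin d) : A l ∈ S.polyAlg A :=
  StarAlgebra.subset_adjoin ℂ _ ⟨l, rfl⟩

/-- The derivations from `ℂ[A₁, …, A_d]` to `M ⊗ Mᵒᵖ` with `∂ₖ A_l = φ(A_l A_k) 1 ⊗ 1`. -/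
structure IsDifferenceQuotient (k : Fin d) (δ : S.polyAlg A →ₗ[ℂ] S.M ⊗[ℂ] S.Mᵐᵒᵖ) : Prop where
  leibniz : ∀ a b : S.polyAlg A, δ (a * b) =
    ((a : S.M) ⊗ₜ[ℂ] 1) * δ b + ((1 : S.M) ⊗ₜ[ℂ] MulOpposite.op (b : S.M)) * δ a
  apply_gen : ∀ l, δ ⟨A l, S.mem_polyAlg A l⟩ = S.state (A l * A k) • (1 ⊗ₜ[ℂ] 1)

/-- `ξ₁, …, ξ_d` are conjugate variables of `A₁, …, A_d`: the quasi-free difference quotients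
`∂ₖ` exist and are unique, and `⟪ξₖ, x Ω⟫ = ⟪1 ⊗ 1, ∂ₖ x⟫` for all `x ∈ ℂ[A₁, …, A_d]`. -/
def IsConjugateSystem (ξ : Fin d → S.Fock) : Prop :=
  ∀ k, ∃ δ : S.polyAlg A →ₗ[ℂ] S.M ⊗[ℂ] S.Mᵐᵒᵖ,
    S.IsDifferenceQuotient A k δ ∧ (∀ δ', S.IsDifferenceQuotient A k δ' → δ' = δ) ∧
    ∀ x : S.polyAlg A, ⟪ξ k, ((x : S.M) : S.Fock →L[ℂ] S.Fock) S.vacuum⟫_ℂ = S.stateTensor (δ x)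

end Conjugate

section Dual

/-- The set `B(n+1)` of partitions of `{0, …, n}` into pairs and singletons, encoded as involutions:
`0` is paired with some `π 0 > 0`, every `l` with `0 < l < π 0` is paired with some vertex beyond
`π 0`, and a vertex beyond `π 0` is either paired with such an `l` or a singleton. -/
def partitions (n : ℕ) : Finset (Equiv.Perm (Fin (n + 1))) :=
  Finset.univ.filter fun π => π * π = 1 ∧ 0 < π 0 ∧ (∀ l, 0 < l → l < π 0 → π 0 < π l) ∧
    ∀ l, π 0 < l → π l = l ∨ π l < π 0

variable {d : ℕ} (e : OrthonormalBasis (Fin d) ℂ S.HU) (j : Fin d → N)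

/-- The vector `e_w`. -/
def wordVec (w : List (Fin d)) : S.FockAlg := (w.map fun k => S.ι (e k)).prod

variable {n : ℕ} (a : Fin (n + 1) → Fin d) (π : Equiv.Perm (Fin (n + 1)))

/-- `Q(π)`, where vertex `k` carries the letter `a k`. -/
def Qweight : ℝ :=
  (∏ v, ∏ u, if v < u ∧ u < π 0 then S.q (j (a v)) (j (a u)) else 1) *
  (∏ v, ∏ u, if 0 < v ∧ v < u ∧ u < π 0 ∧ π u < π v then
    S.q (j (a (π v))) (j (a (π u))) else 1) *
  ∏ v, ∏ u, if π 0 < v ∧ v < u ∧ π v = v ∧ π u ≠ u then S.q (j (a v)) (j (a u)) else 1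

/-- `E(π)`: the product of `⟪ē_{a k}, e_{a l}⟫_U` over the pairs `k > l` of `π`. -/
def Eweight : ℂ := ∏ l, if l < π l then ⟪S.bar (e (a (π l))), e (a l)⟫_ℂ else 1

/-- The word of the singletons of `π`, in decreasing order. -/
def singletonWord : List (Fin d) :=
  (((List.finRange (n + 1)).filter fun k => π k = k).reverse).map a

/-- The letters carried by the vertices `0, 1, …, n` for the word `w = αₙ ⋯ α₁` and `α₀ = α`. -/
def letters (α : Fin d) (w : List (Fin d)) : Fin (w.length + 1) → Fin d :=
  fun k => (α :: w.reverse).get (k.cast (by simp))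

/-- `D_α e_w`. -/
def dualOnWord (α : Fin d) (w : List (Fin d)) : S.FockAlg :=
  ∑ π ∈ partitions w.length, ((-1 : ℂ) ^ ((π 0 : ℕ) - 1) * (S.Qweight j (letters α w) π : ℂ) *
    S.Eweight e (letters α w) π) • S.wordVec e (singletonWord (letters α w) π)

/-- The algebraic dual variable `D_α`, as a linear map on the algebraic Fock space: the linear
extension of `e_w ↦ D_α e_w` from the basis `(e_w)`. -/
def dualAlg (α : Fin d) : S.FockAlg →ₗ[ℂ] S.FockAlg :=
  (e.toBasis.tensorAlgebra).constr ℂ fun w : FreeMonoid (Fin d) => S.dualOnWord e j α w.toList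

/-- The dual variable `D_α` as an unbounded operator on the Fock space, with the algebraic Fock
space as its domain. -/
def dualVariable (α : Fin d) : S.Fock →ₗ.[ℂ] S.Fock where
  domain := LinearMap.range S.toFock.toLinearMap
  toFun := S.toFock.toLinearMap ∘ₗ S.dualAlg e j α ∘ₗ
    (LinearEquiv.ofInjective S.toFock.toLinearMap S.toFock.injective).symm.toLinearMap

theorem dualVariable_apply (α : Fin d) (x : S.FockAlg) :
    S.dualVariable e j α ⟨S.toFock x, ⟨x, rfl⟩⟩ = S.toFock (S.dualAlg e j α x) := by
  have h : (LinearEquiv.ofInjective S.toFock.toLinearMap S.toFock.injective).symm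
      ⟨S.toFock x, ⟨x, rfl⟩⟩ = x := by
    rw [LinearEquiv.symm_apply_eq]; rfl
  change S.toFock (S.dualAlg e j α ((LinearEquiv.ofInjective S.toFock.toLinearMap
    S.toFock.injective).symm ⟨S.toFock x, ⟨x, rfl⟩⟩)) = _
  rw [h]

theorem dualAlg_wordVec (α : Fin d) (w : List (Fin d)) :
    S.dualAlg e j α (S.wordVec e w) = S.dualOnWord e j α w := by
  have h : S.wordVec e w = e.toBasis.tensorAlgebra (FreeMonoid.ofList w) := by
    have h1 : FreeAlgebra.basisFreeMonoid ℂ (Fin d) (FreeMonoid.ofList w) =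
        (w.map (FreeAlgebra.ι ℂ)).prod := by
      change FreeAlgebra.equivMonoidAlgebraFreeMonoid.symm (MonoidAlgebra.single _ 1) = _
      change MonoidAlgebra.lift ℂ _ _ (FreeMonoid.lift (FreeAlgebra.ι ℂ)) _ = _
      rw [MonoidAlgebra.lift_single, one_smul, FreeMonoid.lift_apply]
      rfl
    rw [Module.Basis.tensorAlgebra, Module.Basis.map_apply, h1, AlgEquiv.toLinearEquiv_apply,
      map_list_prod, List.map_map]
    simp only [Function.comp_def, TensorAlgebra.equivFreeAlgebra_symm_ι,
      OrthonormalBasis.coe_toBasis]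
    rfl
  rw [h]
  exact (e.toBasis.tensorAlgebra).constr_basis ℂ _ _

end Dual

end Deformed
end Data
end MixedQAW

end

/-!
Conjugate variables for the operators `W(e_k)` of a mixed `q`-Araki-Woods algebra.

In the basis `(e_w)` of the algebraic Fock space the generator `A_l = W(e_l)` is creation plus
contraction: it adds the letter `l` on the left, or contracts `l` with some letter of the word,
paying the covariance `c l x = ⟪ē_l, e_x⟫` and a factor `q` for each letter passed
(`MixedQAW.Data.W_toFock`). The dual variable has a recursive description in the same terms: `D_a e_w`
is the sum over the decompositions `w = u k v` of the words obtained by contracting `u` from the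
right by the letters of `v`, with sign `(-1)^|v|`, the factor `c k a`, and `q` over all pairs of
letters of `a` and `v` (`MixedQAW.Words.dual`). Contractions from the left commute with contractions
from the right, since letters with nonzero covariance have the same colour, and the remaining terms
telescope to the commutation relation `D_a A_l - A_l D_a = c l a ⟪Ω, ·⟫ Ω`
(`MixedQAW.Words.mulGen_dual`). As `D_a Ω = 0`, applying it letter by letter gives
`D_a x Ω = (id ⊗ φ)(∂_a x) Ω`, whose vacuum component is `(φ ⊗ φ)(∂_a x)`
(`MixedQAW.Data.inner_eq_stateTensor`). The difference quotient exists because the monomials in the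
generators are a basis of the algebra (`MixedQAW.Data.polyOfWords_bijective`): the vacuum vector of a
monomial has leading term `e_w`.

Only the vacuum component of `D_α` enters the theorem, so the combinatorial and the recursive
description need to be compared only there. On both sides it vanishes on words of even length; on
words of length `2m + 1` only the decomposition at the middle letter, respectively only the pairings
`i ↔ m + 1 + σ i` with `σ 0 = 0`, contribute, and the two sums over permutations agree
(`MixedQAW.Data.inner_vacuum_dualOnWord_eq`).

It remains to see that the functional `e_w ↦ ⟪Ω, D_α e_w⟫` is bounded, so that `Ω` lies in the domain
of the adjoint and `D_α^* Ω` represents it. On words of length `2m + 1` the functional is at most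
`C^(m+1) m! q₀^(m(m+1)/2)` with `q₀ < 1` (`MixedQAW.Words.norm_vac_dual_le`). The deformed inner
product on tensors of degree `n` is bounded below by an exponential `K^(-n)` times the free one:
writing the symmetrizer as a composition of operators `1 + T_1 + T_1 T_2 + ⋯`, each factor is bounded
below uniformly, by the factorization `MixedQAW.braidSum_mul` which follows from the braid relations.
Hence a functional supported in degree `n` is represented by a vector of norm at most `(K d)^n` times
its supremum on words (`MixedQAW.Words.exists_represent`), and the sum over `m` converges
(`MixedQAW.Words.summable_dualBound`).
-/

noncomputable section

namespace MixedQAW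

/-! ### The free vector space on words -/

/-- The complex vector space with basis the words over the alphabet `ι`; for `ι = Fin d` these are
the coordinates of the algebraic Fock space in the basis `(e_w)`. -/
abbrev Words (ι : Type*) : Type _ := List ι →₀ ℂ

namespace Words

variable {ι : Type*}

/-- The basis vector of a word. -/
def word (w : List ι) : Words ι := Finsupp.single w 1

/-- The linear extension of a map defined on words. -/
def ext {V : Type*} [AddCommMonoid V] [Module ℂ V] (f : List ι → V) : Words ι →ₗ[ℂ] V :=
  Finsupp.linearCombination ℂ f

@[simp] theorem ext_word {V : Type*} [AddCommMonoid V] [Module ℂ V] (f : List ι → V)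
    (w : List ι) : ext f (word w) = f w := by
  simp [ext, word]

theorem hom_ext {V : Type*} [AddCommMonoid V] [Module ℂ V] {f g : Words ι →ₗ[ℂ] V}
    (h : ∀ w, f (word w) = g (word w)) : f = g :=
  Finsupp.lhom_ext' fun w => LinearMap.ext_ring (h w)

theorem hom_congr {V : Type*} [AddCommMonoid V] [Module ℂ V] {f g : Words ι →ₗ[ℂ] V}
    (h : ∀ w, f (word w) = g (word w)) (x : Words ι) : f x = g x :=
  LinearMap.congr_fun (hom_ext h) x

/-- Adding a letter on the left of each word. -/
def cons (l : ι) : Words ι →ₗ[ℂ] Words ι := ext fun w => word (l :: w)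

/-- Adding a letter on the right of each word. -/
def snoc (l : ι) : Words ι →ₗ[ℂ] Words ι := ext fun w => word (w ++ [l])

/-- Reading words backwards. -/
def rev : Words ι →ₗ[ℂ] Words ι := ext fun w => word w.reverse

/-- The coefficient of the empty word. -/
def vac : Words ι →ₗ[ℂ] ℂ := Finsupp.lapply []

@[simp] theorem cons_word (l : ι) (w : List ι) : cons l (word w) = word (l :: w) := by simp [cons]
@[simp] theorem snoc_word (l : ι) (w : List ι) : snoc l (word w) = word (w ++ [l]) := by
  simp [snoc]
@[simp] theorem rev_word (w : List ι) : rev (word w) = word w.reverse := by simp [rev]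
@[simp] theorem vac_nil : vac (word ([] : List ι)) = 1 := by simp [vac, word]
@[simp] theorem vac_cons (l : ι) (w : List ι) : vac (word (l :: w)) = 0 := by simp [vac, word]
@[simp] theorem vac_cons' (l : ι) (x : Words ι) : vac (cons l x) = 0 :=
  hom_congr (f := vac ∘ₗ cons l) (g := 0) (fun w => by simp) x

theorem cons_snoc (k l : ι) (x : Words ι) : cons l (snoc k x) = snoc k (cons l x) :=
  hom_congr (f := cons l ∘ₗ snoc k) (g := snoc k ∘ₗ cons l) (fun w => by simp) x

theorem snoc_rev (l : ι) (x : Words ι) : rev (cons l x) = snoc l (rev x) :=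
  hom_congr (f := rev ∘ₗ cons l) (g := snoc l ∘ₗ rev) (fun w => by simp) x

theorem vac_rev (x : Words ι) : vac (rev x) = vac x :=
  hom_congr (f := vac ∘ₗ rev) (g := vac) (fun w => by
    rcases List.eq_nil_or_concat w with rfl | ⟨w, l, rfl⟩
    · simp
    · cases w <;> simp) x

/-! ### Contractions of words -/

/-- The diagonal operator multiplying `word w` by the product of `r` over the letters of `w`. -/
def scale (r : ι → ℂ) : Words ι →ₗ[ℂ] Words ι := ext fun w => (w.map r).prod • word w

@[simp] theorem scale_word (r : ι → ℂ) (w : List ι) :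
    scale r (word w) = (w.map r).prod • word w := by simp [scale]

/-- The contraction of a word `w`: the sum over the letters `x` of `w` of the word with `x` removed,
multiplied by `c x` and by `r y` for every letter `y` to the left of `x`. -/
def contractWord (c r : ι → ℂ) : List ι → Words ι
  | [] => 0
  | x :: w => c x • word w + r x • cons x (contractWord c r w)

/-- The contraction from the left, as a linear map. -/
def contract (c r : ι → ℂ) : Words ι →ₗ[ℂ] Words ι := ext (contractWord c r)

@[simp] theorem contract_nil (c r : ι → ℂ) : contract c r (word []) = 0 := by
  simp [contract, contractWord]

@[simp] theorem contract_cons_word (c r : ι → ℂ) (x : ι) (w : List ι) :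
    contract c r (word (x :: w)) = c x • word w + r x • cons x (contract c r (word w)) := by
  simp [contract, contractWord]

theorem contract_cons (c r : ι → ℂ) (x : ι) (y : Words ι) :
    contract c r (cons x y) = c x • y + r x • cons x (contract c r y) :=
  hom_congr (f := contract c r ∘ₗ cons x)
    (g := c x • LinearMap.id + r x • (cons x ∘ₗ contract c r)) (fun w => by simp) y

/-- The contraction of a word from the right. -/
def rcontractWord (c r : ι → ℂ) : List ι → Words ι
  | [] => 0
  | x :: w => cons x (rcontractWord c r w) + (c x * (w.map r).prod) • word w

/-- The contraction from the right: the sum over the letters `x` of the word with `x` removed,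
multiplied by `c x` and by `r y` for every letter `y` to the right of `x`. -/
def rcontract (c r : ι → ℂ) : Words ι →ₗ[ℂ] Words ι := ext (rcontractWord c r)

@[simp] theorem rcontract_nil (c r : ι → ℂ) : rcontract c r (word []) = 0 := by
  simp [rcontract, rcontractWord]

@[simp] theorem rcontract_cons_word (c r : ι → ℂ) (x : ι) (w : List ι) :
    rcontract c r (word (x :: w)) =
      cons x (rcontract c r (word w)) + (c x * (w.map r).prod) • word w := by
  simp [rcontract, rcontractWord]

theorem rcontract_cons (c r : ι → ℂ) (x : ι) (y : Words ι) :
    rcontract c r (cons x y) = cons x (rcontract c r y) + c x • scale r y :=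
  hom_congr (f := rcontract c r ∘ₗ cons x)
    (g := cons x ∘ₗ rcontract c r + c x • scale r) (fun w => by simp [smul_smul]) y

theorem rcontract_snoc_word (c r : ι → ℂ) (x : ι) (w : List ι) :
    rcontract c r (word (w ++ [x])) = c x • word w + r x • snoc x (rcontract c r (word w)) := by
  induction w with
  | nil => simp
  | cons l w ih =>
    simp only [List.cons_append, rcontract_cons_word, ih, map_add, map_smul, cons_word,
      List.map_append, List.prod_append, cons_snoc, snoc_word]
    simp only [List.map_cons, List.map_nil, List.prod_singleton]
    module

theorem rcontract_rev (c r : ι → ℂ) (x : Words ι) :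
    rcontract c r (rev x) = rev (contract c r x) :=
  hom_congr (f := rcontract c r ∘ₗ rev) (g := rev ∘ₗ contract c r) (fun w => by
    simp only [LinearMap.comp_apply, rev_word]
    induction w with
    | nil => simp
    | cons l w ih => simp [rcontract_snoc_word, ih, snoc_rev]) x

theorem contract_snoc (c r : ι → ℂ) (x : ι) (y : Words ι) :
    contract c r (snoc x y) = snoc x (contract c r y) + c x • scale r y :=
  hom_congr (f := contract c r ∘ₗ snoc x) (g := snoc x ∘ₗ contract c r + c x • scale r)
    (fun w => by
      simp only [LinearMap.comp_apply, snoc_word, LinearMap.add_apply, LinearMap.smul_apply,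
        scale_word]
      induction w with
      | nil => simp
      | cons l w ih =>
        simp only [List.cons_append, contract_cons_word, ih, map_add, map_smul, cons_word,
          snoc_word, List.map_cons, List.prod_cons, cons_snoc]
        module) y

/-- If every letter which `c` can contract has `r`-weight `t`, then contracting a word divides its
`r`-weight by `t`. -/
theorem scale_contract {c r r' : ι → ℂ} {t : ℂ} (h : ∀ y, c y ≠ 0 → r y = t) (x : Words ι) :
    t • scale r (contract c r' x) = contract c r' (scale r x) :=
  hom_congr (f := t • (scale r ∘ₗ contract c r')) (g := contract c r' ∘ₗ scale r) (fun w => by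
    simp only [LinearMap.comp_apply, LinearMap.smul_apply, scale_word, map_smul]
    have hs : ∀ (x : ι) (y : Words ι), scale r (cons x y) = r x • cons x (scale r y) := fun x y =>
      hom_congr (f := scale r ∘ₗ cons x) (g := r x • (cons x ∘ₗ scale r))
        (fun w => by simp [smul_smul]) y
    induction w with
    | nil => simp
    | cons l w ih =>
      simp only [contract_cons_word, map_add, map_smul, scale_word, List.map_cons, List.prod_cons,
        hs, smul_add]
      rw [show t • r' l • r l • cons l (scale r (contract c r' (word w))) =
        r' l • r l • cons l (t • scale r (contract c r' (word w))) by
          rw [map_smul]; module, ih, map_smul]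
      by_cases hl : c l = 0
      · rw [hl]; module
      · rw [h l hl]; module) x

theorem scale_rev (r : ι → ℂ) (x : Words ι) : scale r (rev x) = rev (scale r x) :=
  hom_congr (f := scale r ∘ₗ rev) (g := rev ∘ₗ scale r) (fun w => by simp) x

theorem rev_rev (x : Words ι) : rev (rev x) = x :=
  hom_congr (f := rev ∘ₗ rev) (g := LinearMap.id) (fun w => by simp) x

theorem scale_rcontract {c r r' : ι → ℂ} {t : ℂ} (h : ∀ y, c y ≠ 0 → r y = t) (x : Words ι) :
    t • scale r (rcontract c r' x) = rcontract c r' (scale r x) := by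
  obtain ⟨y, rfl⟩ : ∃ y, x = rev y := ⟨rev x, (rev_rev x).symm⟩
  rw [rcontract_rev, scale_rev, ← map_smul, scale_contract h, scale_rev, rcontract_rev]

/-! ### The dual variable on words and its commutation relations -/

section Dual

variable (c q : ι → ι → ℂ)

/-- The `l`-th generator in the basis of words: creation plus contraction. In the application `c` is
the covariance of the letters and `q` their deformation parameter; the hypotheses used below are
that `q` is symmetric and that letters with nonzero covariance have the same parameters. -/
def mulGen (l : ι) : Words ι →ₗ[ℂ] Words ι := cons l + contract (c l) (q l)

theorem mulGen_apply (l : ι) (x : Words ι) :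
    mulGen c q l x = cons l x + contract (c l) (q l) x := rfl

/-- The contraction from the right with the letter `v`. -/
abbrev rightC (v : ι) : Words ι →ₗ[ℂ] Words ι := rcontract (fun x => c x v) (q v)

variable {c q}

/-- Contractions from the left commute with contractions from the right. Both contractions of a
letter past another one produce a factor `q`, and these factors agree because contracted letters
have the same parameters. -/
theorem contract_rightC (hq : ∀ x y, q x y = q y x) (hc : ∀ x y, c x y ≠ 0 → q x = q y)
    (l v : ι) (x : Words ι) :
    contract (c l) (q l) (rightC c q v x) = rightC c q v (contract (c l) (q l) x) :=
  hom_congr (f := contract (c l) (q l) ∘ₗ rightC c q v)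
    (g := rightC c q v ∘ₗ contract (c l) (q l)) (fun w => by
    simp only [LinearMap.comp_apply]
    induction w with
    | nil => simp
    | cons x w ih =>
      simp only [rightC] at ih ⊢
      have hs := scale_contract (c := c l) (r := q v) (r' := q l) (t := q v l)
        (fun y hy => by rw [hq v y, hq v l, hc l y hy]) (word w)
      simp only [rcontract_cons_word, contract_cons_word, map_add, map_smul, contract_cons,
        rcontract_cons, ih, scale_word] at hs ⊢
      -- Either `x` and `v` have no covariance, or their parameters agree.
      by_cases hx : c x v = 0
      · rw [hx]; module
      · rw [← hc x v hx, hq x l] at hs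
        rw [mul_smul, ← hc x v hx, ← hs]
        module) x

/-- A right contraction fails to commute with a generator only through the created letter. -/
theorem mulGen_rightC (hq : ∀ x y, q x y = q y x) (hc : ∀ x y, c x y ≠ 0 → q x = q y)
    (l v : ι) (x : Words ι) :
    mulGen c q l (rightC c q v x) = rightC c q v (mulGen c q l x) - c l v • scale (q l) x := by
  simp only [mulGen_apply, contract_rightC hq hc, map_add]
  rw [rcontract_cons]
  by_cases hx : c l v = 0
  · rw [hx]; module
  · rw [hc l v hx]; module

variable (c q) (a : ι)

/-- The signed iterated contraction `Γ_v` from the right with the letters of `v`, the last letter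
of `v` acting first, weighted by `q` over all pairs of letters of `a` and `v`. -/
def rightCs : List ι → Words ι →ₗ[ℂ] Words ι
  | [] => LinearMap.id
  | x :: v => (-(q x a * (v.map (q x)).prod)) • (rightC c q x ∘ₗ rightCs v)

/-- `rightCs`, extended linearly in the word of contracting letters. -/
def rightCsL : Words ι →ₗ[ℂ] Words ι →ₗ[ℂ] Words ι := ext (rightCs c q a)

theorem rightCsL_cons (x : ι) (v : Words ι) : rightCsL c q a (cons x v) =
    (-q x a) • (rightC c q x ∘ₗ rightCsL c q a (scale (q x) v)) := by
  refine hom_congr (f := rightCsL c q a ∘ₗ cons x)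
    (g := (-q x a) • ((LinearMap.llcomp ℂ _ _ _ (rightC c q x)) ∘ₗ rightCsL c q a ∘ₗ scale (q x)))
    (fun w => LinearMap.ext fun y => ?_) v
  simp [rightCsL, rightCs, smul_smul, neg_smul]

variable {c q}

theorem scale_rightCs (hq : ∀ x y, q x y = q y x) (hc : ∀ x y, c x y ≠ 0 → q x = q y)
    (l : ι) (v : List ι) (x : Words ι) :
    (v.map (q l)).prod • scale (q l) (rightCs c q a v x) = rightCs c q a v (scale (q l) x) := by
  induction v generalizing x with
  | nil => simp [rightCs]
  | cons y v ih =>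
    simp only [rightCs, List.map_cons, List.prod_cons, LinearMap.smul_apply, LinearMap.comp_apply,
      map_smul]
    rw [← ih, map_smul, ← scale_rcontract (c := fun x => c x y) (r := q l) (r' := q y)
      (t := q l y)]
    · module
    · intro x hx
      rw [hq l x, hq l y, hc x y hx]

/-- The commutation relation between generators and iterated right contractions. -/
theorem mulGen_rightCs (hq : ∀ x y, q x y = q y x) (hc : ∀ x y, c x y ≠ 0 → q x = q y)
    (l : ι) (v : List ι) (x : Words ι) :
    mulGen c q l (rightCs c q a v x) = rightCs c q a v (mulGen c q l x) +
      q l a • rightCsL c q a (contract (c l) (q l) (word v)) (scale (q l) x) := by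
  induction v generalizing x with
  | nil => simp [rightCs]
  | cons y v ih =>
    have h1 := scale_rightCs a hq hc l v x
    have h2 := scale_contract (c := c l) (r := q y) (r' := q l) (t := q y l)
        (fun z hz => by rw [hq y z, hq y l, hc l z hz]) (word v)
    rw [scale_word, map_smul] at h2
    have h3 : rightCsL c q a (word v) = rightCs c q a v := by simp [rightCsL]
    simp only [rightCs, LinearMap.smul_apply, LinearMap.comp_apply, map_smul, mulGen_rightC hq hc,
      ih, contract_cons_word, map_add, LinearMap.add_apply, rightCsL_cons, h3]
    have h4 : q l y • rightCsL c q a (scale (q y) (contract (c l) (q l) (word v))) =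
        (v.map (q y)).prod • rightCsL c q a (contract (c l) (q l) (word v)) := by
      rw [← map_smul, hq l y, h2, map_smul]
    have h5 := congrArg (fun T => rightC c q y (T (scale (q l) x))) h4
    simp only [LinearMap.smul_apply, map_smul] at h5
    have h6 : q l y • -q y a • rightC c q y (rightCsL c q a
        (scale (q y) (contract (c l) (q l) (word v))) (scale (q l) x)) =
        -q y a • q l y • rightC c q y (rightCsL c q a
        (scale (q y) (contract (c l) (q l) (word v))) (scale (q l) x)) := by module
    rw [h6, h5, ← h1]
    by_cases hx : c l y = 0
    · rw [hx]; module
    · rw [hc l y hx]; module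

theorem mulGen_rightCsL (hq : ∀ x y, q x y = q y x) (hc : ∀ x y, c x y ≠ 0 → q x = q y)
    (l : ι) (v x : Words ι) :
    mulGen c q l (rightCsL c q a v x) = rightCsL c q a v (mulGen c q l x) +
      q l a • rightCsL c q a (contract (c l) (q l) v) (scale (q l) x) := by
  have h := hom_congr (f := (rightCsL c q a).flip x |>.comp LinearMap.id |> (mulGen c q l).comp)
    (g := (rightCsL c q a).flip (mulGen c q l x) +
      q l a • ((rightCsL c q a).flip (scale (q l) x) ∘ₗ contract (c l) (q l)))
    (fun w => by simpa [rightCsL] using mulGen_rightCs a hq hc l w x) v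
  simpa using h

theorem rightCsL_word_nil (v : Words ι) :
    rightCsL c q a v (word []) = vac v • word [] :=
  hom_congr (f := (rightCsL c q a).flip (word [])) (g := vac.smulRight (word [])) (fun w => by
    induction w with
    | nil => simp [rightCsL, rightCs]
    | cons y v ih =>
      have h : rightCs c q a v (word []) = vac (word v) • word [] := by simpa [rightCsL] using ih
      simp [rightCsL, rightCs, h]) v

variable (c q)

/-- Auxiliary to `dual`: the contributions in which the letters of `v` already stand to the
right of the letter paired with `a`; the first argument is read from right to left. -/
def dualRev : List ι → Words ι →ₗ[ℂ] Words ι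
  | [] => 0
  | k :: w => c k a • (rightCsL c q a).flip (word w.reverse) + dualRev w ∘ₗ cons k

/-- `dualRev` as a bilinear map. -/
def dualAux : Words ι →ₗ[ℂ] Words ι →ₗ[ℂ] Words ι := ext fun w => dualRev c q a w.reverse

/-- The dual variable on words: the sum over the decompositions `w = u k v` of the signed iterated
contractions of `u` from the right by `v`, multiplied by `c k a`. -/
def dual : Words ι →ₗ[ℂ] Words ι := (dualAux c q a).flip (word [])

theorem dualAux_nil : dualAux c q a (word []) = 0 := by simp [dualAux, dualRev]

theorem dualAux_snoc (k : ι) (x v : Words ι) : dualAux c q a (snoc k x) v =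
    c k a • rightCsL c q a v x + dualAux c q a x (cons k v) :=
  hom_congr (f := (dualAux c q a).flip v ∘ₗ snoc k)
    (g := c k a • rightCsL c q a v + (dualAux c q a).flip (cons k v))
    (fun w => by simp [dualAux, dualRev]) x

variable {c q}

/-- The commutation relation of `dualAux`. The error term, in which `v` is contracted from the left,
telescopes in the recursion over the letters of `w`. -/
theorem mulGen_dualAux (hq : ∀ x y, q x y = q y x) (hc : ∀ x y, c x y ≠ 0 → q x = q y)
    (l : ι) (w : List ι) (v : Words ι) :
    mulGen c q l (dualAux c q a (word w) v) = dualAux c q a (mulGen c q l (word w)) v +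
      dualAux c q a (scale (q l) (word w)) (contract (c l) (q l) v) -
      (c l a * vac (word w) * vac v) • word [] := by
  induction w using List.reverseRecOn generalizing v with
  | nil =>
    have h := dualAux_snoc c q a l (word []) v
    simp only [snoc_word, List.nil_append, dualAux_nil, LinearMap.zero_apply,
      rightCsL_word_nil] at h
    simp only [mulGen_apply, dualAux_nil, LinearMap.zero_apply, map_zero, cons_word, contract_nil,
      h, scale_word, map_smul, LinearMap.smul_apply, vac_nil, add_zero]
    module
  | append_singleton w k ih =>
    have h0 : vac (word (w ++ [k])) = 0 := by cases w <;> simp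
    have h1 : mulGen c q l (snoc k (word w)) =
        snoc k (mulGen c q l (word w)) + c l k • scale (q l) (word w) := by
      rw [mulGen_apply, mulGen_apply, contract_snoc, map_add, cons_snoc]; abel
    have h2 : scale (q l) (word (w ++ [k])) = q l k • snoc k (scale (q l) (word w)) := by
      simp only [scale_word, map_smul, snoc_word, List.map_append, List.prod_append, smul_smul,
        List.map_cons, List.map_nil, List.prod_singleton, mul_comm]
    rw [h0, h2, ← snoc_word, h1]
    simp only [dualAux_snoc, map_add, map_smul, LinearMap.add_apply, LinearMap.smul_apply, ih,
      mulGen_rightCsL a hq hc, contract_cons, vac_cons']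
    by_cases hx : c k a = 0
    · rw [hx]; module
    · rw [show q l k = q l a by rw [hq l k, hq l a, hc k a hx]]; module

/-- The commutation relation `D_a A_l - A_l D_a = c l a ⟪Ω, ·⟫ Ω` of the dual variable with the
generators. -/
theorem mulGen_dual (hq : ∀ x y, q x y = q y x) (hc : ∀ x y, c x y ≠ 0 → q x = q y)
    (l : ι) (x : Words ι) :
    dual c q a (mulGen c q l x) = mulGen c q l (dual c q a x) + (c l a * vac x) • word [] :=
  hom_congr (f := dual c q a ∘ₗ mulGen c q l)
    (g := mulGen c q l ∘ₗ dual c q a + (c l a • vac).smulRight (word [])) (fun w => by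
      have h := mulGen_dualAux a hq hc l w (word [])
      simp only [contract_nil, map_zero, vac_nil, add_zero, mul_one] at h
      simp [dual, h]) x

end Dual

end Words
end MixedQAW
end

noncomputable section

namespace MixedQAW
namespace Words

/-! ### Iterated contractions as sums over permutations -/

section Permanent

/-- The permutation of `Fin (n + 1)` with `0 ↦ k` which maps the other elements to the complement
of `k` in the way prescribed by `τ`. -/
def permInsert {n : ℕ} (k : Fin (n + 1)) (τ : Equiv.Perm (Fin n)) : Equiv.Perm (Fin (n + 1)) :=
  k.cycleRange.symm * Equiv.Perm.decomposeFin.symm (0, τ)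

@[simp] theorem permInsert_zero {n : ℕ} (k : Fin (n + 1)) (τ : Equiv.Perm (Fin n)) :
    permInsert k τ 0 = k := by
  simp [permInsert]

@[simp] theorem permInsert_succ {n : ℕ} (k : Fin (n + 1)) (τ : Equiv.Perm (Fin n)) (i : Fin n) :
    permInsert k τ i.succ = k.succAbove (τ i) := by
  simp [permInsert, Equiv.Perm.decomposeFin_symm_apply_succ]

theorem permInsert_bijective (n : ℕ) : Function.Bijective
    fun z : Fin (n + 1) × Equiv.Perm (Fin n) => permInsert z.1 z.2 := by
  rw [Fintype.bijective_iff_injective_and_card]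
  constructor
  · rintro ⟨k, τ⟩ ⟨k', τ'⟩ h
    have h0 : k = k' := by simpa using congrArg (fun σ => σ 0) h
    subst h0
    have h1 : τ = τ' := Equiv.ext fun i => by simpa using congrArg (fun σ => σ i.succ) h
    rw [h1]
  · simp [Fintype.card_perm, Nat.factorial_succ]

variable {ι : Type*}

/-- The contraction of a word as a sum over the place of the removed letter. -/
theorem contract_ofFn (c r : ι → ℂ) {n : ℕ} (y : Fin (n + 1) → ι) :
    contract c r (word (List.ofFn y)) =
      ∑ k, (c (y k) * ∏ s, if s < k then r (y s) else 1) •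
        word (List.ofFn fun i => y (k.succAbove i)) := by
  induction n with
  | zero => simp
  | succ n ih =>
    rw [List.ofFn_succ, contract_cons_word, ih, Fin.sum_univ_succ (n := n + 1), map_sum,
      Finset.smul_sum]
    congr 1
    · simp
    · refine Finset.sum_congr rfl fun k _ => ?_
      rw [map_smul, cons_word, smul_smul]
      congr 1
      · rw [Fin.prod_univ_succ (n := n + 1)]
        simp only [Fin.succ_pos, if_true, Fin.succ_lt_succ_iff]
        ring
      · rw [List.ofFn_succ (n := n)]
        simp

variable (c q : ι → ι → ℂ)

/-- The successive contractions from the left by the letters of a word, the first letter acting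
first. -/
def contracts : List ι → Words ι →ₗ[ℂ] Words ι
  | [] => LinearMap.id
  | x :: v => contracts v ∘ₗ contract (c x) (q x)

theorem contracts_append (v w : List ι) (x : Words ι) :
    contracts c q (v ++ w) x = contracts c q w (contracts c q v x) := by
  induction v generalizing x with
  | nil => simp [contracts]
  | cons l v ih => simp [contracts, ih]

/-- The sum over all bijections between the letters of two words of equal length, with the product
of `c` over the matched pairs and the product of `q` over the inversions. -/
def permSum {n : ℕ} (x y : Fin n → ι) : ℂ :=
  ∑ σ : Equiv.Perm (Fin n), (∏ i, c (x i) (y (σ i))) *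
    ∏ i, ∏ i', if i < i' ∧ σ i' < σ i then q (x i) (y (σ i')) else 1

theorem vac_contracts_ofFn {n : ℕ} (x y : Fin n → ι) :
    vac (contracts c q (List.ofFn x) (word (List.ofFn y))) = permSum c q x y := by
  induction n with
  | zero => simp [contracts, permSum]
  | succ n ih =>
    rw [List.ofFn_succ, contracts, LinearMap.comp_apply, contract_ofFn, map_sum, map_sum, permSum,
      ← (permInsert_bijective n).sum_comp, Fintype.sum_prod_type]
    refine Finset.sum_congr rfl fun k _ => ?_
    rw [map_smul, map_smul, ih, permSum, smul_eq_mul, Finset.mul_sum]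
    refine Finset.sum_congr rfl fun τ _ => ?_
    have h : (∏ s, if s < k then q (x 0) (y s) else 1) =
        ∏ i : Fin n, if k.succAbove (τ i) < k then q (x 0) (y (k.succAbove (τ i))) else 1 := by
      rw [Fin.prod_univ_succAbove _ k, Equiv.prod_comp τ fun i =>
        if k.succAbove i < k then q (x 0) (y (k.succAbove i)) else 1]
      simp
    rw [h]
    simp only [Fin.prod_univ_succ, permInsert_zero, permInsert_succ, Fin.succ_pos,
      false_and, if_false, one_mul, true_and, Fin.not_lt_zero, Fin.succ_lt_succ_iff,
      Fin.succAbove_lt_succAbove_iff]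
    ring

/-- Every contraction removes exactly one letter. -/
theorem vac_contracts_of_length_ne (v w : List ι) (h : v.length ≠ w.length) :
    vac (contracts c q v (word w)) = 0 := by
  have key : ∀ (v : List ι) (n : ℕ) (x : Words ι), v.length ≠ n →
      x ∈ Submodule.span ℂ (word '' {w : List ι | w.length = n}) →
      vac (contracts c q v x) = 0 := by
    intro v
    induction v with
    | nil =>
      intro n x hn hx
      induction hx using Submodule.span_induction with
      | mem x hx =>
        obtain ⟨w, hw, rfl⟩ := hx
        cases w with
        | nil => exact absurd hw (by simpa using hn)
        | cons l w => simp [contracts]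
      | zero => simp
      | add x y _ _ hx hy => rw [map_add, map_add, hx, hy, add_zero]
      | smul a x _ hx => rw [map_smul, map_smul, hx, smul_zero]
    | cons l v ih =>
      intro n x hn hx
      induction hx using Submodule.span_induction with
      | mem x hx =>
        obtain ⟨w, hw, rfl⟩ := hx
        cases n with
        | zero =>
          rw [List.length_eq_zero_iff.mp hw]
          simp [contracts]
        | succ n =>
          refine ih n _ (by simpa using hn) ?_
          have hw' : w = List.ofFn fun i : Fin (n + 1) => w.get (i.cast (hw : _ = _).symm) := by
            refine List.ext_get (by simpa using hw) fun i h1 h2 => ?_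
            rw [List.get_ofFn]; rfl
          rw [hw', contract_ofFn]
          exact Submodule.sum_mem _ fun k _ => Submodule.smul_mem _ _
            (Submodule.subset_span ⟨_, by simp, rfl⟩)
      | zero => simp
      | add x y _ _ hx hy => rw [map_add, map_add, hx, hy, add_zero]
      | smul a x _ hx => rw [map_smul, map_smul, hx, smul_zero]
  exact key v _ _ h (Submodule.subset_span ⟨w, rfl, rfl⟩)

end Permanent

/-! ### The vacuum coefficient of the dual variable -/

section Dual

variable {ι : Type*} (c q : ι → ι → ℂ) (a : ι)

/-- The signed weight of all pairs of letters of `a` and `v`. -/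
def pairWeight : List ι → ℂ
  | [] => 1
  | x :: v => -(q x a * (v.map (q x)).prod) * pairWeight v

theorem rightCs_rev (v : List ι) (y : Words ι) : rightCs c q a v (rev y) =
    pairWeight q a v • rev (contracts (fun x l => c l x) q v.reverse y) := by
  induction v with
  | nil => simp [rightCs, pairWeight, contracts]
  | cons x v ih =>
    rw [rightCs, LinearMap.smul_apply, LinearMap.comp_apply, ih, map_smul, rightC, rcontract_rev,
      List.reverse_cons, contracts_append, smul_smul]
    rfl

theorem vac_rightCs (v w : List ι) : vac (rightCs c q a v (word w)) =
    pairWeight q a v * vac (contracts (fun x l => c l x) q v.reverse (word w.reverse)) := by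
  have h := rightCs_rev c q a v (word w.reverse)
  rw [rev_word, List.reverse_reverse] at h
  rw [h, map_smul, vac_rev, smul_eq_mul]

/-- A decomposition `u k v` contributes to the vacuum coefficient only if `u` and `v` have the same
length. -/
theorem vac_dualRev_of_length_ne (w v : List ι) (h : ∀ m, w.length + v.length ≠ 2 * m + 1) :
    vac (dualRev c q a w (word v)) = 0 := by
  induction w generalizing v with
  | nil => simp [dualRev]
  | cons k w ih =>
    have h1 : rightCsL c q a (word v) = rightCs c q a v := by simp [rightCsL]
    rw [dualRev, LinearMap.add_apply, map_add, LinearMap.comp_apply, cons_word,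
      ih _ fun m => by have := h m; simp only [List.length_cons] at this ⊢; omega]
    rw [LinearMap.smul_apply, LinearMap.flip_apply, h1, map_smul, vac_rightCs,
      vac_contracts_of_length_ne]
    · simp
    · have := h v.length
      simp only [List.length_cons, List.length_reverse] at this ⊢
      omega

/-- The decompositions at a letter to the left of the middle do not contribute. -/
theorem vac_dualRev_lt (w v : List ι) (h : w.length ≤ v.length) :
    vac (dualRev c q a w (word v)) = 0 := by
  induction w generalizing v with
  | nil => simp [dualRev]
  | cons k w ih =>
    have h1 : rightCsL c q a (word v) = rightCs c q a v := by simp [rightCsL]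
    simp only [List.length_cons] at h
    rw [dualRev, LinearMap.add_apply, map_add, LinearMap.comp_apply, cons_word,
      ih _ (by simp only [List.length_cons]; omega), LinearMap.smul_apply, LinearMap.flip_apply, h1,
      map_smul, vac_rightCs, vac_contracts_of_length_ne]
    · simp
    · simp only [List.length_reverse]; omega

/-- Only the decomposition of a word at its middle letter `k` contributes. -/
theorem vac_dualRev_append (s u v : List ι) (k : ι) (h : u.length = s.length + v.length) :
    vac (dualRev c q a (s ++ k :: u) (word v)) = c k a * (pairWeight q a (s.reverse ++ v) *
      vac (contracts (fun x l => c l x) q (s.reverse ++ v).reverse (word u))) := by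
  induction s generalizing v with
  | nil =>
    have h1 : rightCsL c q a (word v) = rightCs c q a v := by simp [rightCsL]
    simp only [List.length_nil, zero_add] at h
    rw [List.nil_append, dualRev, LinearMap.add_apply, map_add, LinearMap.comp_apply, cons_word,
      vac_dualRev_lt c q a u _ (by simp only [List.length_cons]; omega), LinearMap.smul_apply,
      LinearMap.flip_apply, h1, map_smul, vac_rightCs]
    simp
  | cons x s ih =>
    have h1 : rightCsL c q a (word v) = rightCs c q a v := by simp [rightCsL]
    simp only [List.length_cons] at h
    rw [List.cons_append, dualRev, LinearMap.add_apply, map_add, LinearMap.comp_apply, cons_word,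
      ih _ (by simp only [List.length_cons]; omega), LinearMap.smul_apply,
      LinearMap.flip_apply, h1, map_smul, vac_rightCs, vac_contracts_of_length_ne]
    · simp
    · simp only [List.length_reverse, List.length_append, List.length_cons]; omega

theorem vac_dual_of_even (w : List ι) (h : ∀ m, w.length ≠ 2 * m + 1) :
    vac (dual c q a (word w)) = 0 := by
  have := vac_dualRev_of_length_ne c q a w.reverse [] (by simpa using h)
  simpa [dual, dualAux] using this

theorem pairWeight_ofFn {m : ℕ} (x : Fin m → ι) :
    pairWeight q a (List.ofFn x).reverse = (-1) ^ m *
      ∏ u : Fin (m + 1), ∏ v : Fin (m + 1), if v < u then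
        q (Fin.cons (α := fun _ => ι) a x u) (Fin.cons (α := fun _ => ι) a x v) else 1 := by
  induction m with
  | zero => simp [pairWeight]
  | succ m ih =>
    rw [List.ofFn_succ', List.concat_eq_append, List.reverse_append, List.reverse_singleton,
      List.singleton_append, pairWeight, ih, Fin.prod_univ_castSucc (n := m + 1)]
    have h1 : ∀ i : Fin (m + 1), (Fin.cons (α := fun _ => ι) a x i.castSucc : ι) =
        Fin.cons (α := fun _ => ι) a (fun i => x i.castSucc) i := by
      intro i
      refine Fin.cases ?_ (fun i => ?_) i
      · rfl
      · rw [← Fin.succ_castSucc]; rfl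
    have h2 : (Fin.cons (α := fun _ => ι) a x (Fin.last (m + 1)) : ι) = x (Fin.last m) := by
      rw [← Fin.succ_last]; rfl
    have h3 : (List.map (q (x (Fin.last m))) (List.ofFn fun i => x i.castSucc).reverse).prod =
        ∏ i : Fin m, q (x (Fin.last m)) (x i.castSucc) := by
      rw [List.map_reverse, List.prod_reverse, List.map_ofFn, List.prod_ofFn]; rfl
    rw [h3]
    have h4 : ∀ i : Fin (m + 1), ¬ Fin.last (m + 1) < i.castSucc := fun i =>
      not_lt.mpr (Fin.le_last _)
    simp only [Fin.prod_univ_castSucc (n := m + 1), h1, h2, h4, Fin.castSucc_lt_last,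
      Fin.castSucc_lt_castSucc_iff, if_true, if_false, mul_one, lt_self_iff_false]
    rw [Fin.prod_univ_succ (fun i : Fin (m + 1) => q (x (Fin.last m))
      (Fin.cons (α := fun _ => ι) a (fun i => x i.castSucc) i))]
    simp only [Fin.cons_zero, Fin.cons_succ]
    ring

/-- The vacuum coefficient of the dual variable on the word which, read from right to left, is
`x k y`. -/
theorem vac_dual_ofFn {m : ℕ} (x y : Fin m → ι) (k : ι) :
    vac (dual c q a (word (List.ofFn x ++ k :: List.ofFn y).reverse)) =
      c k a * ((-1) ^ m * (∏ u : Fin (m + 1), ∏ v : Fin (m + 1), if v < u then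
        q (Fin.cons (α := fun _ => ι) a x u) (Fin.cons (α := fun _ => ι) a x v) else 1) *
        permSum (fun x l => c l x) q x y) := by
  have := vac_dualRev_append c q a (List.ofFn x) (List.ofFn y) [] k (by simp)
  rw [List.append_nil, List.reverse_reverse, vac_contracts_ofFn, pairWeight_ofFn] at this
  rw [← this]
  simp [dual, dualAux]

end Dual

end Words
end MixedQAW
end

noncomputable section

namespace MixedQAW

/-! ### Lower bounds for sums of products of braiding operators -/

section Braid

/-- The product `T 0 * T 1 * ⋯ * T (k - 1)`. -/
def braidProd {A : Type*} [Ring A] (T : ℕ → A) : ℕ → A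
  | 0 => 1
  | k + 1 => braidProd T k * T k

/-- The sum of the first `n` products `T 0 * ⋯ * T (k - 1)`. -/
def braidSum {A : Type*} [Ring A] (T : ℕ → A) (n : ℕ) : A := ∑ k ∈ Finset.range n, braidProd T k

variable {A : Type*} [Ring A] {T : ℕ → A}

theorem braidProd_comm (hT : ∀ i j, i + 2 ≤ j → T i * T j = T j * T i) (k j : ℕ) (h : k < j) :
    T j * braidProd T k = braidProd T k * T j := by
  induction k with
  | zero => simp [braidProd]
  | succ k ih =>
    rw [braidProd, ← mul_assoc, ih (by omega), mul_assoc, mul_assoc, hT k j (by omega)]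

theorem braidProd_shift (hT : ∀ i j, i + 2 ≤ j → T i * T j = T j * T i)
    (hB : ∀ i, T i * T (i + 1) * T i = T (i + 1) * T i * T (i + 1)) (i m : ℕ) (h : i + 2 ≤ m) :
    T (i + 1) * braidProd T m = braidProd T m * T i := by
  induction m, h using Nat.le_induction with
  | base =>
    rw [braidProd, braidProd, ← mul_assoc, ← mul_assoc, braidProd_comm hT _ _ (Nat.lt_succ_self i),
      mul_assoc, mul_assoc, ← mul_assoc (T (i + 1)), ← hB]
    simp only [mul_assoc]
  | succ m h ih => rw [braidProd, ← mul_assoc, ih, mul_assoc, mul_assoc, hT i m h]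

theorem braidProd_mul (hT : ∀ i j, i + 2 ≤ j → T i * T j = T j * T i)
    (hB : ∀ i, T i * T (i + 1) * T i = T (i + 1) * T i * T (i + 1)) (k n : ℕ) (h : k < n) :
    braidProd T (k + 1) * braidProd T n = T 0 * braidProd T n * braidProd T k := by
  induction k with
  | zero => simp [braidProd]
  | succ k ih =>
    rw [braidProd, mul_assoc, braidProd_shift hT hB k n (by omega), ← mul_assoc, ih (by omega),
      braidProd]
    simp only [mul_assoc]

/-- The factorization which allows to invert the sums `braidSum T n` one after the other. -/
theorem braidSum_mul (hT : ∀ i j, i + 2 ≤ j → T i * T j = T j * T i)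
    (hB : ∀ i, T i * T (i + 1) * T i = T (i + 1) * T i * T (i + 1)) (n : ℕ) :
    braidSum T (n + 1) * (1 - braidProd T n) = (1 - T 0 * braidProd T n) * braidSum T n := by
  have h : braidSum T (n + 1) * braidProd T n =
      braidProd T n + T 0 * braidProd T n * braidSum T n := by
    rw [braidSum, Finset.sum_range_succ', add_mul, Finset.sum_mul, add_comm, braidSum,
      Finset.mul_sum]
    congr 1
    · simp [braidProd]
    · exact Finset.sum_congr rfl fun k hk => braidProd_mul hT hB k n (Finset.mem_range.mp hk)
  rw [mul_sub, mul_one, h, sub_mul, one_mul, braidSum, Finset.sum_range_succ, braidSum]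
  abel

/-- The constant in the lower bound for `braidSum`. -/
def braidConst (q : ℝ) : ℝ := Real.exp ((1 + 1 / (1 - q)) * (1 - q)⁻¹)

theorem one_le_braidConst {q : ℝ} (h1 : q < 1) : 1 ≤ braidConst q := by
  have : 0 < 1 - q := by linarith
  exact Real.one_le_exp (by positivity)

/-- If the operators `T i` satisfy the braid relations and have norm at most `q < 1`, then
`braidSum T (n + 1)` is bounded below, uniformly in `n`, on every invariant subspace of finite
dimension. -/
theorem norm_le_braidSum {V : Type*} [NormedAddCommGroup V] [NormedSpace ℂ V]
    {T : ℕ → Module.End ℂ V} (hT : ∀ i j, i + 2 ≤ j → T i * T j = T j * T i)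
    (hB : ∀ i, T i * T (i + 1) * T i = T (i + 1) * T i * T (i + 1)) {q : ℝ} (h0 : 0 ≤ q)
    (h1 : q < 1) (hn : ∀ i x, ‖T i x‖ ≤ q * ‖x‖) (F : Submodule ℂ V) [FiniteDimensional ℂ F]
    (hF : ∀ i, ∀ x ∈ F, T i x ∈ F) (n : ℕ) (x : V) (hx : x ∈ F) :
    ‖x‖ ≤ braidConst q * ‖braidSum T (n + 1) x‖ := by
  have hq : 0 < 1 - q := by linarith
  have hprod : ∀ k x, ‖braidProd T k x‖ ≤ q ^ k * ‖x‖ := by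
    intro k
    induction k with
    | zero => simp [braidProd]
    | succ k ih =>
      intro x
      refine (ih _).trans ?_
      rw [pow_succ, mul_assoc]
      exact mul_le_mul_of_nonneg_left (hn k x) (by positivity)
  have hprodF : ∀ k, ∀ x ∈ F, braidProd T k x ∈ F := by
    intro k
    induction k with
    | zero => intro x hx; simpa [braidProd] using hx
    | succ k ih => intro x hx; exact ih _ (hF k x hx)
  have key : ∀ n, ∀ x ∈ F, ‖x‖ ≤ Real.exp (∑ k ∈ Finset.range n, (1 + 1 / (1 - q)) * q ^ (k + 1)) *
      ‖braidSum T (n + 1) x‖ := by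
    intro n
    induction n with
    | zero => intro x _; simp [braidSum, braidProd]
    | succ n ih =>
      have hpow : q ^ (n + 1) ≤ q := pow_le_of_le_one h0 h1.le (by omega)
      have hpow' : q ^ (n + 2) ≤ q ^ (n + 1) := pow_le_pow_of_le_one h0 h1.le (by omega)
      have hpow0 : 0 ≤ q ^ (n + 1) := by positivity
      -- `1 - braidProd T (n + 1)` is invertible on `F`; this reduces `x` to a vector `y` at level `n`.
      let f : F →ₗ[ℂ] F := (1 - braidProd T (n + 1)).restrict fun x hx =>
        F.sub_mem hx (hprodF _ x hx)
      have hf : Function.Surjective f := by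
        rw [← LinearMap.injective_iff_surjective, ← LinearMap.ker_eq_bot, LinearMap.ker_eq_bot']
        rintro ⟨y, hy⟩ h
        have h' : y - braidProd T (n + 1) y = 0 := congrArg Subtype.val h
        have h2 := hprod (n + 1) y
        rw [← sub_eq_zero.mp h'] at h2
        have h3 : ‖y‖ = 0 := by nlinarith [norm_nonneg y]
        exact Subtype.ext (norm_eq_zero.mp h3)
      intro x hx
      obtain ⟨⟨y, hy⟩, hyx⟩ := hf ⟨x, hx⟩
      have hyx' : (1 - braidProd T (n + 1)) y = x := congrArg Subtype.val hyx
      have h2 : ‖x‖ ≤ (1 + q ^ (n + 1)) * ‖y‖ := by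
        rw [← hyx']
        refine (norm_sub_le _ _).trans ?_
        have := hprod (n + 1) y
        simp only [Module.End.one_apply]
        linarith
      have h3 := congrArg (fun S => S y) (braidSum_mul hT hB (n + 1))
      simp only [Module.End.mul_apply, hyx'] at h3
      have h4 : (1 - q ^ (n + 2)) * ‖braidSum T (n + 1) y‖ ≤ ‖braidSum T (n + 1 + 1) x‖ := by
        rw [h3]
        set z := braidSum T (n + 1) y
        have h5 : ‖T 0 (braidProd T (n + 1) z)‖ ≤ q ^ (n + 2) * ‖z‖ := by
          refine (hn 0 _).trans ?_
          rw [pow_succ' q (n + 1), mul_assoc]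
          exact mul_le_mul_of_nonneg_left (hprod _ _) h0
        have h6 := norm_sub_norm_le z (T 0 (braidProd T (n + 1) z))
        change _ ≤ ‖z - T 0 (braidProd T (n + 1) z)‖
        linarith
      have h7 : 1 + q ^ (n + 1) ≤ Real.exp (q ^ (n + 1)) := by
        rw [add_comm]; exact Real.add_one_le_exp _
      have h8 : 1 ≤ Real.exp (1 / (1 - q) * q ^ (n + 1)) * (1 - q ^ (n + 2)) := by
        have hpos : 0 < 1 - q ^ (n + 2) := by linarith
        rw [← div_le_iff₀ hpos]
        refine le_trans ?_ (Real.add_one_le_exp _)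
        rw [div_le_iff₀ hpos, one_div_mul_eq_div, add_mul, div_mul_eq_mul_div, one_mul]
        have h9 : q ^ (n + 2) ≤ q ^ (n + 1) * (1 - q ^ (n + 2)) / (1 - q) := by
          rw [le_div_iff₀ hq]
          exact mul_le_mul hpow' (by linarith) hq.le hpow0
        linarith
      rw [Finset.sum_range_succ, add_mul 1, one_mul, Real.exp_add, Real.exp_add]
      set e := Real.exp (∑ k ∈ Finset.range n, (1 + 1 / (1 - q)) * q ^ (k + 1))
      have he : 0 ≤ e := Real.exp_nonneg _
      set u := Real.exp (q ^ (n + 1))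
      set v := Real.exp (1 / (1 - q) * q ^ (n + 1))
      have hu : 0 ≤ u := Real.exp_nonneg _
      have hv : 0 ≤ v := Real.exp_nonneg _
      calc ‖x‖ ≤ u * ‖y‖ := h2.trans (mul_le_mul_of_nonneg_right h7 (norm_nonneg _))
        _ ≤ u * (e * ‖braidSum T (n + 1) y‖) := mul_le_mul_of_nonneg_left (ih y hy) hu
        _ = e * u * (1 * ‖braidSum T (n + 1) y‖) := by ring
        _ ≤ e * u * (v * (1 - q ^ (n + 2)) * ‖braidSum T (n + 1) y‖) := by gcongr
        _ = e * (u * v) * ((1 - q ^ (n + 2)) * ‖braidSum T (n + 1) y‖) := by ring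
        _ ≤ e * (u * v) * ‖braidSum T (n + 1 + 1) x‖ := by gcongr
  refine (key n x hx).trans (mul_le_mul_of_nonneg_right (Real.exp_le_exp.mpr ?_) (norm_nonneg _))
  rw [← Finset.mul_sum]
  refine mul_le_mul_of_nonneg_left ?_ (by positivity)
  rw [← tsum_geometric_of_lt_one h0 h1]
  refine le_trans (Finset.sum_le_sum fun k _ => pow_le_pow_of_le_one h0 h1.le (Nat.le_succ k)) ?_
  exact (summable_geometric_of_lt_one h0 h1).sum_le_tsum _ fun k _ => by positivity

end Braid

namespace Words

/-! ### The inner product on words -/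

section Norm

variable {ι : Type*}

/-- The inner product for which the words are an orthonormal basis. -/
abbrev core : InnerProductSpace.Core ℂ (Words ι) where
  inner x y := x.sum fun w z => conj z * y w
  conj_inner_symm x y := by
    classical
    rw [Finsupp.sum_of_support_subset (s := x.support ∪ y.support) _ Finset.subset_union_left _
      (by simp), Finsupp.sum_of_support_subset (s := x.support ∪ y.support) _
      Finset.subset_union_right _ (by simp), map_sum]
    simp [mul_comm]
  re_inner_nonneg x := by
    simp only [Finsupp.sum, map_sum, RCLike.re_to_complex, ← Complex.normSq_eq_conj_mul_self,
      Complex.ofReal_re]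
    exact Finset.sum_nonneg fun w _ => Complex.normSq_nonneg _
  add_left x y z := by
    classical
    exact Finsupp.sum_add_index' (by simp) (by simp [add_mul])
  smul_left x y a := by
    rw [Finsupp.sum_smul_index' (by simp), Finsupp.mul_sum]
    simp [mul_assoc]
  definite x h := by
    have h' := congrArg Complex.re h
    simp only [Finsupp.sum, Complex.re_sum, ← Complex.normSq_eq_conj_mul_self,
      Complex.ofReal_re, Complex.zero_re] at h'
    rw [Finset.sum_eq_zero_iff_of_nonneg fun w _ => Complex.normSq_nonneg _] at h'
    ext1 w
    by_cases hw : w ∈ x.support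
    · simpa using h' w hw
    · simpa using hw

instance : NormedAddCommGroup (Words ι) :=
  InnerProductSpace.Core.toNormedAddCommGroup (𝕜 := ℂ) (cd := core)

instance : InnerProductSpace ℂ (Words ι) := InnerProductSpace.ofCore core.toCore

theorem inner_def (x y : Words ι) : ⟪x, y⟫_ℂ = x.sum fun w z => conj z * y w := rfl

@[simp] theorem inner_word (w : List ι) (x : Words ι) : ⟪word w, x⟫_ℂ = x w := by
  simp [inner_def, word]

theorem word_self (w : List ι) : (word w) w = 1 := by simp [word]

theorem word_of_ne {v w : List ι} (h : v ≠ w) : (word w) v = 0 := Finsupp.single_eq_of_ne h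

theorem orthonormal_word : Orthonormal ℂ (word : List ι → Words ι) := by
  classical
  rw [orthonormal_iff_ite]
  intro v w
  rw [inner_word, word, Finsupp.single_apply]
  simp [eq_comm]

/-- The inner products of images under a weighted injective substitution of words. -/
theorem inner_ext_ext {s : List ι → List ι} (hs : Function.Injective s) (a : List ι → ℂ)
    (x y : Words ι) : ⟪ext (fun w => a w • word (s w)) x, ext (fun w => a w • word (s w)) y⟫_ℂ =
      x.sum fun w z => conj (a w * z) * (a w * y w) := by
  classical
  have h : ∀ x : Words ι, ext (fun w => a w • word (s w)) x =
      x.sum fun w z => (a w * z) • word (s w) := by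
    intro x
    simp [ext, Finsupp.linearCombination_apply, smul_smul, mul_comm]
  rw [h, h, Finsupp.sum_of_support_subset (s := x.support ∪ y.support) _ Finset.subset_union_left _
      (by simp), Finsupp.sum_of_support_subset (s := x.support ∪ y.support) _
      Finset.subset_union_right _ (by simp)]
  have h3 := (orthonormal_word.comp s hs).inner_sum (fun w => a w * x w) (fun w => a w * y w)
    (x.support ∪ y.support)
  simp only [Function.comp_apply] at h3
  rw [h3, Finsupp.sum_of_support_subset (s := x.support ∪ y.support) _ Finset.subset_union_left _
      (by simp)]

theorem norm_sq_eq (x : Words ι) : ‖x‖ ^ 2 = ∑ w ∈ x.support, ‖x w‖ ^ 2 := by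
  rw [← inner_self_eq_norm_sq (𝕜 := ℂ), inner_def, Finsupp.sum, map_sum]
  refine Finset.sum_congr rfl fun w _ => ?_
  rw [RCLike.re_to_complex, ← Complex.normSq_eq_conj_mul_self, Complex.ofReal_re,
    Complex.normSq_eq_norm_sq]

theorem norm_ext_le {s : List ι → List ι} (hs : Function.Injective s) (a : List ι → ℂ) {q : ℝ}
    (h0 : 0 ≤ q) (ha : ∀ w, ‖a w‖ ≤ q) (x : Words ι) :
    ‖ext (fun w => a w • word (s w)) x‖ ≤ q * ‖x‖ := by
  refine le_of_sq_le_sq ?_ (by positivity)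
  rw [← inner_self_eq_norm_sq (𝕜 := ℂ), inner_ext_ext hs, mul_pow, norm_sq_eq, Finset.mul_sum,
    Finsupp.sum, map_sum]
  refine Finset.sum_le_sum fun w _ => ?_
  rw [RCLike.re_to_complex, ← Complex.normSq_eq_conj_mul_self, Complex.ofReal_re,
    Complex.normSq_eq_norm_sq, norm_mul, mul_pow]
  gcongr
  exact ha w

theorem inner_cons_cons (k : ι) (x y : Words ι) : ⟪cons k x, cons k y⟫_ℂ = ⟪x, y⟫_ℂ := by
  have h := inner_ext_ext (List.cons_injective (a := k)) (fun _ => 1) x y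
  simpa [cons, inner_def] using h

theorem inner_cons_ne {k l : ι} (h : k ≠ l) (x y : Words ι) : ⟪cons k x, cons l y⟫_ℂ = 0 := by
  have h1 : ∀ w, (cons l y) (k :: w) = 0 := fun w =>
    hom_congr (f := Finsupp.lapply (k :: w) ∘ₗ cons l) (g := 0) (fun v => by
      rw [LinearMap.comp_apply, cons_word, Finsupp.lapply_apply, word_of_ne (by simp [h])]
      rfl) y
  induction x using Finsupp.induction_linear with
  | zero => simp
  | add a b ha hb => rw [map_add, inner_add_left, ha, hb, add_zero]
  | single w z =>
    have h2 : (Finsupp.single w z : Words ι) = z • word w := by simp [word]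
    rw [h2, map_smul, inner_smul_left, cons_word, inner_word, h1, mul_zero]

theorem norm_sq_sum_cons [Fintype ι] (x : ι → Words ι) :
    ‖∑ k, cons k (x k)‖ ^ 2 = ∑ k, ‖x k‖ ^ 2 := by
  classical
  rw [← inner_self_eq_norm_sq (𝕜 := ℂ), sum_inner, map_sum]
  refine Finset.sum_congr rfl fun k _ => ?_
  rw [inner_sum, Finset.sum_eq_single k, inner_cons_cons, inner_self_eq_norm_sq]
  · intro l _ h
    exact inner_cons_ne h.symm _ _
  · simp

end Norm

/-! ### The symmetrization operator on words -/

section Levels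

variable {ι : Type*}

/-- The span of the words of length `n`. -/
def level (ι : Type*) (n : ℕ) : Submodule ℂ (Words ι) :=
  Submodule.span ℂ (word '' {w | w.length = n})

theorem word_mem_level (w : List ι) : word w ∈ level ι w.length :=
  Submodule.subset_span ⟨w, rfl, rfl⟩

theorem map_mem_level {V : Type*} [AddCommGroup V] [Module ℂ V] {n : ℕ} {f : Words ι →ₗ[ℂ] V}
    {F : Submodule ℂ V} (h : ∀ w : List ι, w.length = n → f (word w) ∈ F) {x : Words ι}
    (hx : x ∈ level ι n) : f x ∈ F := by
  have : level ι n ≤ F.comap f := Submodule.span_le.mpr (by rintro _ ⟨w, hw, rfl⟩; exact h w hw)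
  exact this hx

instance [Finite ι] (n : ℕ) : FiniteDimensional ℂ (level ι n) := by
  have h : (word '' {w : List ι | w.length = n}).Finite := (List.finite_length_eq ι n).image _
  rw [← Submodule.fg_iff_finiteDimensional]
  exact ⟨h.toFinset, by rw [h.coe_toFinset]; rfl⟩

theorem cons_mem_level (k : ι) {n : ℕ} {x : Words ι} (hx : x ∈ level ι n) :
    cons k x ∈ level ι (n + 1) :=
  map_mem_level (fun w hw => by rw [cons_word, ← hw]; exact word_mem_level (k :: w)) hx

theorem contract_mem_level (c r : ι → ℂ) {n : ℕ} {x : Words ι} (hx : x ∈ level ι (n + 1)) :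
    contract c r x ∈ level ι n := by
  refine map_mem_level (fun w hw => ?_) hx
  clear hx
  induction n generalizing w with
  | zero =>
    obtain ⟨l, rfl⟩ := List.length_eq_one_iff.mp hw
    rw [contract_cons_word]
    simpa using Submodule.smul_mem _ _ (word_mem_level ([] : List ι))
  | succ n ih =>
    obtain ⟨l, w, rfl⟩ := List.exists_cons_of_length_eq_add_one hw
    have hw' : w.length = n + 1 := by simpa using hw
    rw [contract_cons_word]
    refine add_mem (Submodule.smul_mem _ _ ?_) (Submodule.smul_mem _ _ (cons_mem_level l (ih w hw')))
    rw [← hw']; exact word_mem_level w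

/-- Exchange of the letters at the places `i` and `i + 1` of a word, if there are such letters. -/
def swapWord : ℕ → List ι → List ι
  | 0, a :: b :: w => b :: a :: w
  | 0, w => w
  | _ + 1, [] => []
  | i + 1, a :: w => a :: swapWord i w

/-- The weight of `swapWord`, which vanishes on short words. -/
def swapWeight (q : ι → ι → ℂ) : ℕ → List ι → ℂ
  | 0, a :: b :: _ => q a b
  | 0, _ => 0
  | _ + 1, [] => 0
  | i + 1, _ :: w => swapWeight q i w

theorem swapWord_swapWord (i : ℕ) (w : List ι) : swapWord i (swapWord i w) = w := by
  induction i generalizing w with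
  | zero => rcases w with _ | ⟨a, _ | ⟨b, w⟩⟩ <;> simp [swapWord]
  | succ i ih => cases w <;> simp [swapWord, ih]

theorem length_swapWord (i : ℕ) (w : List ι) : (swapWord i w).length = w.length := by
  induction i generalizing w with
  | zero => rcases w with _ | ⟨a, _ | ⟨b, w⟩⟩ <;> simp [swapWord]
  | succ i ih => cases w <;> simp [swapWord, ih]

variable (q : ι → ι → ℂ)

theorem norm_swapWeight_le {q₀ : ℝ} (h0 : 0 ≤ q₀) (hq0 : ∀ x y, ‖q x y‖ ≤ q₀) (i : ℕ)
    (w : List ι) : ‖swapWeight q i w‖ ≤ q₀ := by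
  induction i generalizing w with
  | zero => rcases w with _ | ⟨a, _ | ⟨b, w⟩⟩ <;> simp [swapWeight, h0, hq0]
  | succ i ih => cases w <;> simp [swapWeight, h0, ih]

/-- The braiding operator acting on the letters at the places `i` and `i + 1`. -/
def braiding (i : ℕ) : Module.End ℂ (Words ι) :=
  ext fun w => swapWeight q i w • word (swapWord i w)

theorem braiding_word (i : ℕ) (w : List ι) :
    braiding q i (word w) = swapWeight q i w • word (swapWord i w) := by simp [braiding]

theorem braiding_succ_cons (i : ℕ) (k : ι) (x : Words ι) :
    braiding q (i + 1) (cons k x) = cons k (braiding q i x) :=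
  hom_congr (f := braiding q (i + 1) ∘ₗ cons k) (g := cons k ∘ₗ braiding q i) (fun w => by
    simp [braiding_word, swapWeight, swapWord]) x

theorem braiding_zero_cons_cons (k l : ι) (x : Words ι) :
    braiding q 0 (cons k (cons l x)) = q k l • cons l (cons k x) :=
  hom_congr (f := braiding q 0 ∘ₗ cons k ∘ₗ cons l) (g := q k l • (cons l ∘ₗ cons k)) (fun w => by
    simp [braiding_word, swapWeight, swapWord]) x

theorem braiding_comm (i j : ℕ) (h : i + 2 ≤ j) :
    braiding q i * braiding q j = braiding q j * braiding q i := by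
  refine hom_ext fun w => ?_
  simp only [Module.End.mul_apply]
  induction i generalizing j w with
  | zero =>
    obtain ⟨j, rfl⟩ := Nat.exists_eq_add_of_le' h
    rcases w with _ | ⟨a, _ | ⟨b, w⟩⟩
    · simp [braiding_word, swapWeight]
    · simp [braiding_word, swapWeight, swapWord]
    · rw [← cons_word, ← cons_word, braiding_succ_cons, braiding_succ_cons,
        braiding_zero_cons_cons, braiding_zero_cons_cons, map_smul, braiding_succ_cons,
        braiding_succ_cons]
  | succ i ih =>
    obtain ⟨j, rfl⟩ : ∃ j', j = j' + 1 := ⟨j - 1, by omega⟩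
    rcases w with _ | ⟨a, w⟩
    · simp [braiding_word, swapWeight]
    · rw [← cons_word]
      simp only [braiding_succ_cons, ih j (by omega)]

theorem braiding_braid (i : ℕ) :
    braiding q i * braiding q (i + 1) * braiding q i =
      braiding q (i + 1) * braiding q i * braiding q (i + 1) := by
  refine hom_ext fun w => ?_
  simp only [Module.End.mul_apply]
  induction i generalizing w with
  | zero =>
    rcases w with _ | ⟨a, _ | ⟨b, _ | ⟨c, w⟩⟩⟩
    · simp [braiding_word, swapWeight]
    · simp [braiding_word, swapWeight]
    · simp [braiding_word, swapWeight, swapWord]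
    · simp only [zero_add, braiding_word, swapWeight, swapWord, map_smul, smul_smul]
      congr 1
      ring
  | succ i ih =>
    rcases w with _ | ⟨a, w⟩
    · simp [braiding_word, swapWeight]
    · rw [← cons_word]
      simp only [braiding_succ_cons, ih]

theorem norm_braiding_le {q₀ : ℝ} (h0 : 0 ≤ q₀) (hq0 : ∀ x y, ‖q x y‖ ≤ q₀) (i : ℕ)
    (x : Words ι) : ‖braiding q i x‖ ≤ q₀ * ‖x‖ :=
  norm_ext_le (Function.LeftInverse.injective (swapWord_swapWord i)) _ h0
    (norm_swapWeight_le q h0 hq0 i) x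

theorem braiding_mem_level (i : ℕ) {n : ℕ} {x : Words ι} (hx : x ∈ level ι n) :
    braiding q i x ∈ level ι n :=
  map_mem_level (fun w hw => by
    rw [braiding_word, ← hw, ← length_swapWord i w]
    exact Submodule.smul_mem _ _ (word_mem_level _)) hx

/-- The annihilation of the letter `k` from the left, for the orthonormal basis of letters. -/
abbrev ann [DecidableEq ι] (k : ι) : Words ι →ₗ[ℂ] Words ι := contract (Pi.single k 1) (q k)

theorem braidProd_cons (n : ℕ) (k : ι) (x : Words ι) :
    braidProd (braiding q) (n + 1) (cons k x) =
      braiding q 0 (cons k (braidProd (braiding q) n x)) := by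
  induction n generalizing x with
  | zero => simp [braidProd]
  | succ n ih =>
    rw [braidProd, Module.End.mul_apply, braiding_succ_cons, ih]
    rfl

theorem braidSum_cons (n : ℕ) (k : ι) (x : Words ι) :
    braidSum (braiding q) (n + 1) (cons k x) =
      cons k x + braiding q 0 (cons k (braidSum (braiding q) n x)) := by
  rw [braidSum, Finset.sum_range_succ', LinearMap.add_apply, LinearMap.sum_apply, add_comm]
  simp only [braidProd_cons, braidSum, LinearMap.sum_apply, map_sum]
  simp [braidProd]

variable [Fintype ι] [DecidableEq ι]

/-- The sum `∑ k, k ⊗ a_k` agrees with `braidSum` on words of the right length. -/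
theorem sum_cons_ann (hq : ∀ x y, q x y = q y x) {n : ℕ} {x : Words ι} (hx : x ∈ level ι n) :
    ∑ k, cons k (ann q k x) = braidSum (braiding q) n x := by
  have key : ∀ w : List ι, ∑ k, cons k (ann q k (word w)) =
      braidSum (braiding q) w.length (word w) := by
    intro w
    induction w with
    | nil => simp [braidSum]
    | cons l w ih =>
      rw [List.length_cons, ← cons_word, braidSum_cons, ← ih]
      simp only [contract_cons, map_add, map_smul, Finset.sum_add_distrib, map_sum,
        braiding_zero_cons_cons, hq l]
      congr 1
      rw [Finset.sum_eq_single l]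
      · simp
      · intro k _ hk
        rw [Pi.single_eq_of_ne hk.symm, zero_smul]
      · simp
  have h := map_mem_level (f := ∑ k, cons k ∘ₗ ann q k - braidSum (braiding q) n) (F := ⊥)
    (fun w hw => by
      have := key w
      rw [hw] at this
      simp [LinearMap.sub_apply, LinearMap.sum_apply, this]) hx
  simpa [LinearMap.sub_apply, LinearMap.sum_apply, sub_eq_zero] using h

/-- The symmetrization operator on words of length `n`. -/
def symm : ℕ → Words ι →ₗ[ℂ] Words ι
  | 0 => LinearMap.id
  | n + 1 => ∑ k, cons k ∘ₗ symm n ∘ₗ ann q k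

theorem symm_succ_apply (n : ℕ) (x : Words ι) :
    symm q (n + 1) x = ∑ k, cons k (symm q n (ann q k x)) := by
  simp [symm, LinearMap.sum_apply]

theorem symm_mem_level {n : ℕ} {x : Words ι} (hx : x ∈ level ι n) : symm q n x ∈ level ι n := by
  induction n generalizing x with
  | zero => exact hx
  | succ n ih =>
    rw [symm_succ_apply]
    exact Submodule.sum_mem _ fun k _ => cons_mem_level k (ih (contract_mem_level _ _ hx))

/-- The symmetrization operator is bounded below, with a bound which decays at most exponentially
in the length. -/
theorem norm_le_symm (hq : ∀ x y, q x y = q y x) {q₀ : ℝ} (h0 : 0 ≤ q₀) (h1 : q₀ < 1)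
    (hq0 : ∀ x y, ‖q x y‖ ≤ q₀) {n : ℕ} {x : Words ι} (hx : x ∈ level ι n) :
    ‖x‖ ≤ braidConst q₀ ^ n * ‖symm q n x‖ := by
  have hK := one_le_braidConst h1
  induction n generalizing x with
  | zero => simp [symm]
  | succ n ih =>
    have h2 := norm_le_braidSum (braiding_comm q) (braiding_braid q) h0 h1
      (norm_braiding_le q h0 hq0) (level ι (n + 1)) (fun i x hx => braiding_mem_level q i hx) n x hx
    rw [← sum_cons_ann q hq hx] at h2
    have h3 : ‖∑ k, cons k (ann q k x)‖ ≤ braidConst q₀ ^ n * ‖symm q (n + 1) x‖ := by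
      refine le_of_sq_le_sq ?_ (by positivity)
      rw [mul_pow, symm_succ_apply, norm_sq_sum_cons, norm_sq_sum_cons, Finset.mul_sum]
      refine Finset.sum_le_sum fun k _ => ?_
      rw [← mul_pow]
      gcongr
      exact ih (contract_mem_level _ _ hx)
    calc ‖x‖ ≤ _ := h2
      _ ≤ braidConst q₀ * (braidConst q₀ ^ n * ‖symm q (n + 1) x‖) := by gcongr
      _ = _ := by ring

end Levels

section Represent

variable {ι : Type*} [DecidableEq ι] {q : ι → ι → ℂ}
  {G : Type*} [NormedAddCommGroup G] [InnerProductSpace ℂ G] {f : Words ι →ₗ[ℂ] G}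

/-- The inner product pulled back from `G` is given by the symmetrization operator. -/
theorem inner_eq_symm [Fintype ι] (hv : ⟪f (word []), f (word [])⟫_ℂ = 1)
    (ha : ∀ k x y, ⟪f (cons k x), f y⟫_ℂ = ⟪f x, f (ann q k y)⟫_ℂ) {n : ℕ} (w : List ι)
    (hw : w.length = n) {y : Words ι} (hy : y ∈ level ι n) :
    ⟪f (word w), f y⟫_ℂ = ⟪word w, symm q n y⟫_ℂ := by
  induction n generalizing w y with
  | zero =>
    rw [List.length_eq_zero_iff.mp hw]
    have h := map_mem_level (f := innerₛₗ ℂ (f (word [])) ∘ₗ f - innerₛₗ ℂ (word []))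
      (F := (⊥ : Submodule ℂ ℂ)) (fun w hw => by
        rw [List.length_eq_zero_iff.mp hw, Submodule.mem_bot]
        change ⟪f (word []), f (word [])⟫_ℂ - ⟪word [], word []⟫_ℂ = 0
        rw [hv, inner_word, word_self, sub_self]) hy
    simpa [sub_eq_zero, symm] using h
  | succ n ih =>
    obtain ⟨k, w, rfl⟩ := List.exists_cons_of_length_eq_add_one hw
    rw [← cons_word, ha, ih w (by simpa using hw) (contract_mem_level _ _ hy), symm_succ_apply,
      inner_sum, Finset.sum_eq_single k, inner_cons_cons]
    · intro l _ hl
      exact inner_cons_ne hl.symm _ _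
    · simp

theorem inner_eq_zero_of_length_ne
    (ha : ∀ k x y, ⟪f (cons k x), f y⟫_ℂ = ⟪f x, f (ann q k y)⟫_ℂ) (v w : List ι)
    (h : v.length ≠ w.length) : ⟪f (word v), f (word w)⟫_ℂ = 0 := by
  have key : ∀ (v : List ι) (n : ℕ) (x : Words ι), n < v.length → x ∈ level ι n →
      ⟪f (word v), f x⟫_ℂ = 0 := by
    intro v
    induction v with
    | nil => intro n x hn; simp at hn
    | cons k v ih =>
      intro n x hn hx
      rw [← cons_word, ha]
      cases n with
      | zero =>
        have h : ann q k x ∈ (⊥ : Submodule ℂ (Words ι)) := map_mem_level (fun w hw => by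
          rw [List.length_eq_zero_iff.mp hw]; simp) hx
        rw [(Submodule.mem_bot ℂ).mp h, map_zero, inner_zero_right]
      | succ n =>
        exact ih n _ (by simpa using hn) (contract_mem_level _ _ hx)
  rcases lt_or_gt_of_ne h with h | h
  · rw [← inner_conj_symm, key w _ _ h (word_mem_level v), map_zero]
  · exact key v _ _ h (word_mem_level w)

variable [Fintype ι]

/-- Every bounded function on the words of length `n` is represented by a vector whose norm grows at
most exponentially in `n`. -/
theorem exists_represent (hv : ⟪f (word []), f (word [])⟫_ℂ = 1)
    (ha : ∀ k x y, ⟪f (cons k x), f y⟫_ℂ = ⟪f x, f (ann q k y)⟫_ℂ)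
    (hq : ∀ x y, q x y = q y x) {q₀ : ℝ} (h0 : 0 ≤ q₀) (h1 : q₀ < 1)
    (hq0 : ∀ x y, ‖q x y‖ ≤ q₀) (n : ℕ) (g : List ι → ℂ) {B : ℝ}
    (hg : ∀ w, w.length = n → ‖g w‖ ≤ B) :
    ∃ z : G, ‖z‖ ≤ (braidConst q₀ * Fintype.card ι) ^ n * B ∧
      ∀ w, ⟪z, f (word w)⟫_ℂ = if w.length = n then g w else 0 := by
  have hK := one_le_braidConst h1
  let F : level ι n →ₗ[ℂ] level ι n := (symm q n).restrict fun x hx => symm_mem_level q hx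
  have hF : Function.Surjective F := by
    rw [← LinearMap.injective_iff_surjective, ← LinearMap.ker_eq_bot, LinearMap.ker_eq_bot']
    rintro ⟨y, hy⟩ h
    have h' : symm q n y = 0 := congrArg Subtype.val h
    have h2 := norm_le_symm q hq h0 h1 hq0 hy
    rw [h', norm_zero, mul_zero] at h2
    exact Subtype.ext (norm_le_zero_iff.mp h2)
  have hfin := List.finite_length_eq ι n
  let η : Words ι := ∑ w ∈ hfin.toFinset, conj (g w) • word w
  have hη : η ∈ level ι n := Submodule.sum_mem _ fun w hw => by
    have hw' : w.length = n := by simpa using hw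
    rw [← hw']
    exact Submodule.smul_mem _ _ (word_mem_level w)
  obtain ⟨⟨z, hz⟩, hzη⟩ := hF ⟨η, hη⟩
  have hzη' : symm q n z = η := congrArg Subtype.val hzη
  have hηnorm : ‖η‖ ≤ Fintype.card ι ^ n * B := by
    refine (norm_sum_le _ _).trans ?_
    have hle : ∀ w ∈ hfin.toFinset, ‖conj (g w) • word w‖ ≤ B := by
      intro w hw
      rw [norm_smul, orthonormal_word.1, mul_one, RCLike.norm_conj]
      exact hg w (by simpa using hw)
    refine (Finset.sum_le_card_nsmul _ _ _ hle).trans (le_of_eq ?_)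
    have hcard : hfin.toFinset.card = Fintype.card ι ^ n := by
      rw [← Set.ncard_eq_toFinset_card _ hfin]
      have : Nat.card (List.Vector ι n) = Fintype.card ι ^ n := by
        rw [Nat.card_eq_fintype_card, card_vector]
      rw [← this]; rfl
    rw [hcard, nsmul_eq_mul]
    push_cast
    rfl
  refine ⟨f z, ?_, fun w => ?_⟩
  · have h2 : ⟪f z, f z⟫_ℂ = ⟪z, η⟫_ℂ := by
      have h3 : ∀ y ∈ level ι n, ⟪f y, f z⟫_ℂ = ⟪y, η⟫_ℂ := by
        intro y hy
        induction hy using Submodule.span_induction with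
        | mem y hy =>
          obtain ⟨w, hw, rfl⟩ := hy
          rw [inner_eq_symm hv ha w hw hz, hzη']
        | zero => simp
        | add x y _ _ hx hy => rw [map_add, inner_add_left, inner_add_left, hx, hy]
        | smul a x _ hx => rw [map_smul, inner_smul_left, inner_smul_left, hx]
      exact h3 z hz
    have h4 : ‖f z‖ ^ 2 ≤ ‖z‖ * ‖η‖ := by
      rw [← inner_self_eq_norm_sq (𝕜 := ℂ), h2]
      exact (RCLike.re_le_norm _).trans (norm_inner_le_norm _ _)
    have h5 := norm_le_symm q hq h0 h1 hq0 hz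
    rw [hzη'] at h5
    have h6 : ‖f z‖ ≤ braidConst q₀ ^ n * ‖η‖ := by
      refine le_of_sq_le_sq ?_ (by positivity)
      have h7 : (1 : ℝ) ≤ braidConst q₀ ^ n := one_le_pow₀ hK
      calc ‖f z‖ ^ 2 ≤ ‖z‖ * ‖η‖ := h4
        _ ≤ braidConst q₀ ^ n * ‖η‖ * ‖η‖ := by gcongr
        _ ≤ braidConst q₀ ^ n * ‖η‖ * (braidConst q₀ ^ n * ‖η‖) := by
          gcongr
          exact le_mul_of_one_le_left (norm_nonneg _) h7
        _ = _ := by ring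
    calc ‖f z‖ ≤ braidConst q₀ ^ n * ‖η‖ := h6
      _ ≤ braidConst q₀ ^ n * (Fintype.card ι ^ n * B) := by gcongr
      _ = _ := by rw [mul_pow]; ring
  · split_ifs with hw
    · rw [← inner_conj_symm, inner_eq_symm hv ha w hw hz, hzη', inner_sum,
        Finset.sum_eq_single w]
      · rw [inner_smul_right, inner_word, word_self]; simp
      · intro v _ hvw
        rw [inner_smul_right, inner_word, word_of_ne hvw.symm, mul_zero]
      · intro h
        exact absurd (by simpa using hw) h
    · have h := map_mem_level (f := innerₛₗ ℂ (f (word w)) ∘ₗ f) (F := (⊥ : Submodule ℂ ℂ))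
        (fun v hvn => by
          have := inner_eq_zero_of_length_ne ha w v (by omega)
          simpa using this) hz
      rw [← inner_conj_symm]
      have h' : ⟪f (word w), f z⟫_ℂ = 0 := by simpa using h
      rw [h', map_zero]

end Represent

end Words
end MixedQAW
end

noncomputable section

namespace MixedQAW
namespace Words

/-! ### Boundedness of the creation operators -/

section Creation

variable {ι : Type*}

/-- The span of the words of length less than `n`. -/
def below (ι : Type*) (n : ℕ) : Submodule ℂ (Words ι) :=
  Submodule.span ℂ (word '' {w | w.length < n})

theorem word_mem_below {w : List ι} {n : ℕ} (h : w.length < n) : word w ∈ below ι n :=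
  Submodule.subset_span ⟨w, h, rfl⟩

theorem map_mem_below {V : Type*} [AddCommGroup V] [Module ℂ V] {n : ℕ} {f : Words ι →ₗ[ℂ] V}
    {F : Submodule ℂ V} (h : ∀ w : List ι, w.length < n → f (word w) ∈ F) {x : Words ι}
    (hx : x ∈ below ι n) : f x ∈ F := by
  have : below ι n ≤ F.comap f := Submodule.span_le.mpr (by rintro _ ⟨w, hw, rfl⟩; exact h w hw)
  exact this hx

theorem exists_mem_below (x : Words ι) : ∃ n, x ∈ below ι n := by
  refine ⟨x.support.sup List.length + 1, ?_⟩
  have h : x = ∑ w ∈ x.support, x w • word w := by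
    conv_lhs => rw [← Finsupp.sum_single x]
    simp [Finsupp.sum, word]
  have h2 := Submodule.sum_mem (below ι (x.support.sup List.length + 1)) fun w hw =>
    Submodule.smul_mem _ (x w)
      (word_mem_below (Nat.lt_succ_of_le (Finset.le_sup (s := x.support) (f := List.length) hw)))
  rwa [← h] at h2

theorem level_le_below {m n : ℕ} (h : m < n) : level ι m ≤ below ι n :=
  Submodule.span_mono (Set.image_mono fun w (hw : w.length = m) => by
    change w.length < n; omega)

theorem cons_mem_below (k : ι) {n : ℕ} {x : Words ι} (hx : x ∈ below ι n) :
    cons k x ∈ below ι (n + 1) :=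
  map_mem_below (fun w hw => by
    rw [cons_word]
    exact word_mem_below (w := k :: w) (by simpa using hw)) hx

theorem contract_mem_below (c r : ι → ℂ) {n : ℕ} {x : Words ι} (hx : x ∈ below ι (n + 1)) :
    contract c r x ∈ below ι n :=
  map_mem_below (fun w hw => by
    cases w with
    | nil => simp
    | cons l w =>
      refine level_le_below (m := w.length) (by simpa using hw) (contract_mem_level c r ?_)
      exact word_mem_level (l :: w)) hx

theorem eq_zero_of_mem_below_zero {x : Words ι} (hx : x ∈ below ι 0) : x = 0 := by
  have := map_mem_below (f := LinearMap.id) (F := (⊥ : Submodule ℂ (Words ι)))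
    (fun w hw => absurd hw (Nat.not_lt_zero _)) hx
  simpa using this

variable [DecidableEq ι] {q : ι → ι → ℂ}
  {G : Type*} [NormedAddCommGroup G] [InnerProductSpace ℂ G] {f : Words ι →ₗ[ℂ] G}

/-- Boundedness of the creation operators, obtained from the relation
`a_k a_k^* = 1 + q_{kk} a_k^* a_k` by induction on the length of words. -/
theorem norm_cons_le (ha : ∀ k x y, ⟪f (cons k x), f y⟫_ℂ = ⟪f x, f (ann q k y)⟫_ℂ) {q₀ : ℝ}
    (h0 : 0 ≤ q₀) (h1 : q₀ < 1) (hq0 : ∀ x y, ‖q x y‖ ≤ q₀) (k : ι) (x : Words ι) :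
    ‖f (cons k x)‖ ^ 2 ≤ (1 - q₀)⁻¹ * ‖f x‖ ^ 2 := by
  have hpos : 0 < 1 - q₀ := by linarith
  obtain ⟨n, hx⟩ := exists_mem_below x
  induction n generalizing x with
  | zero => simp [eq_zero_of_mem_below_zero hx]
  | succ n ih =>
    set a := ann q k x with ha'
    have hfa := ih a (contract_mem_below _ _ hx)
    have h2 : ⟪f (cons k a), f x⟫_ℂ = ⟪f a, f a⟫_ℂ := by rw [ha]
    have h2' : ⟪f x, f (cons k a)⟫_ℂ = ⟪f a, f a⟫_ℂ := by
      rw [← inner_conj_symm, h2, inner_conj_symm]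
    have h3 : ‖f a‖ ^ 2 ≤ ‖f (cons k a)‖ * ‖f x‖ := by
      rw [← inner_self_eq_norm_sq (𝕜 := ℂ), ← h2]
      exact (RCLike.re_le_norm _).trans (norm_inner_le_norm _ _)
    have h4 : ‖f a‖ ^ 2 ≤ (1 - q₀)⁻¹ * ‖f x‖ ^ 2 := by
      rcases eq_or_lt_of_le (norm_nonneg (f a)) with h | h
      · rw [← h, zero_pow two_ne_zero]; positivity
      · have h5 : (‖f a‖ ^ 2) ^ 2 ≤ ((1 - q₀)⁻¹ * ‖f a‖ ^ 2) * ‖f x‖ ^ 2 := by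
          calc (‖f a‖ ^ 2) ^ 2 ≤ (‖f (cons k a)‖ * ‖f x‖) ^ 2 := by gcongr
            _ = ‖f (cons k a)‖ ^ 2 * ‖f x‖ ^ 2 := by ring
            _ ≤ _ := by gcongr
        have h6 : 0 < ‖f a‖ ^ 2 := pow_pos h 2
        refine le_of_mul_le_mul_left ?_ h6
        calc _ = (‖f a‖ ^ 2) ^ 2 := by ring
          _ ≤ _ := h5
          _ = _ := by ring
    have h5 : ⟪f (cons k x), f (cons k x)⟫_ℂ = ⟪f x, f x⟫_ℂ + q k k * ⟪f a, f a⟫_ℂ := by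
      rw [ha, contract_cons, ← ha', map_add, map_smul, map_smul, inner_add_right, inner_smul_right,
        inner_smul_right, Pi.single_eq_same, one_mul, h2']
    rw [← inner_self_eq_norm_sq (𝕜 := ℂ), h5, map_add, inner_self_eq_norm_sq]
    have h6 : RCLike.re (q k k * ⟪f a, f a⟫_ℂ) ≤ q₀ * ‖f a‖ ^ 2 := by
      refine (RCLike.re_le_norm _).trans ?_
      rw [norm_mul, inner_self_eq_norm_sq_to_K, norm_pow, RCLike.norm_ofReal, abs_norm]
      gcongr
      exact hq0 k k
    calc _ ≤ ‖f x‖ ^ 2 + q₀ * ((1 - q₀)⁻¹ * ‖f x‖ ^ 2) := by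
          gcongr
          exact h6.trans (by gcongr)
      _ = (1 - q₀)⁻¹ * ‖f x‖ ^ 2 := by field_simp; ring

/-- A contraction is a combination of the annihilations of letters. -/
theorem sum_smul_ann [Fintype ι] (c : ι → ℂ) (r : ι → ℂ) (h : ∀ k, c k ≠ 0 → q k = r)
    (x : Words ι) : ∑ k, c k • ann q k x = contract c r x :=
  (hom_congr (f := contract c r) (g := ∑ k, c k • ann q k) (fun w => by
    simp only [LinearMap.sum_apply, LinearMap.smul_apply]
    induction w with
    | nil => simp
    | cons l w ih =>
      simp only [contract_cons_word, ih, smul_add, Finset.sum_add_distrib, map_sum,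
        Finset.smul_sum, map_smul]
      congr 1
      · rw [Finset.sum_eq_single l]
        · simp
        · intro k _ hk
          rw [Pi.single_eq_of_ne hk.symm, zero_smul, smul_zero]
        · simp
      · refine Finset.sum_congr rfl fun k _ => ?_
        by_cases hk : c k = 0
        · simp [hk]
        · rw [ann, h k hk, smul_comm]) x).symm ▸ by simp [LinearMap.sum_apply]

end Creation

end Words

namespace Data

/-! ### The Fock space in terms of words -/

open Words

section FockWords

variable {E : Type*} [NormedAddCommGroup E] [InnerProductSpace ℝ E] {N : Type*} (S : Data E N)
  {d : ℕ} (j : Fin d → N)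

theorem bar_mem_colour {i : N} {x : S.HU} (hx : x ∈ S.colour i) : S.bar x ∈ S.colour i :=
  ⟨hx.1, Submodule.neg_mem _ hx.2⟩

theorem bar_bar (ξ : S.HU) : S.bar (S.bar ξ) = ξ := by
  apply S.toCx.injective
  exact Cx.ext rfl (neg_neg _)

theorem bar_add (ξ η : S.HU) : S.bar (ξ + η) = S.bar ξ + S.bar η := by
  apply S.toCx.injective
  refine Cx.ext rfl ?_
  change -((S.toCx ξ).im + (S.toCx η).im) = -(S.toCx ξ).im + -(S.toCx η).im
  abel

theorem bar_smul (c : ℂ) (ξ : S.HU) : S.bar (c • ξ) = conj c • S.bar ξ := by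
  apply S.toCx.injective
  refine Cx.ext ?_ ?_
  · change c.re • (S.toCx ξ).re - c.im • (S.toCx ξ).im =
      (conj c).re • (S.toCx ξ).re - (conj c).im • -(S.toCx ξ).im
    simp
  · change -(c.re • (S.toCx ξ).im + c.im • (S.toCx ξ).re) =
      (conj c).re • -(S.toCx ξ).im + (conj c).im • (S.toCx ξ).re
    simp only [Complex.conj_re, Complex.conj_im]
    module

theorem incl_add_smul_incl (ξ : S.HU) :
    S.incl (S.toCx ξ).re + Complex.I • S.incl (S.toCx ξ).im = ξ := by
  apply S.toCx.injective
  refine Cx.ext ?_ ?_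
  · change (S.toCx ξ).re + (Complex.I.re • (S.toCx ξ).im - Complex.I.im • (0 : E)) = _
    simp
  · change (0 : E) + (Complex.I.re • (0 : E) + Complex.I.im • (S.toCx ξ).im) = _
    simp

theorem bar_incl (x : E) : S.bar (S.incl x) = S.incl x := by
  apply S.toCx.injective
  exact Cx.ext rfl neg_zero

/-- The deformation parameters of pairs of letters. -/
def letterQ (k l : Fin d) : ℂ := S.q (j k) (j l)

theorem letterQ_symm (k l : Fin d) : S.letterQ j k l = S.letterQ j l k := by
  rw [letterQ, letterQ, S.q_symm]

theorem exists_q_bound : ∃ q₀ : ℝ, 0 < q₀ ∧ q₀ < 1 ∧ ∀ k l, ‖S.letterQ j k l‖ ≤ q₀ := by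
  obtain ⟨i, hi⟩ := Finite.exists_max (fun z : Option (Fin d × Fin d) =>
    z.elim (1 / 2 : ℝ) fun z => |S.q (j z.1) (j z.2)|)
  refine ⟨_, lt_of_lt_of_le (by norm_num) (hi none), ?_, fun k l => ?_⟩
  · cases i with
    | none => norm_num
    | some z => exact S.q_abs_lt_one _ _
  · have := hi (some (k, l))
    rw [letterQ, Complex.norm_real]
    exact this

variable [FiniteDimensional ℝ E]

theorem proj_of_mem_colour {i : N} {x : S.HU} (hx : x ∈ S.colour i) : S.proj i x = x := by
  apply S.toCx.injective
  rw [toCx_proj]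
  exact Cx.ext (Submodule.starProjection_eq_self_iff.mpr hx.1)
    (Submodule.starProjection_eq_self_iff.mpr hx.2)

theorem inner_eq_zero_of_colour_ne {i i' : N} (h : i ≠ i') {x y : S.HU} (hx : x ∈ S.colour i)
    (hy : y ∈ S.colour i') : ⟪x, y⟫_ℂ = 0 := by
  classical
  rw [← S.proj_of_mem_colour hx, proj_symm, ← S.proj_of_mem_colour hy, proj_proj, if_neg h,
    inner_zero_right]

variable (e : OrthonormalBasis (Fin d) ℂ S.HU)

/-- The covariance `⟪ē_k, e_l⟫_U` of pairs of letters. -/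
def letterCov (k l : Fin d) : ℂ := ⟪S.bar (e k), e l⟫_ℂ

variable {j} in
/-- Letters with nonzero covariance have the same colour, hence the same parameters. -/
theorem letterQ_eq_of_cov (hj : ∀ k, e k ∈ S.colour (j k)) (k l : Fin d)
    (h : S.letterCov e k l ≠ 0) : S.letterQ j k = S.letterQ j l := by
  have : j k = j l := by
    by_contra hne
    exact h (S.inner_eq_zero_of_colour_ne hne (S.bar_mem_colour (hj k)) (hj l))
  funext m
  rw [letterQ, letterQ, this]

variable [Fintype N]

/-- The linear map from words to the algebraic Fock space with `w ↦ e_w`. -/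
def wordFock : Words (Fin d) →ₗ[ℂ] S.FockAlg := Words.ext (S.wordVec e)

@[simp] theorem wordFock_word (w : List (Fin d)) : S.wordFock e (word w) = S.wordVec e w := by
  simp [wordFock]

theorem wordFock_cons (k : Fin d) (x : Words (Fin d)) :
    S.wordFock e (cons k x) = S.ι (e k) * S.wordFock e x :=
  hom_congr (f := S.wordFock e ∘ₗ cons k) (g := LinearMap.mulLeft ℂ (S.ι (e k)) ∘ₗ S.wordFock e)
    (fun w => by simp [wordVec]) x

theorem wordVec_eq_basis (w : List (Fin d)) :
    S.wordVec e w = e.toBasis.tensorAlgebra (FreeMonoid.ofList w) := by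
  have h1 : FreeAlgebra.basisFreeMonoid ℂ (Fin d) (FreeMonoid.ofList w) =
      (w.map (FreeAlgebra.ι ℂ)).prod := by
    change FreeAlgebra.equivMonoidAlgebraFreeMonoid.symm (MonoidAlgebra.single _ 1) = _
    change MonoidAlgebra.lift ℂ _ _ (FreeMonoid.lift (FreeAlgebra.ι ℂ)) _ = _
    rw [MonoidAlgebra.lift_single, one_smul, FreeMonoid.lift_apply]
    rfl
  rw [Module.Basis.tensorAlgebra, Module.Basis.map_apply, h1, AlgEquiv.toLinearEquiv_apply,
    map_list_prod, List.map_map]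
  simp only [Function.comp_def, TensorAlgebra.equivFreeAlgebra_symm_ι,
    OrthonormalBasis.coe_toBasis]
  rfl

theorem wordFock_surjective : Function.Surjective (S.wordFock e) := by
  have h : ∀ x ∈ Submodule.span ℂ (Set.range e.toBasis.tensorAlgebra),
      ∃ y, S.wordFock e y = (x : TensorAlgebra ℂ S.HU) := by
    intro x hx
    induction hx using Submodule.span_induction with
    | mem x hx =>
      obtain ⟨w, rfl⟩ := hx
      exact ⟨word w.toList, by rw [wordFock_word, wordVec_eq_basis]; rfl⟩
    | zero => exact ⟨0, map_zero _⟩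
    | add a b _ _ ha hb =>
      obtain ⟨x, rfl⟩ := ha
      obtain ⟨y, rfl⟩ := hb
      exact ⟨x + y, map_add _ _ _⟩
    | smul z a _ ha =>
      obtain ⟨x, rfl⟩ := ha
      exact ⟨z • x, map_smul _ _ _⟩
  intro x
  exact h x (by rw [e.toBasis.tensorAlgebra.span_eq]; trivial)

theorem toDirectSum_wordVec {n : ℕ} (u : Fin n → Fin d) :
    TensorAlgebra.toDirectSum (R := ℂ) (M := S.HU) (S.wordVec e (List.ofFn u)) =
      DirectSum.of (fun n => ⨂[ℂ]^n S.HU) n (PiTensorProduct.tprod ℂ fun t => e (u t)) := by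
  rw [← TensorAlgebra.toDirectSum_tensorPower_tprod, TensorAlgebra.tprod_apply, wordVec,
    List.map_ofFn]
  rfl

theorem inner_wordVec_ofFn {m n : ℕ} (u : Fin m → Fin d) (v : Fin n → Fin d) :
    ⟪S.wordVec e (List.ofFn u), S.wordVec e (List.ofFn v)⟫_ℂ =
      twistedForm S.q S.proj n (PiTensorProduct.tprod ℂ fun t => e (v t))
        (TensorAlgebra.toDirectSum (R := ℂ) (M := S.HU) (S.wordVec e (List.ofFn u)) n) := by
  rw [inner_fockAlg]
  refine (S.fockForm_apply (S.wordVec e (List.ofFn u)) (S.wordVec e (List.ofFn v)) {n} ?_).trans ?_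
  swap
  · rw [Finset.sum_singleton, toDirectSum_wordVec (u := v), DirectSum.of_eq_same]
  · intro k hk
    rw [toDirectSum_wordVec]
    exact DirectSum.of_eq_of_ne _ _ _ (by simpa using hk)

variable {j}

/-- The deformed inner product of two basis tensors, as a sum over permutations. -/
theorem twistedForm_basis (hj : ∀ k, e k ∈ S.colour (j k)) {n : ℕ} (u v : Fin n → Fin d) :
    twistedForm S.q S.proj n (PiTensorProduct.tprod ℂ fun t => e (v t))
      (PiTensorProduct.tprod ℂ fun t => e (u t)) =
      permSum (fun k => Pi.single k 1) (S.letterQ j) u v := by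
  classical
  rw [twistedForm, LinearMap.comp_apply, symmetrizer, LinearMap.sum_apply, map_sum,
    LinearMap.sum_apply, permSum, ← Equiv.sum_comp (Equiv.inv (Equiv.Perm (Fin n)))]
  refine Finset.sum_congr rfl fun σ _ => ?_
  rw [Phi_tprod (fun i i' x h => by rw [proj_proj, if_neg h]) _ (fun t => j (v t)) _
    (fun t => S.proj_of_mem_colour (hj _)), map_smul, LinearMap.smul_apply, tensorForm_tprod,
    smul_eq_mul, mul_comm]
  have h1 : ∀ k l, ⟪e k, e l⟫_ℂ = (Pi.single k 1 : Fin d → ℂ) l := fun k l => by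
    rw [orthonormal_iff_ite.mp e.orthonormal, Pi.single_apply]
    simp [eq_comm]
  have h2 : ∀ t, (Equiv.inv (Equiv.Perm (Fin n)) σ).symm t = σ t := fun t => rfl
  simp only [h1, h2]
  by_cases hz : ∏ t, (Pi.single (u t) 1 : Fin d → ℂ) (v (σ t)) = 0
  · rw [hz, zero_mul, zero_mul]
  · congr 1
    have h3 : ∀ t, v (σ t) = u t := by
      intro t
      by_contra h
      exact Finset.prod_ne_zero_iff.mp hz t (Finset.mem_univ t) (Pi.single_eq_of_ne h 1)
    rw [inversionWeight, Finset.prod_comm, Complex.ofReal_prod, ← Equiv.prod_comp σ]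
    refine Finset.prod_congr rfl fun i _ => ?_
    rw [Complex.ofReal_prod, ← Equiv.prod_comp σ]
    refine Finset.prod_congr rfl fun i' _ => ?_
    have h4 : ∀ t, (Equiv.inv (Equiv.Perm (Fin n)) σ) (σ t) = t := fun t => σ.symm_apply_apply t
    simp only [h4, h3, letterQ, and_comm]
    split_ifs
    · rw [S.q_symm]
    · rfl

theorem inner_wordVec (hj : ∀ k, e k ∈ S.colour (j k)) (u v : List (Fin d)) :
    ⟪S.wordVec e u, S.wordVec e v⟫_ℂ =
      vac (contracts (fun k => Pi.single k 1) (S.letterQ j) u (word v)) := by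
  obtain ⟨m, u, rfl⟩ : ∃ (m : ℕ) (u' : Fin m → Fin d), u = List.ofFn u' :=
    ⟨_, u.get, (List.ofFn_get u).symm⟩
  obtain ⟨n, v, rfl⟩ : ∃ (n : ℕ) (v' : Fin n → Fin d), v = List.ofFn v' :=
    ⟨_, v.get, (List.ofFn_get v).symm⟩
  rw [inner_wordVec_ofFn, toDirectSum_wordVec]
  by_cases h : m = n
  · subst h
    rw [DirectSum.of_eq_same, twistedForm_basis S e hj, vac_contracts_ofFn]
  · rw [DirectSum.of_eq_of_ne _ _ _ (Ne.symm h), map_zero, vac_contracts_of_length_ne]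
    simpa using h

theorem inner_wordVec_nil (hj : ∀ k, e k ∈ S.colour (j k)) :
    ⟪S.wordFock e (word []), S.wordFock e (word [])⟫_ℂ = 1 := by
  have h := S.inner_wordVec e hj [] []
  simpa [contracts] using h

/-- The left annihilation of letters is the adjoint of the creation for the deformed inner product. -/
theorem inner_wordFock_cons (hj : ∀ k, e k ∈ S.colour (j k)) (k : Fin d) (x y : Words (Fin d)) :
    ⟪S.wordFock e (cons k x), S.wordFock e y⟫_ℂ =
      ⟪S.wordFock e x, S.wordFock e (ann (S.letterQ j) k y)⟫_ℂ := by
  have key : ∀ (u : List (Fin d)) (y : Words (Fin d)), ⟪S.wordVec e u, S.wordFock e y⟫_ℂ =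
      vac (contracts (fun k => Pi.single k 1) (S.letterQ j) u y) := fun u y =>
    hom_congr (f := innerₛₗ ℂ (S.wordVec e u) ∘ₗ S.wordFock e)
      (g := vac ∘ₗ contracts (fun k => Pi.single k 1) (S.letterQ j) u)
      (fun v => by simpa using S.inner_wordVec e hj u v) y
  induction x using Finsupp.induction_linear with
  | zero => simp
  | add a b ha hb => rw [map_add, map_add, map_add, inner_add_left, ha, hb, inner_add_left]
  | single w z =>
    have h2 : (Finsupp.single w z : Words (Fin d)) = z • word w := by simp [word]
    rw [h2, map_smul, map_smul, map_smul, inner_smul_left, inner_smul_left, cons_word,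
      wordFock_word, wordFock_word, key, key]
    rfl

theorem norm_ι_mul_le (hj : ∀ k, e k ∈ S.colour (j k)) (ξ : S.HU) :
    ∃ C : ℝ, ∀ y : S.FockAlg, ‖S.ι ξ * y‖ ≤ C * ‖y‖ := by
  obtain ⟨q₀, h0, h1, hq0⟩ := S.exists_q_bound j
  refine ⟨∑ k, ‖e.repr ξ k‖ * Real.sqrt (1 - q₀)⁻¹, fun y => ?_⟩
  obtain ⟨x, rfl⟩ := S.wordFock_surjective e y
  have h : S.ι ξ * S.wordFock e x = ∑ k, e.repr ξ k • S.wordFock e (cons k x) := by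
    conv_lhs => rw [← e.sum_repr ξ, map_sum, Finset.sum_mul]
    simp [wordFock_cons]
  rw [h, Finset.sum_mul]
  refine (norm_sum_le _ _).trans (Finset.sum_le_sum fun k _ => ?_)
  rw [norm_smul, mul_assoc]
  gcongr
  refine Real.le_sqrt_of_sq_le ?_ |>.trans (le_of_eq ?_) (b := Real.sqrt
    ((1 - q₀)⁻¹ * ‖S.wordFock e x‖ ^ 2))
  · exact norm_cons_le (S.inner_wordFock_cons e hj) h0.le h1 hq0 k x
  · rw [Real.sqrt_mul (inv_nonneg.mpr (by linarith)), Real.sqrt_sq (norm_nonneg _)]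

theorem denseRange_toFock : DenseRange S.toFock := UniformSpace.Completion.denseRange_coe

theorem creation_toFock (hj : ∀ k, e k ∈ S.colour (j k)) (ξ : S.HU) (y : S.FockAlg) :
    S.creation ξ (S.toFock y) = S.toFock (S.ι ξ * y) := by
  obtain ⟨C, hC⟩ := S.norm_ι_mul_le e hj ξ
  exact LinearMap.extendOfNorm_eq (e := S.toFock.toLinearMap) S.denseRange_toFock
    ⟨C, fun x => by simpa using hC x⟩ y

theorem annihilation_toFock (hj : ∀ k, e k ∈ S.colour (j k)) (ξ : S.HU) (x : Words (Fin d)) :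
    S.annihilation ξ (S.toFock (S.wordFock e x)) =
      S.toFock (S.wordFock e (∑ k, ⟪ξ, e k⟫_ℂ • ann (S.letterQ j) k x)) := by
  have hd : Dense ((LinearMap.range S.toFock.toLinearMap : Submodule ℂ S.Fock) : Set S.Fock) :=
    S.denseRange_toFock
  refine hd.eq_of_inner_right ℂ ?_
  rintro _ ⟨y, rfl⟩
  obtain ⟨y, rfl⟩ := S.wordFock_surjective e y
  change ⟪S.toFock (S.wordFock e y), _⟫_ℂ = ⟪S.toFock (S.wordFock e y), _⟫_ℂ
  rw [annihilation, ContinuousLinearMap.adjoint_inner_right, S.creation_toFock e hj,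
    LinearIsometry.inner_map_map, LinearIsometry.inner_map_map]
  have h : S.ι ξ * S.wordFock e y = ∑ k, e.repr ξ k • S.wordFock e (cons k y) := by
    conv_lhs => rw [← e.sum_repr ξ, map_sum, Finset.sum_mul]
    simp [wordFock_cons]
  rw [h, sum_inner, map_sum, inner_sum]
  refine Finset.sum_congr rfl fun k _ => ?_
  rw [inner_smul_left, S.inner_wordFock_cons e hj, map_smul, inner_smul_right,
    OrthonormalBasis.repr_apply_apply, inner_conj_symm]

theorem clm_ext_wordFock {f g : S.Fock →L[ℂ] S.Fock}
    (h : ∀ x, f (S.toFock (S.wordFock e x)) = g (S.toFock (S.wordFock e x))) : f = g := by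
  refine ContinuousLinearMap.coeFn_injective
    (S.denseRange_toFock.equalizer f.continuous g.continuous ?_)
  funext y
  obtain ⟨x, rfl⟩ := S.wordFock_surjective e y
  exact h x

theorem creation_add (hj : ∀ k, e k ∈ S.colour (j k)) (ξ η : S.HU) :
    S.creation (ξ + η) = S.creation ξ + S.creation η :=
  S.clm_ext_wordFock e fun x => by
    simp only [add_apply, S.creation_toFock e hj, map_add, add_mul]

theorem creation_smul (hj : ∀ k, e k ∈ S.colour (j k)) (c : ℂ) (ξ : S.HU) :
    S.creation (c • ξ) = c • S.creation ξ :=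
  S.clm_ext_wordFock e fun x => by
    simp only [smul_apply, S.creation_toFock e hj, map_smul, smul_mul_assoc]

theorem annihilation_add (hj : ∀ k, e k ∈ S.colour (j k)) (ξ η : S.HU) :
    S.annihilation (ξ + η) = S.annihilation ξ + S.annihilation η := by
  rw [annihilation, S.creation_add e hj, map_add]; rfl

theorem annihilation_smul (hj : ∀ k, e k ∈ S.colour (j k)) (c : ℂ) (ξ : S.HU) :
    S.annihilation (c • ξ) = conj c • S.annihilation ξ := by
  rw [annihilation, S.creation_smul e hj, map_smulₛₗ]; rfl

/-- `W(ξ) = a*(ξ) + a(ξ̄)`. -/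
theorem W_eq (hj : ∀ k, e k ∈ S.colour (j k)) (ξ : S.HU) :
    (S.W ξ : S.Fock →L[ℂ] S.Fock) = S.creation ξ + S.annihilation (S.bar ξ) := by
  have h1 : (S.W ξ : S.Fock →L[ℂ] S.Fock) =
      S.field (S.toCx ξ).re + Complex.I • S.field (S.toCx ξ).im := rfl
  rw [h1, field, field]
  conv_rhs => rw [← S.incl_add_smul_incl ξ, S.creation_add e hj, S.creation_smul e hj, bar_add,
    bar_smul, bar_incl, bar_incl, S.annihilation_add e hj, S.annihilation_smul e hj,
    Complex.conj_conj]
  rw [smul_add]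
  abel

/-- The operators `W(e_l)` act on words by creation plus contraction. -/
theorem W_toFock (hj : ∀ k, e k ∈ S.colour (j k)) (l : Fin d) (x : Words (Fin d)) :
    (S.W (e l) : S.Fock →L[ℂ] S.Fock) (S.toFock (S.wordFock e x)) =
      S.toFock (S.wordFock e (mulGen (S.letterCov e) (S.letterQ j) l x)) := by
  rw [S.W_eq e hj, add_apply, S.creation_toFock e hj, S.annihilation_toFock e hj,
    mulGen_apply, map_add, map_add, wordFock_cons,
    ← sum_smul_ann (q := S.letterQ j) _ _ fun k hk => (S.letterQ_eq_of_cov e hj l k hk).symm]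
  rfl

/-- The linear span of the `W(e_k)` contains their adjoints. -/
theorem star_W (hj : ∀ k, e k ∈ S.colour (j k)) (l : Fin d) :
    star (S.W (e l)) = ∑ k, e.repr (S.bar (e l)) k • S.W (e k) := by
  have h : ∀ ξ, star (S.W ξ : S.Fock →L[ℂ] S.Fock) = S.W (S.bar ξ) := by
    intro ξ
    rw [S.W_eq e hj, S.W_eq e hj, bar_bar, star_add, add_comm, ContinuousLinearMap.star_eq_adjoint,
      ContinuousLinearMap.star_eq_adjoint, annihilation, annihilation,
      ContinuousLinearMap.adjoint_adjoint]
  let f : S.HU →ₗ[ℂ] S.M :=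
    { toFun := S.W
      map_add' := fun x y => Subtype.ext (by
        change (S.W (x + y) : S.Fock →L[ℂ] S.Fock) = S.W x + S.W y
        rw [S.W_eq e hj, S.W_eq e hj, S.W_eq e hj, S.creation_add e hj, bar_add,
          S.annihilation_add e hj]
        abel)
      map_smul' := fun c x => Subtype.ext (by
        change (S.W (c • x) : S.Fock →L[ℂ] S.Fock) = c • (S.W x : S.Fock →L[ℂ] S.Fock)
        rw [S.W_eq e hj, S.W_eq e hj, S.creation_smul e hj, bar_smul,
          S.annihilation_smul e hj, Complex.conj_conj, smul_add]) }
  have h2 : star (S.W (e l)) = f (S.bar (e l)) := Subtype.ext (h _)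
  rw [h2]
  conv_lhs => rw [← e.sum_repr (S.bar (e l)), map_sum]
  simp only [map_smul]
  rfl

end FockWords

end Data
end MixedQAW
end

noncomputable section

namespace MixedQAW
namespace Words

/-! ### Leading terms of products of generators -/

section Leading

variable {ι : Type*} (c q : ι → ι → ℂ)

/-- The product of the generators along a word, applied to the empty word. -/
def wick : List ι → Words ι
  | [] => word []
  | l :: w => mulGen c q l (wick w)

theorem wick_sub_word_mem (w : List ι) : wick c q w - word w ∈ below ι w.length := by
  induction w with
  | nil => simp [wick]
  | cons l w ih =>
    have h : wick c q (l :: w) - word (l :: w) = cons l (wick c q w - word w) +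
        contract (c l) (q l) ((wick c q w - word w) + word w) := by
      rw [wick, mulGen_apply, map_sub, cons_word, sub_add_cancel]; abel
    have h1 : below ι w.length ≤ below ι (w.length + 1) :=
      Submodule.span_mono (Set.image_mono fun v (hv : v.length < w.length) => hv.trans
        (Nat.lt_succ_self _))
    have h2 : below ι w.length ≤ below ι (w.length + 1 + 1) :=
      h1.trans (Submodule.span_mono (Set.image_mono fun v (hv : v.length < w.length + 1) => hv.trans
        (Nat.lt_succ_self _)))
    rw [h]
    refine add_mem (cons_mem_below l ih) (contract_mem_below _ _ (add_mem (h2 ih) ?_))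
    exact word_mem_below (by simp only [List.length_cons]; omega)

theorem apply_of_mem_below {x : Words ι} {n : ℕ} (hx : x ∈ below ι n) (w : List ι)
    (hw : n ≤ w.length) : x w = 0 := by
  have := map_mem_below (f := Finsupp.lapply w) (F := (⊥ : Submodule ℂ ℂ)) (fun v hv => by
    rw [Submodule.mem_bot, Finsupp.lapply_apply, word_of_ne]
    rintro rfl
    omega) hx
  simpa using this

/-- The leading term of `wick c q w` is `word w`, so these vectors are linearly independent. -/
theorem ext_wick_injective : Function.Injective (ext (wick c q)) := by
  rw [← LinearMap.ker_eq_bot, LinearMap.ker_eq_bot']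
  intro y hy
  by_contra hne
  obtain ⟨w, hw, hmax⟩ := Finset.exists_max_image y.support List.length
    (Finsupp.support_nonempty_iff.mpr hne)
  have h1 := DFunLike.congr_fun hy w
  rw [ext, Finsupp.linearCombination_apply, Finsupp.sum, Finsupp.finsetSum_apply,
    Finset.sum_eq_single_of_mem w hw] at h1
  · have h2 := apply_of_mem_below (wick_sub_word_mem c q w) w le_rfl
    rw [Finsupp.sub_apply, word_self, sub_eq_zero] at h2
    rw [Finsupp.smul_apply, h2] at h1
    exact Finsupp.mem_support_iff.mp hw (by simpa using h1)
  · intro v hv hvw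
    have h2 := apply_of_mem_below (wick_sub_word_mem c q v) w (hmax v hv)
    rw [Finsupp.sub_apply, word_of_ne hvw.symm, sub_zero] at h2
    rw [Finsupp.smul_apply, h2, smul_zero]

end Leading

/-! ### Difference quotients in abstract algebras -/

section Leibniz

variable {ι M : Type*} [Ring M] [Algebra ℂ M] (a : ι → M) (c : ι → ℂ)

/-- The value on the monomial with letters `w` of the derivation with `a l ↦ c l • 1 ⊗ 1`. -/
def diffWord : List ι → M ⊗[ℂ] Mᵐᵒᵖ
  | [] => 0
  | l :: w => (a l ⊗ₜ[ℂ] 1) * diffWord w + c l • (1 ⊗ₜ[ℂ] MulOpposite.op (w.map a).prod)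

theorem diffWord_append (v w : List ι) : diffWord a c (v ++ w) =
    ((v.map a).prod ⊗ₜ[ℂ] 1) * diffWord a c w +
      (1 ⊗ₜ[ℂ] MulOpposite.op (w.map a).prod) * diffWord a c v := by
  induction v with
  | nil =>
    rw [List.nil_append, List.map_nil, List.prod_nil, ← Algebra.TensorProduct.one_def, one_mul,
      diffWord, mul_zero, add_zero]
  | cons l v ih =>
    have h1 : (((l :: v).map a).prod ⊗ₜ[ℂ] (1 : Mᵐᵒᵖ)) =
        (a l ⊗ₜ[ℂ] 1) * ((v.map a).prod ⊗ₜ[ℂ] 1) := by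
      rw [Algebra.TensorProduct.tmul_mul_tmul, one_mul, List.map_cons, List.prod_cons]
    have h2 : ((1 : M) ⊗ₜ[ℂ] MulOpposite.op ((v ++ w).map a).prod) =
        (1 ⊗ₜ[ℂ] MulOpposite.op (w.map a).prod) * (1 ⊗ₜ[ℂ] MulOpposite.op (v.map a).prod) := by
      rw [Algebra.TensorProduct.tmul_mul_tmul, one_mul, ← MulOpposite.op_mul, List.map_append,
        List.prod_append]
    have h3 : (a l ⊗ₜ[ℂ] (1 : Mᵐᵒᵖ)) * (1 ⊗ₜ[ℂ] MulOpposite.op (w.map a).prod) =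
        (1 ⊗ₜ[ℂ] MulOpposite.op (w.map a).prod) * (a l ⊗ₜ[ℂ] (1 : Mᵐᵒᵖ)) := by
      simp only [Algebra.TensorProduct.tmul_mul_tmul, one_mul, mul_one]
    rw [List.cons_append, diffWord, diffWord, ih, h1, h2, mul_add, mul_add, ← mul_assoc,
      ← mul_assoc, ← mul_assoc, h3, mul_smul_comm]
    abel

variable {a c}

/-- A linear map with the values `diffWord` on monomials is a derivation. -/
theorem leibniz_of_diffWord {P : Type*} [Ring P] [Algebra ℂ P] (i : P →ₐ[ℂ] M) (m : List ι → P)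
    (hi : ∀ w, i (m w) = (w.map a).prod) (hm : ∀ v w, m (v ++ w) = m v * m w)
    (hext : ∀ f g : P →ₗ[ℂ] M ⊗[ℂ] Mᵐᵒᵖ, (∀ w, f (m w) = g (m w)) → f = g)
    (δ : P →ₗ[ℂ] M ⊗[ℂ] Mᵐᵒᵖ) (hδ : ∀ w, δ (m w) = diffWord a c w) (x y : P) :
    δ (x * y) = (i x ⊗ₜ[ℂ] 1) * δ y + (1 ⊗ₜ[ℂ] MulOpposite.op (i y)) * δ x := by
  let L : P →ₗ[ℂ] M ⊗[ℂ] Mᵐᵒᵖ :=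
    (Algebra.TensorProduct.includeLeft (R := ℂ) (S := ℂ) (A := M) (B := Mᵐᵒᵖ)).toLinearMap ∘ₗ
      i.toLinearMap
  let R : P →ₗ[ℂ] M ⊗[ℂ] Mᵐᵒᵖ :=
    (Algebra.TensorProduct.includeRight (R := ℂ) (A := M) (B := Mᵐᵒᵖ)).toLinearMap ∘ₗ
      (MulOpposite.opLinearEquiv ℂ).toLinearMap ∘ₗ i.toLinearMap
  have h1 : ∀ v y, δ (m v * y) = L (m v) * δ y + R y * δ (m v) := fun v y =>
    LinearMap.congr_fun (hext (δ ∘ₗ LinearMap.mulLeft ℂ (m v))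
      (LinearMap.mulLeft ℂ (L (m v)) ∘ₗ δ + LinearMap.mulRight ℂ (δ (m v)) ∘ₗ R) fun w => by
        change δ (m v * m w) = (i (m v) ⊗ₜ[ℂ] 1) * δ (m w) +
          (1 ⊗ₜ[ℂ] MulOpposite.op (i (m w))) * δ (m v)
        rw [← hm, hδ, hδ, hδ, diffWord_append, hi, hi]) y
  exact LinearMap.congr_fun (hext (δ ∘ₗ LinearMap.mulRight ℂ y)
    (LinearMap.mulRight ℂ (δ y) ∘ₗ L + LinearMap.mulLeft ℂ (R y) ∘ₗ δ) fun v => h1 v y) x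

theorem diffWord_singleton (l : ι) : diffWord a c [l] = c l • (1 ⊗ₜ[ℂ] 1) := by
  rw [diffWord, diffWord, mul_zero, zero_add, List.map_nil, List.prod_nil, MulOpposite.op_one]

/-- A derivation is determined on monomials by its values on the generators. -/
theorem eq_diffWord_of_leibniz {P : Type*} [Ring P] [Algebra ℂ P] (i : P →ₐ[ℂ] M) (g : ι → P)
    (hi : ∀ l, i (g l) = a l) (δ : P →ₗ[ℂ] M ⊗[ℂ] Mᵐᵒᵖ)
    (hδ : ∀ x y, δ (x * y) = (i x ⊗ₜ[ℂ] 1) * δ y + (1 ⊗ₜ[ℂ] MulOpposite.op (i y)) * δ x)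
    (hg : ∀ l, δ (g l) = c l • (1 ⊗ₜ[ℂ] 1)) (w : List ι) :
    δ (w.map g).prod = diffWord a c w := by
  induction w with
  | nil =>
    have h := hδ 1 1
    rw [map_one, MulOpposite.op_one, ← Algebra.TensorProduct.one_def, mul_one, one_mul] at h
    rw [List.map_nil, List.prod_nil, diffWord]
    exact left_eq_add.mp h
  | cons l w ih =>
    have h : i (w.map g).prod = (w.map a).prod := by
      rw [map_list_prod, List.map_map]
      exact congrArg (fun f => (w.map f).prod) (funext hi)
    rw [List.map_cons, List.prod_cons, hδ, ih, hg, hi, h, mul_smul_comm,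
      ← Algebra.TensorProduct.one_def, mul_one, diffWord]

/-- The map `a ⊗ bᵒᵖ ↦ φ(b) T a` on `M ⊗ Mᵒᵖ`. -/
def slice {V : Type*} [AddCommGroup V] [Module ℂ V] (φ : M →ₗ[ℂ] ℂ) (T : M →ₗ[ℂ] V) :
    M ⊗[ℂ] Mᵐᵒᵖ →ₗ[ℂ] V :=
  TensorProduct.lift (((LinearMap.lsmul ℂ V).flip ∘ₗ T).compl₂
    (φ ∘ₗ (MulOpposite.opLinearEquiv ℂ).symm.toLinearMap))

theorem slice_tmul {V : Type*} [AddCommGroup V] [Module ℂ V] (φ : M →ₗ[ℂ] ℂ) (T : M →ₗ[ℂ] V)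
    (x : M) (y : Mᵐᵒᵖ) : slice φ T (x ⊗ₜ[ℂ] y) = φ y.unop • T x := rfl

theorem slice_mul {V : Type*} [AddCommGroup V] [Module ℂ V] (φ : M →ₗ[ℂ] ℂ) (T : M →ₗ[ℂ] V)
    (x : M) (f : V →ₗ[ℂ] V) (hf : ∀ y, T (x * y) = f (T y)) (z : M ⊗[ℂ] Mᵐᵒᵖ) :
    slice φ T ((x ⊗ₜ[ℂ] 1) * z) = f (slice φ T z) := by
  induction z with
  | zero => rw [mul_zero, map_zero, map_zero]
  | tmul b c =>
    rw [Algebra.TensorProduct.tmul_mul_tmul, one_mul, slice_tmul, slice_tmul, map_smul, hf]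
  | add x y hx hy => rw [mul_add, map_add, map_add, hx, hy, map_add]

theorem slice_diffWord_nil {V : Type*} [AddCommGroup V] [Module ℂ V] (φ : M →ₗ[ℂ] ℂ)
    (T : M →ₗ[ℂ] V) : slice φ T (diffWord a c []) = 0 := by
  rw [diffWord, map_zero]

theorem slice_diffWord_cons {V : Type*} [AddCommGroup V] [Module ℂ V] (φ : M →ₗ[ℂ] ℂ)
    (T : M →ₗ[ℂ] V) (l : ι) (f : V →ₗ[ℂ] V) (hf : ∀ y, T (a l * y) = f (T y)) (w : List ι) :
    slice φ T (diffWord a c (l :: w)) =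
      f (slice φ T (diffWord a c w)) + (c l * φ (w.map a).prod) • T 1 := by
  rw [diffWord, map_add, slice_mul φ T _ f hf, map_smul, slice_tmul, MulOpposite.unop_op,
    smul_smul]

end Leibniz

end Words

namespace Data

open Words

section Polynomials

variable {E : Type*} [NormedAddCommGroup E] [InnerProductSpace ℝ E] [FiniteDimensional ℝ E]
  {N : Type*} [Fintype N] (S : Data E N) {d : ℕ} (e : OrthonormalBasis (Fin d) ℂ S.HU)
  {j : Fin d → N}

/-! ### The algebra generated by the `W(e_k)` -/

/-- The algebra `ℂ[A_1, …, A_d]` for `A_k = W(e_k)`. -/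
abbrev poly : StarSubalgebra ℂ S.M := S.polyAlg fun k => S.W (e k)

/-- The generator `A_l` as an element of `ℂ[A_1, …, A_d]`. -/
def gen (l : Fin d) : S.poly e := ⟨S.W (e l), S.mem_polyAlg _ l⟩

/-- The monomial in the generators given by a word. -/
def monomial (w : List (Fin d)) : S.poly e := (w.map (S.gen e)).prod

theorem monomial_nil : S.monomial e [] = 1 := rfl

theorem monomial_cons (l : Fin d) (w : List (Fin d)) :
    S.monomial e (l :: w) = S.gen e l * S.monomial e w := by simp [monomial]

theorem monomial_append (v w : List (Fin d)) :
    S.monomial e (v ++ w) = S.monomial e v * S.monomial e w := by simp [monomial]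

/-- The polynomial in the generators with given coefficients. -/
def polyOfWords : Words (Fin d) →ₗ[ℂ] S.poly e := Words.ext (S.monomial e)

theorem vacuum_eq : S.vacuum = S.toFock (S.wordFock e (word [])) := by
  rw [wordFock_word]; rfl

theorem monomial_vacuum (hj : ∀ k, e k ∈ S.colour (j k)) (w : List (Fin d)) :
    ((S.monomial e w : S.M) : S.Fock →L[ℂ] S.Fock) S.vacuum =
      S.toFock (S.wordFock e (wick (S.letterCov e) (S.letterQ j) w)) := by
  induction w with
  | nil => exact S.vacuum_eq e
  | cons l w ih =>
    have h : ((S.monomial e (l :: w) : S.M) : S.Fock →L[ℂ] S.Fock) S.vacuum =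
        (S.W (e l) : S.Fock →L[ℂ] S.Fock)
          (((S.monomial e w : S.M) : S.Fock →L[ℂ] S.Fock) S.vacuum) := by
      rw [monomial_cons]; rfl
    rw [h, ih, S.W_toFock e hj]
    rfl

theorem polyOfWords_vacuum (hj : ∀ k, e k ∈ S.colour (j k)) (x : Words (Fin d)) :
    ((S.polyOfWords e x : S.M) : S.Fock →L[ℂ] S.Fock) S.vacuum =
      S.toFock (S.wordFock e (Words.ext (wick (S.letterCov e) (S.letterQ j)) x)) := by
  let f : S.poly e →ₗ[ℂ] S.Fock :=
    { toFun := fun a => ((a : S.M) : S.Fock →L[ℂ] S.Fock) S.vacuum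
      map_add' := fun _ _ => rfl
      map_smul' := fun _ _ => rfl }
  refine hom_congr (f := f ∘ₗ S.polyOfWords e) (g := S.toFock.toLinearMap ∘ₗ S.wordFock e ∘ₗ
    Words.ext (wick (S.letterCov e) (S.letterQ j))) (fun w => ?_) x
  simp only [LinearMap.comp_apply, polyOfWords, ext_word]
  exact S.monomial_vacuum e hj w

theorem inner_vacuum (hj : ∀ k, e k ∈ S.colour (j k)) (x : Words (Fin d)) :
    ⟪S.vacuum, S.toFock (S.wordFock e x)⟫_ℂ = vac x := by
  rw [S.vacuum_eq e, LinearIsometry.inner_map_map]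
  refine hom_congr (f := innerₛₗ ℂ (S.wordFock e (word [])) ∘ₗ S.wordFock e) (g := vac)
    (fun w => ?_) x
  simpa [contracts] using S.inner_wordVec e hj [] w

theorem wordFock_injective : Function.Injective (S.wordFock e) := by
  rw [← LinearMap.ker_eq_bot, LinearMap.ker_eq_bot']
  intro x hx
  have hli : LinearIndependent ℂ fun w : List (Fin d) =>
      e.toBasis.tensorAlgebra (FreeMonoid.ofList w) :=
    e.toBasis.tensorAlgebra.linearIndependent.comp _ FreeMonoid.ofList.injective
  refine linearIndependent_iff.mp hli x ?_
  have h : S.wordVec e = fun w : List (Fin d) => e.toBasis.tensorAlgebra (FreeMonoid.ofList w) :=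
    funext (S.wordVec_eq_basis e)
  rw [wordFock, Words.ext, h] at hx
  exact hx

/-- The monomials are a basis of `ℂ[A_1, …, A_d]`: they are independent since the leading terms of
their vacuum vectors are, and they span since the span of the generators is closed under the
involution. -/
theorem polyOfWords_bijective (hj : ∀ k, e k ∈ S.colour (j k)) :
    Function.Bijective (S.polyOfWords e) := by
  constructor
  · rw [← LinearMap.ker_eq_bot, LinearMap.ker_eq_bot']
    intro x hx
    have h := S.polyOfWords_vacuum e hj x
    rw [hx] at h
    have h2 : S.toFock (S.wordFock e (Words.ext (wick (S.letterCov e) (S.letterQ j)) x)) = 0 :=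
      h.symm
    have h3 := S.wordFock_injective e
      ((S.toFock.injective (h2.trans (map_zero _).symm)).trans (map_zero (S.wordFock e)).symm)
    exact ext_wick_injective _ _ (h3.trans (map_zero _).symm)
  · have hcl : ∀ z ∈ Submonoid.closure (Set.range fun k => S.W (e k)),
        ∃ w, (S.monomial e w : S.M) = z := by
      intro z hz
      induction hz using Submonoid.closure_induction with
      | mem z hz =>
        obtain ⟨l, rfl⟩ := hz
        exact ⟨[l], by rw [monomial_cons, monomial_nil, mul_one]; rfl⟩
      | one => exact ⟨[], rfl⟩
      | mul a b _ _ ha hb =>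
        obtain ⟨v, rfl⟩ := ha
        obtain ⟨w, rfl⟩ := hb
        exact ⟨v ++ w, by rw [monomial_append]; rfl⟩
    have hspan : ∀ z ∈ Submodule.span ℂ
        (Submonoid.closure (Set.range fun k => S.W (e k)) : Set S.M),
        ∃ x, (S.polyOfWords e x : S.M) = z := by
      intro z hz
      induction hz using Submodule.span_induction with
      | mem z hz =>
        obtain ⟨w, rfl⟩ := hcl z hz
        exact ⟨word w, by simp [polyOfWords]⟩
      | zero => exact ⟨0, by simp⟩
      | add a b _ _ ha hb =>
        obtain ⟨x, rfl⟩ := ha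
        obtain ⟨y, rfl⟩ := hb
        exact ⟨x + y, by simp⟩
      | smul c a _ ha =>
        obtain ⟨x, rfl⟩ := ha
        exact ⟨c • x, by simp⟩
    have hle : (S.poly e).toSubalgebra ≤ Algebra.adjoin ℂ (Set.range fun k => S.W (e k)) := by
      change (StarAlgebra.adjoin ℂ (Set.range fun k => S.W (e k))).toSubalgebra ≤ _
      rw [StarAlgebra.adjoin_toSubalgebra, Algebra.adjoin_le_iff]
      refine Set.union_subset Algebra.subset_adjoin ?_
      intro z hz
      obtain ⟨l, hl⟩ := hz
      have hz' : z = star (S.W (e l)) := by rw [← star_star z, ← hl]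
      rw [hz', S.star_W e hj]
      refine Subalgebra.sum_mem _ fun k _ => ?_
      have hk : S.W (e k) ∈ Set.range fun k => S.W (e k) := ⟨k, rfl⟩
      exact Subalgebra.smul_mem _ (Algebra.subset_adjoin hk) _
    intro z
    have hz := hle z.2
    rw [← Subalgebra.mem_toSubmodule, Algebra.adjoin_eq_span] at hz
    obtain ⟨x, hx⟩ := hspan _ hz
    exact ⟨x, Subtype.ext hx⟩

/-! ### The difference quotients -/

theorem state_gen (hj : ∀ k, e k ∈ S.colour (j k)) (l k : Fin d) :
    S.state (S.W (e l) * S.W (e k)) = S.letterCov e l k := by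
  have h := S.monomial_vacuum e hj [l, k]
  have h2 : S.state (S.W (e l) * S.W (e k)) = ⟪S.vacuum, S.toFock (S.wordFock e
      (wick (S.letterCov e) (S.letterQ j) [l, k]))⟫_ℂ := by
    rw [← h]
    simp only [monomial_cons, monomial_nil, mul_one]
    rfl
  rw [h2, S.inner_vacuum e hj]
  simp [wick, mulGen_apply]

/-- The value of the difference quotient `∂_k` on a monomial. -/
abbrev partialWord (k : Fin d) : List (Fin d) → S.M ⊗[ℂ] S.Mᵐᵒᵖ :=
  diffWord (fun l => S.W (e l)) fun l => S.letterCov e l k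

theorem coe_monomial (w : List (Fin d)) :
    (S.monomial e w : S.M) = (w.map fun l => S.W (e l)).prod := by
  induction w with
  | nil => rfl
  | cons l w ih => rw [monomial_cons, List.map_cons, List.prod_cons, ← ih]; rfl

/-- The words as coordinates of the algebra generated by the `W(e_k)`. -/
def polyEquiv (hj : ∀ k, e k ∈ S.colour (j k)) : Words (Fin d) ≃ₗ[ℂ] S.poly e :=
  LinearEquiv.ofBijective (S.polyOfWords e) (S.polyOfWords_bijective e hj)

/-- The quasi-free difference quotient `∂_k`, defined by its values on the basis of monomials. -/
def diffQuotient (hj : ∀ k, e k ∈ S.colour (j k)) (k : Fin d) :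
    S.poly e →ₗ[ℂ] S.M ⊗[ℂ] S.Mᵐᵒᵖ :=
  Words.ext (S.partialWord e k) ∘ₗ (S.polyEquiv e hj).symm.toLinearMap

theorem diffQuotient_polyOfWords (hj : ∀ k, e k ∈ S.colour (j k)) (k : Fin d)
    (x : Words (Fin d)) :
    S.diffQuotient e hj k (S.polyOfWords e x) = Words.ext (S.partialWord e k) x := by
  change Words.ext (S.partialWord e k) ((S.polyEquiv e hj).symm (S.polyEquiv e hj x)) = _
  rw [LinearEquiv.symm_apply_apply]

theorem diffQuotient_monomial (hj : ∀ k, e k ∈ S.colour (j k)) (k : Fin d) (w : List (Fin d)) :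
    S.diffQuotient e hj k (S.monomial e w) = S.partialWord e k w := by
  have := S.diffQuotient_polyOfWords e hj k (word w)
  simpa [polyOfWords] using this

/-- Linear maps which agree on the monomials are equal. -/
theorem poly_hom_ext (hj : ∀ k, e k ∈ S.colour (j k)) {V : Type*} [AddCommMonoid V] [Module ℂ V]
    {f g : S.poly e →ₗ[ℂ] V} (h : ∀ w, f (S.monomial e w) = g (S.monomial e w)) : f = g := by
  have h1 : f ∘ₗ S.polyOfWords e = g ∘ₗ S.polyOfWords e :=
    hom_ext fun w => by simpa [polyOfWords] using h w
  refine LinearMap.ext fun x => ?_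
  obtain ⟨y, rfl⟩ := (S.polyOfWords_bijective e hj).2 x
  exact LinearMap.congr_fun h1 y

theorem isDifferenceQuotient (hj : ∀ k, e k ∈ S.colour (j k)) (k : Fin d) :
    S.IsDifferenceQuotient (fun k => S.W (e k)) k (S.diffQuotient e hj k) where
  leibniz := leibniz_of_diffWord (S.poly e).subtype.toAlgHom (S.monomial e) (S.coe_monomial e)
    (S.monomial_append e) (fun _ _ h => S.poly_hom_ext e hj h) _ (S.diffQuotient_monomial e hj k)
  apply_gen l := by
    have h := S.diffQuotient_monomial e hj k [l]
    have h2 : S.monomial e [l] = S.gen e l := by rw [monomial_cons, monomial_nil, mul_one]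
    rw [h2] at h
    refine h.trans ?_
    rw [S.state_gen e hj]
    exact diffWord_singleton l

theorem differenceQuotient_unique (hj : ∀ k, e k ∈ S.colour (j k)) (k : Fin d)
    (δ : S.poly e →ₗ[ℂ] S.M ⊗[ℂ] S.Mᵐᵒᵖ)
    (hδ : S.IsDifferenceQuotient (fun k => S.W (e k)) k δ) : δ = S.diffQuotient e hj k := by
  refine S.poly_hom_ext e hj fun w => ?_
  rw [diffQuotient_monomial]
  refine eq_diffWord_of_leibniz (S.poly e).subtype.toAlgHom (S.gen e) (fun _ => rfl) δ hδ.leibniz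
    (fun l => ?_) w
  rw [← S.state_gen e hj]
  exact hδ.apply_gen l

/-- The evaluation `x ↦ x Ω`. -/
def vacuumMap : S.M →ₗ[ℂ] S.Fock where
  toFun x := (x : S.Fock →L[ℂ] S.Fock) S.vacuum
  map_add' _ _ := rfl
  map_smul' _ _ := rfl

/-- The map `a ⊗ bᵒᵖ ↦ φ(b) a Ω`. -/
def evalRight : S.M ⊗[ℂ] S.Mᵐᵒᵖ →ₗ[ℂ] S.Fock := slice S.state S.vacuumMap

theorem inner_evalRight (z : S.M ⊗[ℂ] S.Mᵐᵒᵖ) :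
    ⟪S.vacuum, S.evalRight z⟫_ℂ = S.stateTensor z := by
  induction z with
  | zero => rw [map_zero, map_zero, inner_zero_right]
  | tmul a b =>
    rw [evalRight, slice_tmul, inner_smul_right, mul_comm]
    rfl
  | add x y hx hy => rw [map_add, inner_add_right, hx, hy, map_add]

/-- The dual variable computes `(id ⊗ φ) ∘ ∂_k` in the vacuum: both sides satisfy the same recursion
in the first letter, by the commutation relation `mulGen_dual`. -/
theorem evalRight_partialWord (hj : ∀ k, e k ∈ S.colour (j k)) (k : Fin d) (w : List (Fin d)) :
    S.evalRight (S.partialWord e k w) = S.toFock (S.wordFock e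
      (Words.dual (S.letterCov e) (S.letterQ j) k (wick (S.letterCov e) (S.letterQ j) w))) := by
  induction w with
  | nil =>
    refine (slice_diffWord_nil _ _).trans ?_
    rw [wick, Words.dual, LinearMap.flip_apply, dualAux_nil, LinearMap.zero_apply, map_zero,
      map_zero]
  | cons l w ih =>
    have h : S.state (w.map fun l => S.W (e l)).prod =
        vac (wick (S.letterCov e) (S.letterQ j) w) := by
      rw [← S.coe_monomial, ← S.inner_vacuum e hj, ← S.monomial_vacuum e hj]
      rfl
    have h1 : S.vacuumMap 1 = S.toFock (S.wordFock e (word [])) := S.vacuum_eq e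
    refine (slice_diffWord_cons S.state S.vacuumMap l
      (S.W (e l) : S.Fock →L[ℂ] S.Fock).toLinearMap (fun y => rfl) w).trans ?_
    have ih' : slice S.state S.vacuumMap (diffWord (fun l => S.W (e l))
      (fun l => S.letterCov e l k) w) = _ := ih
    rw [ih', ContinuousLinearMap.coe_coe, S.W_toFock e hj, h, h1, wick,
      mulGen_dual _ (S.letterQ_symm j) (S.letterQ_eq_of_cov e hj), map_add, map_add, map_smul,
      map_smul]

/-- If a vector represents the functional `e_w ↦ ⟪Ω, D_k e_w⟫`, then it is conjugate to `∂_k`. -/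
theorem inner_eq_stateTensor (hj : ∀ k, e k ∈ S.colour (j k)) (k : Fin d) (ξ : S.Fock)
    (hξ : ∀ w, ⟪ξ, S.toFock (S.wordVec e w)⟫_ℂ =
      vac (Words.dual (S.letterCov e) (S.letterQ j) k (word w))) (x : S.poly e) :
    ⟪ξ, ((x : S.M) : S.Fock →L[ℂ] S.Fock) S.vacuum⟫_ℂ =
      S.stateTensor (S.diffQuotient e hj k x) := by
  obtain ⟨x, rfl⟩ := (S.polyOfWords_bijective e hj).2 x
  rw [S.polyOfWords_vacuum e hj, diffQuotient_polyOfWords]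
  have h1 : ∀ y, ⟪ξ, S.toFock (S.wordFock e y)⟫_ℂ =
      vac (Words.dual (S.letterCov e) (S.letterQ j) k y) := fun y =>
    hom_congr (f := innerₛₗ ℂ ξ ∘ₗ S.toFock.toLinearMap ∘ₗ S.wordFock e)
      (g := vac ∘ₗ Words.dual (S.letterCov e) (S.letterQ j) k)
      (fun w => by simpa using hξ w) y
  rw [h1]
  refine hom_congr (f := vac ∘ₗ Words.dual (S.letterCov e) (S.letterQ j) k ∘ₗ
      Words.ext (wick (S.letterCov e) (S.letterQ j)))
    (g := S.stateTensor ∘ₗ Words.ext (S.partialWord e k)) (fun w => ?_) x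
  simp only [LinearMap.comp_apply, ext_word]
  rw [← inner_evalRight, S.evalRight_partialWord e hj, S.inner_vacuum e hj]

end Polynomials

end Data
end MixedQAW
end

noncomputable section

namespace MixedQAW

/-! ### The pairings which contribute to the vacuum component of `D_α e_w` -/

namespace Data

open Words

/-- The `i`-th vertex of `{0, …, 2m + 1}`. -/
def low {m : ℕ} (i : Fin (m + 1)) : Fin (m + 1 + m + 1) := Fin.castAdd (m + 1) i

/-- The vertex `m + 1 + i` of `{0, …, 2m + 1}`. -/
def high {m : ℕ} (i : Fin (m + 1)) : Fin (m + 1 + m + 1) := Fin.natAdd (m + 1) i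

theorem low_zero {m : ℕ} : (low 0 : Fin (m + 1 + m + 1)) = 0 := rfl

theorem val_high {m : ℕ} (i : Fin (m + 1)) : (high i : ℕ) = m + 1 + i := Fin.val_natAdd _ _

theorem low_or_high {m : ℕ} {P : Fin (m + 1 + m + 1) → Prop} (h1 : ∀ i, P (low i))
    (h2 : ∀ i, P (high i)) (l : Fin (m + 1 + m + 1)) : P l :=
  Fin.addCases (m := m + 1) (n := m + 1) (motive := P) h1 h2 l

theorem prod_low_high {m : ℕ} {R : Type*} [CommMonoid R] (f : Fin (m + 1 + m + 1) → R) :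
    ∏ l, f l = (∏ i, f (low i)) * ∏ i, f (high i) :=
  Fin.prod_univ_add (a := m + 1) (b := m + 1) f

theorem low_lt_high {m : ℕ} (i k : Fin (m + 1)) : low i < high k :=
  Fin.lt_def.mpr (i.isLt.trans_le ((Nat.le_add_right _ _).trans_eq (val_high k).symm))

theorem low_lt_low {m : ℕ} {i k : Fin (m + 1)} : low i < low k ↔ i < k := Iff.rfl

theorem high_lt_high {m : ℕ} {i k : Fin (m + 1)} : high i < high k ↔ i < k := by
  rw [Fin.lt_def, val_high, val_high, Fin.lt_def, Nat.add_lt_add_iff_left]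

theorem low_injective {m : ℕ} : Function.Injective (low (m := m)) :=
  Fin.castAdd_injective _ _

theorem high_injective {m : ℕ} : Function.Injective (high (m := m)) :=
  Fin.natAdd_injective _ _

/-- The pairing of `{0, …, 2m + 1}` with pairs `{i, m + 1 + σ i}`. -/
def pairPerm {m : ℕ} (σ : Equiv.Perm (Fin (m + 1))) : Equiv.Perm (Fin (m + 1 + m + 1)) :=
  (finSumFinEquiv (m := m + 1) (n := m + 1)).permCongr
    ((Equiv.sumComm _ _).trans (Equiv.sumCongr σ.symm σ))

theorem pairPerm_low {m : ℕ} (σ : Equiv.Perm (Fin (m + 1))) (i : Fin (m + 1)) :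
    pairPerm σ (low i) = high (σ i) := by
  rw [pairPerm, low, Equiv.permCongr_apply, finSumFinEquiv_symm_apply_castAdd]
  rfl

theorem pairPerm_high {m : ℕ} (σ : Equiv.Perm (Fin (m + 1))) (i : Fin (m + 1)) :
    pairPerm σ (high i) = low (σ.symm i) := by
  rw [pairPerm, high, Equiv.permCongr_apply, finSumFinEquiv_symm_apply_natAdd]
  rfl

theorem pairPerm_ne {m : ℕ} (σ : Equiv.Perm (Fin (m + 1))) (l : Fin (m + 1 + m + 1)) :
    pairPerm σ l ≠ l := by
  refine low_or_high (P := fun l => pairPerm σ l ≠ l) (fun i => ?_) (fun i => ?_) l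
  · rw [pairPerm_low]
    exact (low_lt_high _ _).ne'
  · rw [pairPerm_high]
    exact (low_lt_high _ _).ne

theorem pairPerm_injective {m : ℕ} : Function.Injective (pairPerm (m := m)) := fun σ τ h =>
  Equiv.ext fun i => by
    have := congrArg (fun π => π (low i)) h
    simp only [pairPerm_low] at this
    exact high_injective this

theorem pairPerm_zero {m : ℕ} (τ : Equiv.Perm (Fin m)) :
    pairPerm (permInsert 0 τ) 0 = high 0 := by
  rw [← low_zero, pairPerm_low, permInsert_zero]

theorem pairPerm_mem {m : ℕ} (τ : Equiv.Perm (Fin m)) :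
    pairPerm (permInsert 0 τ) ∈ partitions (m + 1 + m) := by
  rw [partitions, Finset.mem_filter, pairPerm_zero]
  refine ⟨Finset.mem_univ _, Equiv.ext fun i => ?_,
    low_lt_high (0 : Fin (m + 1)) 0, ?_, ?_⟩
  · refine low_or_high (P := fun i => (pairPerm (permInsert 0 τ) *
      pairPerm (permInsert 0 τ)) i = (1 : Equiv.Perm (Fin (m + 1 + m + 1))) i) (fun i => ?_) (fun i => ?_) i
    · rw [Equiv.Perm.mul_apply, pairPerm_low, pairPerm_high, Equiv.symm_apply_apply]
      rfl
    · rw [Equiv.Perm.mul_apply, pairPerm_high, pairPerm_low, Equiv.apply_symm_apply]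
      rfl
  · refine low_or_high (fun i hi _ => ?_) (fun i _ hi => ?_)
    · rw [pairPerm_low, high_lt_high, Fin.pos_iff_ne_zero]
      intro h
      have hi0 := (permInsert 0 τ).injective (h.trans (permInsert_zero 0 τ).symm)
      subst hi0
      exact lt_irrefl _ hi
    · rw [high_lt_high] at hi
      exact absurd hi (Fin.not_lt_zero i)
  · refine low_or_high (fun i hi => ?_) (fun i _ => Or.inr ?_)
    · exact absurd hi (low_lt_high i 0).not_gt
    · rw [pairPerm_high]
      exact low_lt_high _ _

theorem apply_of_mem_partitions {n : ℕ} {π : Equiv.Perm (Fin (n + 1))} (hπ : π ∈ partitions n) :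
    (∀ l, π (π l) = l) ∧ (∀ l, l < π 0 → π 0 ≤ π l) ∧ ∀ l, π l ≠ l → π 0 ≤ l → π l < π 0 := by
  obtain ⟨-, h1, h2, h3, h4⟩ := Finset.mem_filter.mp hπ
  have hinv : ∀ l, π (π l) = l := fun l => congrArg (fun τ => τ l) h1
  refine ⟨hinv, fun l hl => ?_, fun l hl hle => ?_⟩
  · rcases eq_or_ne l 0 with rfl | h
    · exact le_rfl
    · exact (h3 l (Fin.pos_iff_ne_zero.mpr h) hl).le
  · rcases hle.eq_or_lt with rfl | h
    · rw [hinv]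
      exact h2
    · exact (h4 l h).resolve_left hl

/-- A pairing without singletons in `B(n + 1)` matches the `π 0` first vertices with the others. -/
theorem two_mul_of_mem {n : ℕ} {π : Equiv.Perm (Fin (n + 1))} (hπ : π ∈ partitions n)
    (hf : ∀ l, π l ≠ l) : 2 * (π 0 : ℕ) = n + 1 := by
  obtain ⟨h1, h2, h3⟩ := apply_of_mem_partitions hπ
  have h : (Finset.Iio (π 0)).map π.toEmbedding = Finset.Ici (π 0) := by
    ext l
    simp only [Finset.mem_map_equiv, Finset.mem_Iio, Finset.mem_Ici]
    have hs : π.symm l = π l := by rw [Equiv.symm_apply_eq, h1]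
    rw [hs]
    exact ⟨fun hl => by simpa only [h1] using h2 _ hl, h3 l (hf l)⟩
  have := congrArg Finset.card h
  rw [Finset.card_map, Fin.card_Iio, Fin.card_Ici] at this
  have hlt := (π 0).isLt
  omega

/-- The pairings without singletons of `2m + 2` vertices are the `pairPerm σ` with `σ 0 = 0`. -/
theorem exists_pairPerm {m : ℕ} {π : Equiv.Perm (Fin (m + 1 + m + 1))}
    (hπ : π ∈ partitions (m + 1 + m)) (hf : ∀ l, π l ≠ l) :
    ∃ τ : Equiv.Perm (Fin m), pairPerm (permInsert 0 τ) = π := by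
  obtain ⟨h1, h2, h3⟩ := apply_of_mem_partitions hπ
  have h0 : π 0 = high 0 := by
    have := two_mul_of_mem hπ hf
    refine Fin.ext ?_
    rw [val_high, Fin.val_zero]
    omega
  have hhigh : ∀ l : Fin (m + 1 + m + 1), high 0 ≤ l → ∃ k : Fin (m + 1), l = high k :=
    low_or_high (fun i h => absurd h (low_lt_high i 0).not_ge) fun i _ => ⟨i, rfl⟩
  have hge : ∀ i : Fin (m + 1), ∃ k : Fin (m + 1), π (low i) = high k := fun i =>
    hhigh _ (h0 ▸ h2 (low i) (h0 ▸ low_lt_high i 0))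
  choose f hfk using hge
  have hinj : Function.Injective f := fun i i' h => by
    have := (hfk i).trans ((congrArg _ h).trans (hfk i').symm)
    exact low_injective (π.injective this)
  let σ : Equiv.Perm (Fin (m + 1)) := Equiv.ofBijective f (Finite.injective_iff_bijective.mp hinj)
  obtain ⟨⟨k, τ⟩, hkτ⟩ := (permInsert_bijective m).2 σ
  have hk : k = 0 := by
    have h4 : permInsert k τ 0 = σ 0 := congrArg (fun σ => σ 0) hkτ
    rw [permInsert_zero] at h4
    exact h4.trans (high_injective ((hfk 0).symm.trans h0))
  subst hk
  refine ⟨τ, ?_⟩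
  have hσ : permInsert 0 τ = σ := hkτ
  rw [hσ]
  refine Equiv.ext (low_or_high (fun i => ?_) fun i => ?_)
  · rw [pairPerm_low]
    exact (hfk i).symm
  · obtain ⟨i, rfl⟩ := σ.surjective i
    rw [pairPerm_high, Equiv.symm_apply_apply]
    exact (h1 _).symm.trans (congrArg π (hfk i))

section Weights

variable {E : Type*} [NormedAddCommGroup E] [InnerProductSpace ℝ E] {N : Type*} (S : Data E N)
  {d : ℕ} (j : Fin d → N)

theorem Qweight_pairPerm {m : ℕ} (a : Fin (m + 1 + m + 1) → Fin d) (τ : Equiv.Perm (Fin m)) :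
    (S.Qweight j a (pairPerm (permInsert 0 τ)) : ℂ) =
      (∏ u : Fin (m + 1), ∏ v : Fin (m + 1), if v < u then
        S.letterQ j (a (low u)) (a (low v)) else 1) *
      ∏ i : Fin m, ∏ i' : Fin m, if i < i' ∧ τ i' < τ i then
        S.letterQ j (a (high (τ i).succ)) (a (high (τ i').succ)) else 1 := by
  have hB : ∀ i : Fin (m + 1), ¬ high i < high 0 := fun i h =>
    absurd (high_lt_high.mp h) (Fin.not_lt_zero i)
  have hC : ∀ i k : Fin (m + 1), ¬ high i < low k := fun i k => (low_lt_high k i).not_gt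
  have e3 : (∏ v, ∏ u, if pairPerm (permInsert 0 τ) 0 < v ∧ v < u ∧
      pairPerm (permInsert 0 τ) v = v ∧ pairPerm (permInsert 0 τ) u ≠ u then
        S.q (j (a v)) (j (a u)) else 1) = 1 :=
    Finset.prod_eq_one fun v _ => Finset.prod_eq_one fun u _ =>
      if_neg fun h => pairPerm_ne _ _ h.2.2.1
  rw [Qweight, e3, mul_one, Complex.ofReal_mul, pairPerm_zero]
  congr 1
  · rw [Finset.prod_comm (s := (Finset.univ : Finset (Fin (m + 1)))), prod_low_high]
    simp only [prod_low_high (m := m), low_lt_high, hB, hC, low_lt_low, and_true, and_false,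
      if_false, Finset.prod_const_one, mul_one, Complex.ofReal_prod]
    refine Finset.prod_congr rfl fun v _ => Finset.prod_congr rfl fun u _ => ?_
    split_ifs
    · rw [letterQ, S.q_symm]
    · exact Complex.ofReal_one
  · rw [prod_low_high]
    simp only [prod_low_high (m := m), low_lt_high, hB, hC, low_lt_low, and_false, true_and,
      false_and, if_false, Finset.prod_const_one, mul_one, pairPerm_low, high_lt_high]
    have hz : ∀ i : Fin (m + 1), (0 < low i) ↔ 0 < i := fun i => Iff.rfl
    simp only [hz, Fin.prod_univ_succ (n := m), lt_irrefl, false_and, Fin.succ_pos, true_and,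
      Fin.not_lt_zero, and_false, if_false, one_mul, Finset.prod_const_one, permInsert_succ,
      Fin.succ_lt_succ_iff, Fin.zero_succAbove, Complex.ofReal_prod]
    refine Finset.prod_congr rfl fun v _ => Finset.prod_congr rfl fun u _ => ?_
    split_ifs
    · rfl
    · exact Complex.ofReal_one

variable [FiniteDimensional ℝ E] (e : OrthonormalBasis (Fin d) ℂ S.HU)

theorem Eweight_pairPerm {m : ℕ} (a : Fin (m + 1 + m + 1) → Fin d) (τ : Equiv.Perm (Fin m)) :
    S.Eweight e a (pairPerm (permInsert 0 τ)) =
      S.letterCov e (a (high 0)) (a (low 0)) *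
        ∏ i : Fin m, S.letterCov e (a (high (τ i).succ)) (a (low i.succ)) := by
  have hC : ∀ i k : Fin (m + 1), ¬ high i < low k := fun i k => (low_lt_high k i).not_gt
  rw [Eweight, prod_low_high]
  simp only [pairPerm_low, pairPerm_high, low_lt_high, if_true, hC, if_false,
    Finset.prod_const_one, mul_one]
  rw [Fin.prod_univ_succ, permInsert_zero]
  simp only [permInsert_succ, Fin.zero_succAbove]
  rfl

/-- The sum over the pairings without singletons in `B(n + 1)`. -/
def vacuumCoeff {n : ℕ} (a : Fin (n + 1) → Fin d) : ℂ :=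
  ∑ π ∈ (partitions n).filter fun π => ∀ l, π l ≠ l,
    (-1 : ℂ) ^ ((π 0 : ℕ) - 1) * (S.Qweight j a π : ℂ) * S.Eweight e a π

variable {j}

theorem vacuumCoeff_of_even {n : ℕ} (a : Fin (n + 1) → Fin d) (h : ∀ m, n ≠ 2 * m + 1) :
    S.vacuumCoeff j e a = 0 := by
  refine Finset.sum_eq_zero fun π hπ => ?_
  obtain ⟨h1, h2⟩ := Finset.mem_filter.mp hπ
  have := two_mul_of_mem h1 h2
  exact absurd (by omega) (h ((π 0 : ℕ) - 1))

/-- The sum over the pairings without singletons is the sum over permutations in `vac_dual_ofFn`. -/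
theorem vacuumCoeff_eq (hj : ∀ k, e k ∈ S.colour (j k)) {m : ℕ}
    (a : Fin (m + 1 + m + 1) → Fin d) (α k : Fin d) (x y : Fin m → Fin d)
    (h1 : ∀ i, a (low i) = Fin.cons (α := fun _ => Fin d) α x i)
    (h2 : ∀ i, a (high i) = Fin.cons (α := fun _ => Fin d) k y i) :
    S.vacuumCoeff j e a = vac (Words.dual (S.letterCov e) (S.letterQ j) α
      (word (List.ofFn x ++ k :: List.ofFn y).reverse)) := by
  have hsum : S.vacuumCoeff j e a = ∑ τ : Equiv.Perm (Fin m),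
      (-1 : ℂ) ^ m * (S.Qweight j a (pairPerm (permInsert 0 τ)) : ℂ) *
        S.Eweight e a (pairPerm (permInsert 0 τ)) := by
    symm
    refine Finset.sum_bij (fun τ _ => pairPerm (permInsert 0 τ)) (fun τ _ => ?_)
      (fun τ _ τ' _ h => ?_) (fun π hπ => ?_) fun τ _ => ?_
    · exact Finset.mem_filter.mpr ⟨pairPerm_mem τ, pairPerm_ne _⟩
    · exact congrArg Prod.snd ((permInsert_bijective m).1
        (a₁ := (0, τ)) (a₂ := (0, τ')) (pairPerm_injective h))
    · obtain ⟨h3, h4⟩ := Finset.mem_filter.mp hπ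
      obtain ⟨τ, hτ⟩ := exists_pairPerm h3 h4
      exact ⟨τ, Finset.mem_univ _, hτ⟩
    · rw [pairPerm_zero, val_high]
      congr 3
  rw [hsum, vac_dual_ofFn, permSum]
  simp only [Qweight_pairPerm, Eweight_pairPerm, h1, h2, Fin.cons_zero, Fin.cons_succ]
  rw [Finset.mul_sum, Finset.mul_sum]
  refine Finset.sum_congr rfl fun τ _ => ?_
  -- The crossing weight of the pairing involves the letters `y (τ i)`, `permSum` their partners `x i`: the parameters
  -- agree unless a factor of the covariance vanishes.
  by_cases h0 : ∃ i, S.letterCov e (y (τ i)) (x i) = 0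
  · obtain ⟨i, hi⟩ := h0
    rw [Finset.prod_eq_zero (f := fun i => S.letterCov e (y (τ i)) (x i)) (Finset.mem_univ i) hi]
    simp
  · have h3 : ∀ i, S.letterQ j (y (τ i)) = S.letterQ j (x i) := fun i =>
      S.letterQ_eq_of_cov e hj _ _ fun h => h0 ⟨i, h⟩
    simp only [h3]
    ring

theorem vacuumCoeff_letters (α : Fin d) {n : ℕ} (w : List (Fin d)) (hn : w.length = n)
    (a : Fin (n + 1) → Fin d) (ha : List.ofFn a = α :: w.reverse) :
    S.vacuumCoeff j e (letters α w) = S.vacuumCoeff j e a := by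
  subst hn
  have h : letters α w = a := by
    refine List.ofFn_injective (?_ : List.ofFn (letters α w) = List.ofFn a)
    rw [ha]
    refine List.ext_getElem (by simp) fun i h1 h2 => ?_
    rw [List.getElem_ofFn]
    rfl
  rw [h]

theorem exists_ofFn {m : ℕ} (w : List (Fin d)) (hw : w.length = 2 * m + 1) :
    ∃ (x y : Fin m → Fin d) (k : Fin d), w = (List.ofFn x ++ k :: List.ofFn y).reverse := by
  have hm : m < w.reverse.length := by rw [List.length_reverse]; omega
  have hof : ∀ (l : List (Fin d)), l.length = m → ∃ x : Fin m → Fin d, l = List.ofFn x := by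
    rintro l rfl
    exact ⟨l.get, (List.ofFn_get l).symm⟩
  obtain ⟨x, hx⟩ := hof (w.reverse.take m) (by rw [List.length_take]; omega)
  obtain ⟨y, hy⟩ := hof (w.reverse.drop (m + 1)) (by
    rw [List.length_drop, List.length_reverse]; omega)
  refine ⟨x, y, w.reverse[m], ?_⟩
  rw [← hx, ← hy, ← List.drop_eq_getElem_cons hm, List.take_append_drop, List.reverse_reverse]

variable [Fintype N]

/-- Only the pairings without singletons contribute to the vacuum component. -/
theorem inner_vacuum_dualOnWord (hj : ∀ k, e k ∈ S.colour (j k)) (α : Fin d)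
    (w : List (Fin d)) : ⟪S.vacuum, S.toFock (S.dualOnWord e j α w)⟫_ℂ =
      S.vacuumCoeff j e (letters α w) := by
  rw [dualOnWord, map_sum, inner_sum, vacuumCoeff, Finset.sum_filter]
  refine Finset.sum_congr rfl fun π _ => ?_
  rw [← wordFock_word, map_smul, inner_smul_right, S.inner_vacuum e hj]
  split_ifs with h
  · have h1 : singletonWord (letters α w) π = [] := by
      simp [singletonWord, h]
    rw [h1, vac_nil, mul_one]
  · obtain ⟨l, hl⟩ := not_forall_not.mp h
    have h1 : singletonWord (letters α w) π ≠ [] := by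
      simpa [singletonWord] using ⟨l, hl⟩
    obtain ⟨k, v, hv⟩ := List.exists_cons_of_ne_nil h1
    rw [hv, vac_cons, mul_zero]

/-- The combinatorial dual variable has the same vacuum component as the recursively defined one. -/
theorem inner_vacuum_dualOnWord_eq (hj : ∀ k, e k ∈ S.colour (j k)) (α : Fin d)
    (w : List (Fin d)) : ⟪S.vacuum, S.toFock (S.dualOnWord e j α w)⟫_ℂ =
      vac (Words.dual (S.letterCov e) (S.letterQ j) α (word w)) := by
  rw [S.inner_vacuum_dualOnWord e hj]
  by_cases h : ∃ m, w.length = 2 * m + 1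
  · obtain ⟨m, hm⟩ := h
    obtain ⟨x, y, k, rfl⟩ := exists_ofFn w hm
    let a : Fin (m + 1 + m + 1) → Fin d := Fin.append (m := m + 1) (n := m + 1)
      (Fin.cons (α := fun _ => Fin d) α x) (Fin.cons (α := fun _ => Fin d) k y)
    rw [S.vacuumCoeff_letters e α _ (n := m + 1 + m) (by rw [hm]; omega) a ?_,
      S.vacuumCoeff_eq e hj a α k x y (Fin.append_left _ _) (Fin.append_right _ _)]
    rw [List.reverse_reverse]
    refine (List.ofFn_fin_append (m := m + 1) (n := m + 1) _ _).trans ?_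
    rw [List.ofFn_succ, List.ofFn_succ]
    simp
  · push Not at h
    rw [vac_dual_of_even _ _ _ _ h, S.vacuumCoeff_of_even e _ h]

end Weights

end Data
end MixedQAW
end

noncomputable section

namespace MixedQAW

/-! ### The vector which represents the vacuum component of `D_α` -/

namespace Words

section Bounds

variable {ι : Type*} {c q : ι → ι → ℂ} {C q₀ : ℝ}

theorem norm_permSum_le (hc : ∀ x y, ‖c x y‖ ≤ C) (hq : ∀ x y, ‖q x y‖ ≤ 1) {m : ℕ}
    (x y : Fin m → ι) : ‖permSum c q x y‖ ≤ m.factorial * C ^ m := by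
  have h : ∀ σ : Equiv.Perm (Fin m), ‖(∏ i, c (x i) (y (σ i))) *
      ∏ i, ∏ i', if i < i' ∧ σ i' < σ i then q (x i) (y (σ i')) else 1‖ ≤ C ^ m := fun σ => by
    have h1 : ‖∏ i, c (x i) (y (σ i))‖ ≤ C ^ m := by
      rw [norm_prod]
      refine (Finset.prod_le_prod (fun _ _ => norm_nonneg _) fun i _ => hc _ _).trans_eq ?_
      rw [Finset.prod_const, Finset.card_univ, Fintype.card_fin]
    have h2 : ‖∏ i, ∏ i', if i < i' ∧ σ i' < σ i then q (x i) (y (σ i')) else 1‖ ≤ 1 := by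
      rw [norm_prod]
      refine Finset.prod_le_one (fun _ _ => norm_nonneg _) fun i _ => ?_
      rw [norm_prod]
      refine Finset.prod_le_one (fun _ _ => norm_nonneg _) fun i' _ => ?_
      split_ifs
      · exact hq _ _
      · exact norm_one.le
    rw [norm_mul]
    exact (mul_le_of_le_one_right (norm_nonneg _) h2).trans h1
  refine (norm_sum_le_of_le _ fun σ _ => h σ).trans_eq ?_
  rw [Finset.sum_const, Finset.card_univ, Fintype.card_perm, Fintype.card_fin, nsmul_eq_mul]

theorem norm_prod_lt_le (hq : ∀ x y, ‖q x y‖ ≤ q₀) {m : ℕ} (x : Fin m → ι) :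
    ‖∏ u, ∏ v, if v < u then q (x u) (x v) else 1‖ ≤ ∏ u ∈ Finset.range m, q₀ ^ u := by
  rw [Finset.prod_range, norm_prod]
  refine Finset.prod_le_prod (fun _ _ => norm_nonneg _) fun u _ => ?_
  rw [Finset.prod_ite, Finset.prod_const_one, mul_one, norm_prod]
  refine (Finset.prod_le_prod (fun _ _ => norm_nonneg _) fun v _ => hq _ _).trans_eq ?_
  have h : Finset.univ.filter (· < u) = Finset.Iio u := by ext v; simp
  rw [Finset.prod_const, h, Fin.card_Iio]

/-- A bound for the vacuum components of the dual variable on words of length `2m + 1`. -/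
def dualBound (C q₀ : ℝ) (m : ℕ) : ℝ :=
  C * ((∏ u ∈ Finset.range (m + 1), q₀ ^ u) * (m.factorial * C ^ m))

theorem norm_vac_dual_le (hc : ∀ x y, ‖c x y‖ ≤ C) (hq : ∀ x y, ‖q x y‖ ≤ q₀) (h0 : 0 ≤ q₀)
    (h1 : q₀ ≤ 1) (a : ι) {m : ℕ} (x y : Fin m → ι) (k : ι) :
    ‖vac (dual c q a (word (List.ofFn x ++ k :: List.ofFn y).reverse))‖ ≤ dualBound C q₀ m := by
  rw [vac_dual_ofFn, norm_mul, norm_mul, norm_mul, norm_pow, norm_neg, norm_one, one_pow, one_mul]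
  have hC : 0 ≤ C := (norm_nonneg _).trans (hc k a)
  have h2 : 0 ≤ ∏ u ∈ Finset.range (m + 1), q₀ ^ u := Finset.prod_nonneg fun _ _ => pow_nonneg h0 _
  refine mul_le_mul (hc k a) (mul_le_mul (norm_prod_lt_le hq _)
    (norm_permSum_le (fun x y => hc y x) (fun x y => (hq x y).trans h1) x y) (norm_nonneg _) h2)
    (by positivity) hC

/-- The factor `q₀ ^ (m (m + 1) / 2)`, which comes from the arcs crossing at the vertices below
`π 0`, beats `m !` and the powers of constants. -/
theorem summable_dualBound {K : ℝ} (hK : 0 < K) (hC : 0 < C) (h0 : 0 < q₀) (h1 : q₀ < 1) :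
    Summable fun m : ℕ => K ^ (2 * m + 1) * dualBound C q₀ m := by
  have hpos : ∀ m, 0 < K ^ (2 * m + 1) * dualBound C q₀ m := fun m => by
    have : 0 < ∏ u ∈ Finset.range (m + 1), q₀ ^ u := Finset.prod_pos fun _ _ => pow_pos h0 _
    unfold dualBound
    positivity
  refine summable_of_ratio_test_tendsto_lt_one zero_lt_one
    (Filter.Eventually.of_forall fun m => (hpos m).ne') ?_
  -- The quotient of successive terms is `K ^ 2 * C * (m + 1) * q₀ ^ (m + 1)`.
  have h2 := ((tendsto_self_mul_const_pow_of_lt_one h0.le h1).comp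
    (Filter.tendsto_add_atTop_nat 1)).const_mul (K ^ 2 * C)
  rw [mul_zero] at h2
  refine h2.congr fun m => ?_
  rw [Real.norm_of_nonneg (hpos _).le, Real.norm_of_nonneg (hpos _).le, eq_div_iff (hpos m).ne']
  simp only [dualBound, Function.comp_apply]
  rw [Finset.prod_range_succ _ (m + 1), Nat.factorial_succ]
  push_cast
  ring

end Bounds

end Words

namespace Data

open Words

section Vector

variable {E : Type*} [NormedAddCommGroup E] [InnerProductSpace ℝ E] [FiniteDimensional ℝ E]
  {N : Type*} (S : Data E N) {d : ℕ} (e : OrthonormalBasis (Fin d) ℂ S.HU) {j : Fin d → N}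

theorem exists_letterCov_bound : ∃ C : ℝ, 0 < C ∧ ∀ k l, ‖S.letterCov e k l‖ ≤ C := by
  obtain ⟨C, hC⟩ := Finite.exists_le fun p : Fin d × Fin d => ‖S.letterCov e p.1 p.2‖
  exact ⟨max C 1, lt_max_of_lt_right one_pos, fun k l => (hC (k, l)).trans (le_max_left _ _)⟩

variable [Fintype N]

/-- The functional `e_w ↦ ⟪Ω, D_α e_w⟫` is bounded on the Fock space: it is represented by the sum
of the vectors which represent it on the words of a fixed odd length. -/
theorem exists_dual_vector (hj : ∀ k, e k ∈ S.colour (j k)) (α : Fin d) :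
    ∃ ξ : S.Fock, ∀ w, ⟪ξ, S.toFock (S.wordVec e w)⟫_ℂ =
      vac (Words.dual (S.letterCov e) (S.letterQ j) α (word w)) := by
  obtain ⟨q₀, h0, h1, hq⟩ := S.exists_q_bound j
  obtain ⟨C, hC, hc⟩ := S.exists_letterCov_bound e
  let g : List (Fin d) → ℂ := fun w =>
    vac (Words.dual (S.letterCov e) (S.letterQ j) α (word w))
  have hg : ∀ m w, w.length = 2 * m + 1 → ‖g w‖ ≤ dualBound C q₀ m := fun m w hw => by
    obtain ⟨x, y, k, rfl⟩ := exists_ofFn w hw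
    exact norm_vac_dual_le hc hq h0.le h1.le α x y k
  have hz : ∀ m, ∃ z : S.FockAlg,
      ‖z‖ ≤ (braidConst q₀ * Fintype.card (Fin d)) ^ (2 * m + 1) * dualBound C q₀ m ∧
      ∀ w, ⟪z, S.wordFock e (word w)⟫_ℂ = if w.length = 2 * m + 1 then g w else 0 := fun m =>
    exists_represent (S.inner_wordVec_nil e hj) (S.inner_wordFock_cons e hj) (S.letterQ_symm j)
      h0.le h1 hq (2 * m + 1) g (hg m)
  choose z hzn hz using hz
  have hb := one_le_braidConst h1
  have hK : 0 < braidConst q₀ * Fintype.card (Fin d) := by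
    have : 0 < Fintype.card (Fin d) := Fintype.card_pos_iff.mpr ⟨α⟩
    positivity
  have hs : Summable fun m => S.toFock (z m) := Summable.of_norm_bounded
    (summable_dualBound hK hC h0 h1) fun m => by
      rw [LinearIsometry.norm_map]
      exact hzn m
  refine ⟨∑' m, S.toFock (z m), fun w => ?_⟩
  have hsum : HasSum (fun m => ⟪S.toFock (S.wordVec e w), S.toFock (z m)⟫_ℂ)
      ⟪S.toFock (S.wordVec e w), ∑' m, S.toFock (z m)⟫_ℂ :=
    hs.hasSum.mapL (innerSL ℂ (S.toFock (S.wordVec e w)))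
  have hterm : ∀ m, ⟪S.toFock (S.wordVec e w), S.toFock (z m)⟫_ℂ =
      if w.length = 2 * m + 1 then conj (g w) else 0 := fun m => by
    rw [LinearIsometry.inner_map_map, ← inner_conj_symm, ← wordFock_word, hz, apply_ite conj,
      map_zero]
  rw [← inner_conj_symm, ← Complex.conj_conj (vac _)]
  refine congrArg conj (hsum.unique ?_)
  by_cases h : ∃ m, w.length = 2 * m + 1
  · obtain ⟨m, hm⟩ := h
    have := hasSum_single (f := fun m => ⟪S.toFock (S.wordVec e w), S.toFock (z m)⟫_ℂ) m
      fun m' hm' => by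
        rw [hterm, if_neg]
        omega
    rwa [hterm, if_pos hm] at this
  · push Not at h
    have h2 : conj (vac (Words.dual (S.letterCov e) (S.letterQ j) α (word w))) = 0 := by
      rw [vac_dual_of_even _ _ _ _ h, map_zero]
    rw [h2]
    have h3 : (fun m => ⟪S.toFock (S.wordVec e w), S.toFock (z m)⟫_ℂ) = fun _ => 0 :=
      funext fun m => by rw [hterm, if_neg (h m)]
    rw [h3]
    exact hasSum_zero

/-- The defining property of `D_α^* Ω`, for the vector `ξ` of `exists_dual_vector`. -/
theorem inner_eq_inner_dualVariable (hj : ∀ k, e k ∈ S.colour (j k)) (α : Fin d) (ξ : S.Fock)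
    (hξ : ∀ w, ⟪ξ, S.toFock (S.wordVec e w)⟫_ℂ =
      vac (Words.dual (S.letterCov e) (S.letterQ j) α (word w)))
    (x : (S.dualVariable e j α).domain) :
    ⟪ξ, (x : S.Fock)⟫_ℂ = ⟪S.vacuum, S.dualVariable e j α x⟫_ℂ := by
  obtain ⟨_, y, rfl⟩ := x
  obtain ⟨y, rfl⟩ := S.wordFock_surjective e y
  have h := S.dualVariable_apply e j α (S.wordFock e y)
  refine Eq.trans ?_ (congrArg (fun v => ⟪S.vacuum, v⟫_ℂ) h.symm)
  refine hom_congr (f := innerₛₗ ℂ ξ ∘ₗ S.toFock.toLinearMap ∘ₗ S.wordFock e)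
    (g := innerₛₗ ℂ S.vacuum ∘ₗ S.toFock.toLinearMap ∘ₗ S.dualAlg e j α ∘ₗ S.wordFock e)
    (fun w => ?_) y
  change ⟪ξ, S.toFock (S.wordFock e (word w))⟫_ℂ =
    ⟪S.vacuum, S.toFock (S.dualAlg e j α (S.wordFock e (word w)))⟫_ℂ
  rw [wordFock_word, dualAlg_wordVec, hξ, S.inner_vacuum_dualOnWord_eq e hj]

end Vector

end Data
end MixedQAW
end

theorem theorem3p3 {E : Type*} [NormedAddCommGroup E] [InnerProductSpace ℝ E]
    [FiniteDimensional ℝ E] {N : Type*} [Fintype N] (S : MixedQAW.Data E N) {d : ℕ}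
    (e : OrthonormalBasis (Fin d) ℂ S.HU) (j : Fin d → N) (hj : ∀ k, e k ∈ S.colour (j k)) :
    ∃ h : ∀ α, S.vacuum ∈ (S.dualVariable e j α).adjoint.domain,
      S.IsConjugateSystem (fun k => S.W (e k))
        (fun α => (S.dualVariable e j α).adjoint ⟨S.vacuum, h α⟩) := by
  choose ξ hξ using S.exists_dual_vector e hj
  have hx := fun α => S.inner_eq_inner_dualVariable e hj α (ξ α) (hξ α)
  have h : ∀ α, S.vacuum ∈ (S.dualVariable e j α).adjoint.domain := fun α =>
    LinearPMap.mem_adjoint_domain_of_exists _ ⟨ξ α, hx α⟩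
  have hdense : ∀ α, Dense ((S.dualVariable e j α).domain : Set S.Fock) :=
    fun _ => S.denseRange_toFock
  have hadj : ∀ α, (S.dualVariable e j α).adjoint ⟨S.vacuum, h α⟩ = ξ α := fun α =>
    LinearPMap.adjoint_apply_eq (hdense α) _ (hx α)
  refine ⟨h, fun k => ⟨S.diffQuotient e hj k, S.isDifferenceQuotient e hj k,
    S.differenceQuotient_unique e hj k, fun x => ?_⟩⟩
  refine (congrArg (fun v => ⟪v, _⟫_ℂ) (hadj k)).trans ?_
  exact S.inner_eq_stateTensor e hj k (ξ k) (hξ k) x
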